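/- **Language.** The basic types are $\mathbf{integer}$, $\mathbf{Boolean}$, $\mathbf{nat}$, $\mathbf{object}$ and possibly further (abstract) basic types; $\mathbf{object}$ denotes an infinite set containing $\mathbf{null}$, and every basic type denotes a nonempty countable set $\mathcal D_T$. There are infinitely many simple variables of each basic type and infinitely many array variables of each higher type $T_1\times\dots\times T_n\to T$ ($n\ge1$). Expressions are built from variables, subscripted variables $a[s_1,\dots,s_n]$, typed constants (including the Boolean connectives, integer and natural number arithmetic, $\mathbf{null}$, equality at every basic type, operations for coding finite sequences of natural numbers, and possibly further constants of arbitrary interpretation) and conditional expressions. Assertions are the first-order formulas built from Boolean expressions by propositional connectives and quantification over simple variables. Statements are $$S::=skip\mid u:=t\mid \bar x:=\bar t\mid S;S\mid \mathbf{if}\,B\,\mathbf{then}\,S\,\mathbf{else}\,S\,\mathbf{fi}\mid \mathbf{if}\,B\to S\,\mathbf{fi}\mid\mathbf{while}\,B\,\mathbf{do}\,S\,\mathbf{od}\mid \mathbf{begin\ local}\,\bar x:=\bar t;S\,\mathbf{end}\mid P(\bar t),$$ with $u$ a simple or subscripted variable and $\bar x$ a sequence of distinct simple variables. The failure statement $\mathbf{if}\,B\to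 S\,\mathbf{fi}$ fails, aborting the execution, if $B$ is false. A block restores its local variables at its end. A recursive program is a main statement $S$ together with a finite set $D$ of procedure declarations $P(\bar u)::S_P$, one for each procedure that is called, all calls being well-typed; a call $P(\bar t)$ is executed as $\mathbf{begin\ local}\,\bar u:=\bar t;S_P\,\mathbf{end}$. It is assumed that no local variable of a block of $S$ or $D$ occurs freely in $S$ or $D$, and that no formal parameter of a procedure occurs freely (as a global variable) in $D$. **States.** For every basic type $T$ fix an array variable $h_T$ of type $\mathbf{nat}\to T$ that does not occur in $S$ or $D$. Only states in which every $h_T$ is a surjection $\mathbb N\to\mathcal D_T$ are considered; $[\![p]\!]$ is the set of these states that satisfy the assertion $p$. $\mathcal M_{sp}[\![S]\!](\sigma)$ is the set of final states of the terminating computations of $S$ started in $\sigma$, with $\mathbf{fail}$ as an additional element if $S$ can fail, and $\models_{sp}\{p\}\,S\,\{q\}$ means $\bigcup_{\sigma\in[\![p]\!]}\mathcal M_{sp}[\![S]\!](\sigma)\subseteq[\![q]\!]$, where $\mathbf{fail}\notin[\![q]\!]$. **Proof systems.** Let $change(\cdot)$ be the set of global variables that can be modified, $var(\cdot)$ the set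 of all variables and $free(\cdot)$ the set of free variables. $SPR$ consists of the following axioms and rules, where implications between assertions count as premises if they are true in all states considered: $\{p\}\,skip\,\{p\}$; $\{p[u:=t]\}\,u:=t\,\{p\}$ ($u$ simple or subscripted); $\{p[\bar x:=\bar t]\}\,\bar x:=\bar t\,\{p\}$; the usual composition, conditional, while and consequence rules; - from $p\to B$ and $\{p\}S\{q\}$ infer $\{p\}\,\mathbf{if}\,B\to S\,\mathbf{fi}\,\{q\}$; - from $\{p\}\,\bar x:=\bar t;S\,\{q\}$ infer $\{p\}\,\mathbf{begin\ local}\,\bar x:=\bar t;S\,\mathbf{end}\,\{q\}$ if $\bar x$ is disjoint from $free(q)$; - from $\{p\}S\{q\}$ and $\{r\}S\{q\}$ infer $\{p\vee r\}S\{q\}$; from $\{p_1\}S\{q_1\}$ and $\{p_2\}S\{q_2\}$ infer $\{p_1\wedge p_2\}S\{q_1\wedge q_2\}$; - from $\{p\}S\{q\}$ infer $\{\exists x:p\}S\{q\}$ if $x\notin var(D)\cup var(S)\cup free(q)$; - from $\{r\}S\{q\}$ infer $\{p\wedge r\}S\{p\wedge q\}$ if $free(p)\cap(change(D)\cup change(S))=\emptyset$;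 - from $\{p\}S\{q\}$ infer $\{p[\bar z:=\bar t]\}S\{q[\bar z:=\bar t]\}$, for distinct simple variables $\bar z$, if $\bar z\cap(var(D)\cup var(S))=\emptyset$ and $var(\bar t)\cap(change(D)\cup change(S))=\emptyset$. $SPR^+$ is $SPR$ extended by the recursion rule: infer $\{p\}S\{q\}$ if there is a finite set $A$ of formulas $\{p_i\}P_i(\bar t_i)\{q_i\}$, $i=1,\dots,n$, such that $A\vdash_{SPR}\{p\}S\{q\}$ and $A\vdash_{SPR}\{p_i\}\,\mathbf{begin\ local}\,\bar u_i:=\bar t_i;S_i\,\mathbf{end}\,\{q_i\}$ for all $i$, where $P_i(\bar u_i)::S_i\in D$. **Theorem (Completeness: Strong Partial Correctness).** For every recursive program with main statement $S$ and declarations $D$ and all assertions $p,q$, $$\models_{sp}\{p\}\,S\,\{q\}\quad\text{implies}\quad\vdash_{SPR^+}\{p\}\,S\,\{q\}.$$ -/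

import Mathlib

/-! # Recursive programs with arrays, failures, blocks and call-by-value procedures

Syntax, structural operational semantics, first-order assertions over the program variables,
and the Hoare-style proof systems `SPR` and `SPR⁺` for strong partial correctness. -/

namespace RecProg

/-! ## Types, languages, models -/

/-- Basic types: integers, Booleans, natural numbers, objects, and further (abstract) basic
types named by the elements of `E`. -/
inductive Ty (E : Type) : Type
  | int : Ty E
  | bool : Ty E
  | nat : Ty E
  | obj : Ty E
  | ext (e : E) : Ty E

/-- A language: names for additional basic types, and additional typed constants; an element of
`Fn n A T` is a constant of type `A 0 × ⋯ × A (n - 1) → T` (of basic type `T` if `n = 0`). -/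
structure Lang where
  Ext : Type
  Fn : (n : ℕ) → (Fin n → Ty Ext) → Ty Ext → Type

/-- The basic types of a language. -/
abbrev Lang.Ty (L : Lang) : Type := RecProg.Ty L.Ext

/-- An interpretation of the additional basic types and of type `obj`, with the void reference
`null`. All values of a type can be enumerated; the other basic types are standard. -/
structure Model (L : Lang) where
  Obj : Type
  null : Obj
  obj_infinite : Infinite Obj
  obj_countable : Countable Obj
  Dom : L.Ext → Type
  dom_nonempty : ∀ e, Nonempty (Dom e)
  dom_countable : ∀ e, Countable (Dom e)

/-- The set of values denoted by a basic type. -/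
abbrev Model.Val {L : Lang} (M : Model L) : L.Ty → Type
  | .int => ℤ
  | .bool => Bool
  | .nat => ℕ
  | .obj => M.Obj
  | .ext e => M.Dom e

/-- An interpretation of the additional typed constants. -/
abbrev Model.Interp {L : Lang} (M : Model L) : Type :=
  ∀ (n : ℕ) (A : Fin n → L.Ty) (T : L.Ty), L.Fn n A T → (∀ i, M.Val (A i)) → M.Val T

/-- The typed constants: Boolean connectives, integer and natural number arithmetic, `null`,
equality at every basic type, the coding of finite sequences of natural numbers
(`seq k` forms the code of a sequence of length `k`, `elem` is the `i`-th element, counted from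
`1`, of the coded sequence, `len` its length), and the additional constants of the language. -/
inductive Op (L : Lang) : (n : ℕ) → (Fin n → L.Ty) → L.Ty → Type
  | tt : Op L 0 (fun _ => .bool) .bool
  | ff : Op L 0 (fun _ => .bool) .bool
  | not : Op L 1 (fun _ => .bool) .bool
  | and : Op L 2 (fun _ => .bool) .bool
  | or : Op L 2 (fun _ => .bool) .bool
  | eq (T : L.Ty) : Op L 2 (fun _ => T) .bool
  | intConst (z : ℤ) : Op L 0 (fun _ => .int) .int
  | intAdd : Op L 2 (fun _ => .int) .int
  | intSub : Op L 2 (fun _ => .int) .int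
  | intMul : Op L 2 (fun _ => .int) .int
  | intLe : Op L 2 (fun _ => .int) .bool
  | natConst (k : ℕ) : Op L 0 (fun _ => .nat) .nat
  | natAdd : Op L 2 (fun _ => .nat) .nat
  | natMul : Op L 2 (fun _ => .nat) .nat
  | natLe : Op L 2 (fun _ => .nat) .bool
  | seq (k : ℕ) : Op L k (fun _ => .nat) .nat
  | elem : Op L 2 (fun _ => .nat) .nat
  | len : Op L 1 (fun _ => .nat) .nat
  | null : Op L 0 (fun _ => .obj) .obj
  | ext {n : ℕ} {A : Fin n → L.Ty} {T : L.Ty} (f : L.Fn n A T) : Op L n A T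

/-- The sequence of natural numbers coded by a natural number; the coding is a bijection. -/
def decodeSeq (n : ℕ) : List ℕ := (Denumerable.eqv (List ℕ)).symm n

open Classical in
/-- The meaning of the typed constants. -/
noncomputable def Op.eval {L : Lang} (M : Model L) (I : M.Interp) :
    {n : ℕ} → {A : Fin n → L.Ty} → {T : L.Ty} → Op L n A T → (∀ i, M.Val (A i)) → M.Val T
  | _, _, _, .tt, _ => true
  | _, _, _, .ff, _ => false
  | _, _, _, .not, v => Bool.not (v 0)
  | _, _, _, .and, v => Bool.and (v 0) (v 1)
  | _, _, _, .or, v => Bool.or (v 0) (v 1)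
  | _, _, _, .eq _, v => decide (v 0 = v 1)
  | _, _, _, .intConst z, _ => z
  | _, _, _, .intAdd, v => Int.add (v 0) (v 1)
  | _, _, _, .intSub, v => Int.sub (v 0) (v 1)
  | _, _, _, .intMul, v => Int.mul (v 0) (v 1)
  | _, _, _, .intLe, v => decide (LE.le (α := ℤ) (v 0) (v 1))
  | _, _, _, .natConst k, _ => k
  | _, _, _, .natAdd, v => Nat.add (v 0) (v 1)
  | _, _, _, .natMul, v => Nat.mul (v 0) (v 1)
  | _, _, _, .natLe, v => decide (LE.le (α := ℕ) (v 0) (v 1))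
  | _, _, _, .seq k, v => Denumerable.eqv (List ℕ) (List.ofFn (n := k) v)
  | _, _, _, .elem, v => (0 :: decodeSeq (v 0)).getD (v 1) 0
  | _, _, _, .len, v => (decodeSeq (v 0)).length
  | _, _, _, .null, _ => M.null
  | _, _, _, .ext f, v => I _ _ _ f v

/-! ## Variables and states -/

/-- Simple variables; there are infinitely many of each basic type. -/
structure SVar (L : Lang) where
  ty : L.Ty
  id : ℕ

/-- Array variables of type `arg 0 × ⋯ × arg n → val`; there are infinitely many of each
higher type. The number of argument types is `n + 1 ≥ 1`. -/
structure AVar (L : Lang) where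
  n : ℕ
  arg : Fin (n + 1) → L.Ty
  val : L.Ty
  id : ℕ

/-- Variables are simple variables or array variables. -/
inductive Var (L : Lang) : Type
  | simple (x : SVar L) : Var L
  | array (a : AVar L) : Var L

/-- Proper states. -/
structure State {L : Lang} (M : Model L) where
  simple : ∀ x : SVar L, M.Val x.ty
  array : ∀ a : AVar L, (∀ i, M.Val (a.arg i)) → M.Val a.val

open Classical in
/-- Simultaneous update of a dependent function at the points `x 0, …, x (n - 1)`, which are
distinct wherever this is used. -/
noncomputable def updMany {X : Type} {F : X → Type} {n : ℕ} (f : ∀ y, F y)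
    (x : Fin n → X) (v : ∀ i, F (x i)) : ∀ y, F y :=
  fun y => if hy : ∃ i, x i = y then hy.choose_spec ▸ v hy.choose else f y

section
variable {L : Lang} {M : Model L}

open Classical in
/-- `σ[x := d]` for a simple variable `x`. -/
noncomputable def State.set (σ : State M) (x : SVar L) (d : M.Val x.ty) : State M :=
  { σ with simple := Function.update σ.simple x d }

/-- `σ[x₁, …, xₙ := d₁, …, dₙ]` for distinct simple variables. -/
noncomputable def State.setMany (σ : State M) {n : ℕ} (x : Fin n → SVar L)
    (d : ∀ i, M.Val (x i).ty) : State M :=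
  { σ with simple := updMany (F := fun y : SVar L => M.Val y.ty) σ.simple x d }

open Classical in
/-- The update of the array variable `a` at the argument `v` to `d`. -/
noncomputable def State.setArr (σ : State M) (a : AVar L) (v : ∀ i, M.Val (a.arg i))
    (d : M.Val a.val) : State M :=
  { σ with array := Function.update σ.array a (Function.update (σ.array a) v d) }

end

/-! ## Expressions -/

/-- Bound variables of type `T` in a context of quantified variables. -/
inductive BVar {L : Lang} : List L.Ty → L.Ty → Type
  | zero {Γ : List L.Ty} {T : L.Ty} : BVar (T :: Γ) T
  | succ {Γ : List L.Ty} {T U : L.Ty} : BVar Γ T → BVar (U :: Γ) T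

/-- Expressions of a basic type. Quantified variables are nameless; the expressions of the
programming language are those in the empty context. -/
inductive Expr (L : Lang) (Γ : List L.Ty) : L.Ty → Type
  | bvar {T : L.Ty} (b : BVar Γ T) : Expr L Γ T
  | var (x : SVar L) : Expr L Γ x.ty
  | arr (a : AVar L) (s : ∀ i, Expr L Γ (a.arg i)) : Expr L Γ a.val
  | op {n : ℕ} {A : Fin n → L.Ty} {T : L.Ty} (f : Op L n A T) (s : ∀ i, Expr L Γ (A i)) :
      Expr L Γ T
  | ite {T : L.Ty} (B : Expr L Γ .bool) (s t : Expr L Γ T) : Expr L Γ T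

/-- Expressions of the programming language. -/
abbrev PExpr (L : Lang) (T : L.Ty) : Type := Expr L [] T

/-- Values of the quantified variables. -/
abbrev Env {L : Lang} (M : Model L) (Γ : List L.Ty) : Type := ∀ T : L.Ty, BVar Γ T → M.Val T

/-- The empty environment. -/
def Env.nil {L : Lang} {M : Model L} : Env M [] := fun _ b => nomatch b

/-- The extension of an environment by a value for the innermost quantified variable. -/
def Env.cons {L : Lang} {M : Model L} {Γ : List L.Ty} {T : L.Ty} (d : M.Val T) (ρ : Env M Γ) :
    Env M (T :: Γ)
  | _, .zero => d
  | _, .succ b => ρ _ b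

section
variable {L : Lang} {M : Model L}

/-- The value of an expression in a state. -/
noncomputable def Expr.eval (I : M.Interp) (σ : State M) {Γ : List L.Ty} (ρ : Env M Γ) :
    {T : L.Ty} → Expr L Γ T → M.Val T
  | _, .bvar b => ρ _ b
  | _, .var x => σ.simple x
  | _, .arr a s => σ.array a (fun i => (s i).eval I σ ρ)
  | _, .op f s => f.eval M I (fun i => (s i).eval I σ ρ)
  | _, .ite B s t => bif B.eval I σ ρ then s.eval I σ ρ else t.eval I σ ρ

/-- The value of an expression of the programming language in a state. -/
noncomputable abbrev State.eval (I : M.Interp) (σ : State M) {T : L.Ty} (t : PExpr L T) :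
    M.Val T :=
  Expr.eval I σ Env.nil t

/-- The simple and array variables in an expression. -/
def Expr.vars {Γ : List L.Ty} : {T : L.Ty} → Expr L Γ T → Set (Var L)
  | _, .bvar _ => ∅
  | _, .var x => {.simple x}
  | _, .arr a s => {.array a} ∪ ⋃ i, (s i).vars
  | _, .op _ s => ⋃ i, (s i).vars
  | _, .ite B s t => B.vars ∪ s.vars ∪ t.vars

/-- An expression of the programming language, in the scope of quantifiers. -/
def Expr.lift {Γ : List L.Ty} : {T : L.Ty} → PExpr L T → Expr L Γ T
  | _, .bvar b => nomatch b
  | _, .var x => .var x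
  | _, .arr a s => .arr a (fun i => (s i).lift)
  | _, .op f s => .op f (fun i => (s i).lift)
  | _, .ite B s t => .ite B.lift s.lift t.lift

/-- The conjunction of finitely many Boolean expressions. -/
def Expr.conj {Γ : List L.Ty} : {n : ℕ} → (Fin n → Expr L Γ .bool) → Expr L Γ .bool
  | 0, _ => .op .tt (fun i => i.elim0)
  | _ + 1, B => .op .and ![B 0, Expr.conj (fun i => B i.succ)]

/-- The Boolean expression `s = t`. -/
def Expr.eq {Γ : List L.Ty} {T : L.Ty} (s t : Expr L Γ T) : Expr L Γ .bool :=
  .op (.eq T) (fun i => if i = 0 then s else t)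

/-- Simultaneous substitution for simple variables. -/
def Expr.subst {Γ : List L.Ty} (θ : ∀ x : SVar L, PExpr L x.ty) :
    {T : L.Ty} → Expr L Γ T → Expr L Γ T
  | _, .bvar b => .bvar b
  | _, .var x => (θ x).lift
  | _, .arr a s => .arr a (fun i => (s i).subst θ)
  | _, .op f s => .op f (fun i => (s i).subst θ)
  | _, .ite B s t => .ite (B.subst θ) (s.subst θ) (t.subst θ)

open Classical in
/-- The substitution `[a[s₁, …, sₙ] := t]` for a subscripted variable, in which aliases are
resolved by conditional expressions: `a[r₁, …, rₙ]` becomes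
`if r₁' = s₁ ∧ ⋯ ∧ rₙ' = sₙ then t else a[r₁', …, rₙ']`, where `rᵢ'` results from `rᵢ`. -/
noncomputable def Expr.substArr {Γ : List L.Ty} (a : AVar L) (s : ∀ i, PExpr L (a.arg i))
    (t : PExpr L a.val) : {T : L.Ty} → Expr L Γ T → Expr L Γ T
  | _, .bvar b => .bvar b
  | _, .var x => .var x
  | _, .arr b r =>
      Function.update
        (β := fun c : AVar L => (∀ i, Expr L Γ (c.arg i)) → Expr L Γ c.val)
        (fun c r' => .arr c r') a
        (fun r' => .ite (.conj fun i => .eq (r' i) (s i).lift) t.lift (.arr a r'))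
        b (fun i => Expr.substArr a s t (r i))
  | _, .op f r => .op f (fun i => Expr.substArr a s t (r i))
  | _, .ite B r r' => .ite (Expr.substArr a s t B) (Expr.substArr a s t r) (Expr.substArr a s t r')

end

/-! ## Assertions -/

/-- First-order assertions: Boolean expressions closed under the propositional connectives and
quantification over values of basic type. -/
inductive Assn (L : Lang) : List L.Ty → Type
  | atom {Γ : List L.Ty} (B : Expr L Γ .bool) : Assn L Γ
  | neg {Γ : List L.Ty} (p : Assn L Γ) : Assn L Γ
  | conj {Γ : List L.Ty} (p q : Assn L Γ) : Assn L Γ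
  | disj {Γ : List L.Ty} (p q : Assn L Γ) : Assn L Γ
  | ex {Γ : List L.Ty} (T : L.Ty) (p : Assn L (T :: Γ)) : Assn L Γ
  | all {Γ : List L.Ty} (T : L.Ty) (p : Assn L (T :: Γ)) : Assn L Γ

/-- Assertions about states: all quantified variables are bound. -/
abbrev Assertion (L : Lang) : Type := Assn L []

section
variable {L : Lang} {M : Model L}

/-- Satisfaction of an assertion. -/
def Assn.sat (I : M.Interp) (σ : State M) : {Γ : List L.Ty} → Env M Γ → Assn L Γ → Prop
  | _, ρ, .atom B => B.eval I σ ρ = true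
  | _, ρ, .neg p => ¬ p.sat I σ ρ
  | _, ρ, .conj p q => p.sat I σ ρ ∧ q.sat I σ ρ
  | _, ρ, .disj p q => p.sat I σ ρ ∨ q.sat I σ ρ
  | _, ρ, .ex T p => ∃ d : M.Val T, p.sat I σ (Env.cons d ρ)
  | _, ρ, .all T p => ∀ d : M.Val T, p.sat I σ (Env.cons d ρ)

/-- The free (simple and array) variables of an assertion. -/
def Assn.free : {Γ : List L.Ty} → Assn L Γ → Set (Var L)
  | _, .atom B => B.vars
  | _, .neg p => p.free
  | _, .conj p q => p.free ∪ q.free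
  | _, .disj p q => p.free ∪ q.free
  | _, .ex _ p => p.free
  | _, .all _ p => p.free

/-- Simultaneous substitution for simple variables in an assertion. -/
def Assn.subst (θ : ∀ x : SVar L, PExpr L x.ty) : {Γ : List L.Ty} → Assn L Γ → Assn L Γ
  | _, .atom B => .atom (B.subst θ)
  | _, .neg p => .neg (p.subst θ)
  | _, .conj p q => .conj (p.subst θ) (q.subst θ)
  | _, .disj p q => .disj (p.subst θ) (q.subst θ)
  | _, .ex T p => .ex T (p.subst θ)
  | _, .all T p => .all T (p.subst θ)

/-- `p[x₁, …, xₙ := t₁, …, tₙ]` for distinct simple variables. -/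
noncomputable def Assn.substMany {Γ : List L.Ty} (p : Assn L Γ) {n : ℕ} (x : Fin n → SVar L)
    (t : ∀ i, PExpr L (x i).ty) : Assn L Γ :=
  p.subst (updMany (F := fun y : SVar L => PExpr L y.ty) (fun y => .var y) x t)

open Classical in
/-- `p[x := t]` for a simple variable `x`. -/
noncomputable def Assn.substOne {Γ : List L.Ty} (p : Assn L Γ) (x : SVar L)
    (t : PExpr L x.ty) : Assn L Γ :=
  p.subst (Function.update (β := fun y : SVar L => PExpr L y.ty) (fun y => .var y) x t)

/-- `p[a[s₁, …, sₙ] := t]` for a subscripted variable. -/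
noncomputable def Assn.substArr (a : AVar L) (s : ∀ i, PExpr L (a.arg i)) (t : PExpr L a.val) :
    {Γ : List L.Ty} → Assn L Γ → Assn L Γ
  | _, .atom B => .atom (Expr.substArr a s t B)
  | _, .neg p => .neg (Assn.substArr a s t p)
  | _, .conj p q => .conj (Assn.substArr a s t p) (Assn.substArr a s t q)
  | _, .disj p q => .disj (Assn.substArr a s t p) (Assn.substArr a s t q)
  | _, .ex T p => .ex T (Assn.substArr a s t p)
  | _, .all T p => .all T (Assn.substArr a s t p)

/-- The outermost bound variable of a context. -/
def BVar.last : (Γ : List L.Ty) → (T : L.Ty) → BVar (Γ ++ [T]) T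
  | [], _ => .zero
  | _ :: Γ, T => .succ (BVar.last Γ T)

/-- A bound variable, after a further variable has been added as the outermost one. -/
def BVar.inl (U : L.Ty) : {Γ : List L.Ty} → {T : L.Ty} → BVar Γ T → BVar (Γ ++ [U]) T
  | _, _, .zero => .zero
  | _, _, .succ b => .succ (BVar.inl U b)

open Classical in
/-- Replacement of the simple variable `x` by a new outermost bound variable. -/
noncomputable def Expr.abs (x : SVar L) {Γ : List L.Ty} :
    {T : L.Ty} → Expr L Γ T → Expr L (Γ ++ [x.ty]) T
  | _, .bvar b => .bvar (b.inl x.ty)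
  | _, .var y =>
      Function.update (β := fun z : SVar L => Expr L (Γ ++ [x.ty]) z.ty) (fun z => .var z) x
        (.bvar (BVar.last Γ x.ty)) y
  | _, .arr a s => .arr a (fun i => (s i).abs x)
  | _, .op f s => .op f (fun i => (s i).abs x)
  | _, .ite B s t => .ite (B.abs x) (s.abs x) (t.abs x)

/-- Replacement of the simple variable `x` by a new outermost bound variable. -/
noncomputable def Assn.abs (x : SVar L) : {Γ : List L.Ty} → Assn L Γ → Assn L (Γ ++ [x.ty])
  | _, .atom B => .atom (B.abs x)
  | _, .neg p => .neg (p.abs x)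
  | _, .conj p q => .conj (p.abs x) (q.abs x)
  | _, .disj p q => .disj (p.abs x) (q.abs x)
  | _, .ex T p => .ex T (p.abs x)
  | _, .all T p => .all T (p.abs x)

/-- The assertion `∃ x : p` for a simple variable `x`. -/
noncomputable def Assn.exists (x : SVar L) (p : Assertion L) : Assertion L := .ex x.ty (p.abs x)

end

/-! ## Programs -/

/-- The heads of finitely many procedure declarations: each procedure has a sequence (possibly
empty) of distinct simple variables as formal parameters. -/
structure Header (L : Lang) where
  num : ℕ
  arity : Fin num → ℕ
  formal : ∀ P : Fin num, Fin (arity P) → SVar L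
  formal_inj : ∀ P, Function.Injective (formal P)

/-- Statements; all procedure calls are to declared procedures and well-typed. -/
inductive Stmt {L : Lang} (H : Header L) : Type
  | skip : Stmt H
  | assign (x : SVar L) (t : PExpr L x.ty) : Stmt H
  | assignArr (a : AVar L) (s : ∀ i, PExpr L (a.arg i)) (t : PExpr L a.val) : Stmt H
  /-- parallel assignment to distinct simple variables -/
  | par {n : ℕ} (x : Fin n → SVar L) (hx : Function.Injective x)
      (t : ∀ i, PExpr L (x i).ty) : Stmt H
  | seq (S₁ S₂ : Stmt H) : Stmt H
  | cond (B : PExpr L .bool) (S₁ S₂ : Stmt H) : Stmt H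
  /-- the failure statement `if B → S fi` -/
  | guard (B : PExpr L .bool) (S : Stmt H) : Stmt H
  | loop (B : PExpr L .bool) (S : Stmt H) : Stmt H
  /-- the block `begin local x₁, …, xₙ := t₁, …, tₙ; S end` -/
  | block {n : ℕ} (x : Fin n → SVar L) (hx : Function.Injective x)
      (t : ∀ i, PExpr L (x i).ty) (S : Stmt H) : Stmt H
  | call (P : Fin H.num) (t : ∀ i, PExpr L (H.formal P i).ty) : Stmt H

/-- A set of procedure declarations: a body for each head. -/
structure Decls {L : Lang} (H : Header L) where
  body : Fin H.num → Stmt H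

/-- The variables `x₁, …, xₙ` as a set. -/
def varSet {L : Lang} {n : ℕ} (x : Fin n → SVar L) : Set (Var L) :=
  Set.range fun i => Var.simple (x i)

section
variable {L : Lang} {H : Header L}

/-- The block `begin local u₁, …, uₙ := t₁, …, tₙ; S end` by which the call `P(t₁, …, tₙ)` is
replaced, where `P(u₁, …, uₙ) :: S` is the declaration of `P`. -/
def Decls.callBlock (D : Decls H) (P : Fin H.num) (t : ∀ i, PExpr L (H.formal P i).ty) :
    Stmt H :=
  .block (H.formal P) (H.formal_inj P) t (D.body P)

/-- All simple and array variables of a statement. -/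
def Stmt.vars : Stmt H → Set (Var L)
  | .skip => ∅
  | .assign x t => {.simple x} ∪ t.vars
  | .assignArr a s t => {.array a} ∪ (⋃ i, (s i).vars) ∪ t.vars
  | .par x _ t => varSet x ∪ ⋃ i, (t i).vars
  | .seq S₁ S₂ => S₁.vars ∪ S₂.vars
  | .cond B S₁ S₂ => B.vars ∪ S₁.vars ∪ S₂.vars
  | .guard B S => B.vars ∪ S.vars
  | .loop B S => B.vars ∪ S.vars
  | .block x _ t S => varSet x ∪ (⋃ i, (t i).vars) ∪ S.vars
  | .call _ t => ⋃ i, (t i).vars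

/-- The variables that occur freely (as global variables) in a statement. -/
def Stmt.globals : Stmt H → Set (Var L)
  | .skip => ∅
  | .assign x t => {.simple x} ∪ t.vars
  | .assignArr a s t => {.array a} ∪ (⋃ i, (s i).vars) ∪ t.vars
  | .par x _ t => varSet x ∪ ⋃ i, (t i).vars
  | .seq S₁ S₂ => S₁.globals ∪ S₂.globals
  | .cond B S₁ S₂ => B.vars ∪ S₁.globals ∪ S₂.globals
  | .guard B S => B.vars ∪ S.globals
  | .loop B S => B.vars ∪ S.globals
  | .block x _ t S => (⋃ i, (t i).vars) ∪ (S.globals \ varSet x)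
  | .call _ t => ⋃ i, (t i).vars

/-- The local variables of the blocks in a statement. -/
def Stmt.locals : Stmt H → Set (Var L)
  | .skip => ∅
  | .assign _ _ => ∅
  | .assignArr _ _ _ => ∅
  | .par _ _ _ => ∅
  | .seq S₁ S₂ => S₁.locals ∪ S₂.locals
  | .cond _ S₁ S₂ => S₁.locals ∪ S₂.locals
  | .guard _ S => S.locals
  | .loop _ S => S.locals
  | .block x _ _ S => varSet x ∪ S.locals
  | .call _ _ => ∅

/-- The global variables on the left-hand side of an assignment in a statement, outside of
subscript positions. -/
def Stmt.change : Stmt H → Set (Var L)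
  | .skip => ∅
  | .assign x _ => {.simple x}
  | .assignArr a _ _ => {.array a}
  | .par x _ _ => varSet x
  | .seq S₁ S₂ => S₁.change ∪ S₂.change
  | .cond _ S₁ S₂ => S₁.change ∪ S₂.change
  | .guard _ S => S.change
  | .loop _ S => S.change
  | .block x _ _ S => S.change \ varSet x
  | .call _ _ => ∅

/-- All variables of the declarations, including the formal parameters. -/
def Decls.vars (D : Decls H) : Set (Var L) := ⋃ P, varSet (H.formal P) ∪ (D.body P).vars

/-- The variables that occur freely in the declarations. -/
def Decls.globals (D : Decls H) : Set (Var L) :=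
  ⋃ P, (D.body P).globals \ varSet (H.formal P)

/-- The local variables of the blocks in the declarations. -/
def Decls.locals (D : Decls H) : Set (Var L) := ⋃ P, (D.body P).locals

/-- The formal parameters of the declarations. -/
def Decls.formals (_D : Decls H) : Set (Var L) := ⋃ P, varSet (H.formal P)

/-- The global variables that can be modified by the declared procedures. -/
def Decls.change (D : Decls H) : Set (Var L) :=
  ⋃ P, (D.body P).change \ varSet (H.formal P)

/-- Absence of name clashes between local and global variables in the recursive program with
main statement `S` and declarations `D`: no local variable of a block occurs freely in `S` or
`D`, and no formal parameter occurs freely in `D`. -/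
structure NoClash (D : Decls H) (S : Stmt H) : Prop where
  locals_disjoint : Disjoint (S.locals ∪ D.locals) (S.globals ∪ D.globals)
  formals_disjoint : Disjoint D.formals D.globals

end

/-! ## Operational semantics -/

/-- Statements at run time: the empty statement `E`, statements of the language, parallel
assignments of values (which restore the local variables at the end of a block), and
sequential compositions of these. -/
inductive RStmt {L : Lang} (M : Model L) (H : Header L) : Type
  | empty : RStmt M H
  | prog (S : Stmt H) : RStmt M H
  | restore {n : ℕ} (x : Fin n → SVar L) (d : ∀ i, M.Val (x i).ty) : RStmt M H
  | seq (R₁ R₂ : RStmt M H) : RStmt M H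

/-- Configurations: a statement to be executed with a proper state, or failure. A failure
aborts the execution, so the latter stands for the pair of `E` and the special state. -/
inductive Conf {L : Lang} (M : Model L) (H : Header L) : Type
  | run (R : RStmt M H) (σ : State M) : Conf M H
  | fail : Conf M H

/-- The configuration with `R` still to be executed afterwards, where `E; R` is `R`. -/
def Conf.andThen {L : Lang} {M : Model L} {H : Header L} : Conf M H → RStmt M H → Conf M H
  | .run .empty σ, R => .run R σ
  | .run R₁ σ, R => .run (.seq R₁ R) σ
  | .fail, _ => .fail

section
variable {L : Lang} {M : Model L} {H : Header L}

/-- The transitions from the configuration of a run-time statement and a proper state. -/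
inductive Step (I : M.Interp) (D : Decls H) : RStmt M H → State M → Conf M H → Prop
  | skip (σ : State M) : Step I D (.prog .skip) σ (.run .empty σ)
  | assign (x : SVar L) (t : PExpr L x.ty) (σ : State M) :
      Step I D (.prog (.assign x t)) σ (.run .empty (σ.set x (σ.eval I t)))
  | assignArr (a : AVar L) (s : ∀ i, PExpr L (a.arg i)) (t : PExpr L a.val) (σ : State M) :
      Step I D (.prog (.assignArr a s t)) σ
        (.run .empty (σ.setArr a (fun i => σ.eval I (s i)) (σ.eval I t)))
  | par {n : ℕ} (x : Fin n → SVar L) (hx : Function.Injective x)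
      (t : ∀ i, PExpr L (x i).ty) (σ : State M) :
      Step I D (.prog (.par x hx t)) σ (.run .empty (σ.setMany x fun i => σ.eval I (t i)))
  | restore {n : ℕ} (x : Fin n → SVar L) (d : ∀ i, M.Val (x i).ty) (σ : State M) :
      Step I D (.restore x d) σ (.run .empty (σ.setMany x d))
  | seqProg {S₁ : Stmt H} (S₂ : Stmt H) {σ : State M} {c : Conf M H} :
      Step I D (.prog S₁) σ c → Step I D (.prog (.seq S₁ S₂)) σ (c.andThen (.prog S₂))
  | seq {R₁ : RStmt M H} (R₂ : RStmt M H) {σ : State M} {c : Conf M H} :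
      Step I D R₁ σ c → Step I D (.seq R₁ R₂) σ (c.andThen R₂)
  | condTrue (B : PExpr L .bool) (S₁ S₂ : Stmt H) (σ : State M) :
      σ.eval I B = true → Step I D (.prog (.cond B S₁ S₂)) σ (.run (.prog S₁) σ)
  | condFalse (B : PExpr L .bool) (S₁ S₂ : Stmt H) (σ : State M) :
      σ.eval I B = false → Step I D (.prog (.cond B S₁ S₂)) σ (.run (.prog S₂) σ)
  | guardTrue (B : PExpr L .bool) (S : Stmt H) (σ : State M) :
      σ.eval I B = true → Step I D (.prog (.guard B S)) σ (.run (.prog S) σ)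
  | guardFalse (B : PExpr L .bool) (S : Stmt H) (σ : State M) :
      σ.eval I B = false → Step I D (.prog (.guard B S)) σ .fail
  | loopTrue (B : PExpr L .bool) (S : Stmt H) (σ : State M) :
      σ.eval I B = true →
        Step I D (.prog (.loop B S)) σ (.run (.prog (.seq S (.loop B S))) σ)
  | loopFalse (B : PExpr L .bool) (S : Stmt H) (σ : State M) :
      σ.eval I B = false → Step I D (.prog (.loop B S)) σ (.run .empty σ)
  | block {n : ℕ} (x : Fin n → SVar L) (hx : Function.Injective x)
      (t : ∀ i, PExpr L (x i).ty) (S : Stmt H) (σ : State M) :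
      Step I D (.prog (.block x hx t S)) σ
        (.run (.seq (.prog (.seq (.par x hx t) S)) (.restore x fun i => σ.simple (x i))) σ)
  | call (P : Fin H.num) (t : ∀ i, PExpr L (H.formal P i).ty) (σ : State M) :
      Step I D (.prog (.call P t)) σ (.run (.prog (D.callBlock P t)) σ)

/-- The transition relation between configurations. -/
inductive Trans (I : M.Interp) (D : Decls H) : Conf M H → Conf M H → Prop
  | mk {R : RStmt M H} {σ : State M} {c : Conf M H} :
      Step I D R σ c → Trans I D (.run R σ) c

/-- Terminal configurations; `none` is the special state of failure. -/
def Conf.final : Option (State M) → Conf M H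
  | some τ => .run .empty τ
  | none => .fail

/-- The strong partial correctness semantics `M_sp⟦S⟧ : Σ → 𝒫(Σ ∪ {fail})`. -/
def semSP (I : M.Interp) (D : Decls H) (S : Stmt H) (σ : State M) : Set (Option (State M)) :=
  {o | Relation.ReflTransGen (Trans I D) (.run (.prog S) σ) (Conf.final o)}

/-! ## Correctness formulas and their validity -/

/-- The array variable `h_T` of type `nat → T`, where `h` chooses an identifier for each `T`. -/
def enumVar (h : L.Ty → ℕ) (T : L.Ty) : AVar L := ⟨0, fun _ => .nat, T, h T⟩

/-- The states under consideration: each `h_T` enumerates the values of the basic type `T`. -/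
def State.Enumerates (h : L.Ty → ℕ) (σ : State M) : Prop :=
  ∀ T : L.Ty, Function.Surjective fun k : ℕ => σ.array (enumVar h T) (fun _ => k)

/-- The set `⟦p⟧` of the states that satisfy `p`. -/
def Assn.states (I : M.Interp) (h : L.Ty → ℕ) (p : Assertion L) : Set (State M) :=
  {σ | σ.Enumerates h ∧ p.sat I σ Env.nil}

/-- The assertion `p → q` is true (in all states). -/
def Implies (I : M.Interp) (h : L.Ty → ℕ) (p q : Assertion L) : Prop :=
  p.states I h ⊆ q.states I h

/-- Correctness formulas `{p} S {q}`. -/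
structure Triple (H : Header L) where
  pre : Assertion L
  stmt : Stmt H
  post : Assertion L

/-- `{p} S {q}` holds in the sense of strong partial correctness: `M_sp⟦S⟧(⟦p⟧) ⊆ ⟦q⟧`. -/
def Triple.ValidSP (I : M.Interp) (D : Decls H) (h : L.Ty → ℕ) (F : Triple H) : Prop :=
  (⋃ σ ∈ F.pre.states I h, semSP I D F.stmt σ) ⊆ some '' F.post.states I h

/-! ## The proof systems -/

/-- `A ⊢ F` in the proof system `SPR` for the declarations `D`: derivability from the
assumptions `A` (and from the true assertions, in the rules that have assertions as premises). -/
inductive SPR (I : M.Interp) (D : Decls H) (h : L.Ty → ℕ) (A : Set (Triple H)) :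
    Triple H → Prop
  | assumption {F : Triple H} : F ∈ A → SPR I D h A F
  | skip (p : Assertion L) : SPR I D h A ⟨p, .skip, p⟩
  | assign (p : Assertion L) (x : SVar L) (t : PExpr L x.ty) :
      SPR I D h A ⟨p.substOne x t, .assign x t, p⟩
  | assignArr (p : Assertion L) (a : AVar L) (s : ∀ i, PExpr L (a.arg i)) (t : PExpr L a.val) :
      SPR I D h A ⟨p.substArr a s t, .assignArr a s t, p⟩
  | par (p : Assertion L) {n : ℕ} (x : Fin n → SVar L) (hx : Function.Injective x)
      (t : ∀ i, PExpr L (x i).ty) : SPR I D h A ⟨p.substMany x t, .par x hx t, p⟩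
  | seq {p r q : Assertion L} {S₁ S₂ : Stmt H} :
      SPR I D h A ⟨p, S₁, r⟩ → SPR I D h A ⟨r, S₂, q⟩ → SPR I D h A ⟨p, .seq S₁ S₂, q⟩
  | cond {p q : Assertion L} {B : PExpr L .bool} {S₁ S₂ : Stmt H} :
      SPR I D h A ⟨.conj p (.atom B), S₁, q⟩ →
      SPR I D h A ⟨.conj p (.neg (.atom B)), S₂, q⟩ → SPR I D h A ⟨p, .cond B S₁ S₂, q⟩
  | loop {p : Assertion L} {B : PExpr L .bool} {S : Stmt H} :
      SPR I D h A ⟨.conj p (.atom B), S, p⟩ →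
      SPR I D h A ⟨p, .loop B S, .conj p (.neg (.atom B))⟩
  | consequence {p p₁ q₁ q : Assertion L} {S : Stmt H} :
      Implies I h p p₁ → SPR I D h A ⟨p₁, S, q₁⟩ → Implies I h q₁ q → SPR I D h A ⟨p, S, q⟩
  | guard {p q : Assertion L} {B : PExpr L .bool} {S : Stmt H} :
      Implies I h p (.atom B) → SPR I D h A ⟨p, S, q⟩ → SPR I D h A ⟨p, .guard B S, q⟩
  | block {p q : Assertion L} {n : ℕ} {x : Fin n → SVar L} {hx : Function.Injective x}
      {t : ∀ i, PExpr L (x i).ty} {S : Stmt H} :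
      Disjoint (varSet x) q.free →
      SPR I D h A ⟨p, .seq (.par x hx t) S, q⟩ → SPR I D h A ⟨p, .block x hx t S, q⟩
  | disjunction {p r q : Assertion L} {S : Stmt H} :
      SPR I D h A ⟨p, S, q⟩ → SPR I D h A ⟨r, S, q⟩ → SPR I D h A ⟨.disj p r, S, q⟩
  | conjunction {p₁ p₂ q₁ q₂ : Assertion L} {S : Stmt H} :
      SPR I D h A ⟨p₁, S, q₁⟩ → SPR I D h A ⟨p₂, S, q₂⟩ →
      SPR I D h A ⟨.conj p₁ p₂, S, .conj q₁ q₂⟩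
  | existsIntro {p q : Assertion L} {S : Stmt H} (x : SVar L) :
      Var.simple x ∉ D.vars ∪ S.vars ∪ q.free →
      SPR I D h A ⟨p, S, q⟩ → SPR I D h A ⟨p.exists x, S, q⟩
  | invariance {p r q : Assertion L} {S : Stmt H} :
      Disjoint p.free (D.change ∪ S.change) →
      SPR I D h A ⟨r, S, q⟩ → SPR I D h A ⟨.conj p r, S, .conj p q⟩
  | substitution {p q : Assertion L} {S : Stmt H} {n : ℕ} (z : Fin n → SVar L)
      (hz : Function.Injective z) (t : ∀ i, PExpr L (z i).ty) :
      Disjoint (varSet z) (D.vars ∪ S.vars) →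
      Disjoint (⋃ i, (t i).vars) (D.change ∪ S.change) →
      SPR I D h A ⟨p, S, q⟩ → SPR I D h A ⟨p.substMany z t, S, q.substMany z t⟩

/-- Correctness formulas `{p} P(t₁, …, tₙ) {q}` about procedure calls. -/
structure CallTriple (H : Header L) where
  pre : Assertion L
  proc : Fin H.num
  args : ∀ i, PExpr L (H.formal proc i).ty
  post : Assertion L

/-- The correctness formula `{p} P(t₁, …, tₙ) {q}`. -/
def CallTriple.toTriple (c : CallTriple H) : Triple H := ⟨c.pre, .call c.proc c.args, c.post⟩

/-- The correctness formula `{p} begin local u₁, …, uₙ := t₁, …, tₙ; S end {q}`, where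
`P(u₁, …, uₙ) :: S` is the declaration of `P`. -/
def CallTriple.toBlock (D : Decls H) (c : CallTriple H) : Triple H :=
  ⟨c.pre, D.callBlock c.proc c.args, c.post⟩

/-- `F` is the conclusion of an instance of the recursion rule all of whose premises hold:
for finitely many assumptions `C` about procedure calls, both `F` and the formulas about the
blocks corresponding to these calls are derivable in `SPR` from `C`. -/
def RecursionRule (I : M.Interp) (D : Decls H) (h : L.Ty → ℕ) (F : Triple H) : Prop :=
  ∃ C : List (CallTriple H),
    SPR I D h {G | ∃ c ∈ C, G = c.toTriple} F ∧
    ∀ c ∈ C, SPR I D h {G | ∃ c ∈ C, G = c.toTriple} (c.toBlock D)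

/-- `⊢ F` in the proof system `SPR⁺`, which is `SPR` extended by the recursion rule. As the
premises of the recursion rule are about derivability in `SPR`, its conclusions can be
used like initial formulas. -/
def SPRPlus (I : M.Interp) (D : Decls H) (h : L.Ty → ℕ) (F : Triple H) : Prop :=
  SPR I D h {G | RecursionRule I D h G} F

end

end RecProg

open RecProg

/-!
The completeness proof works with weakest preconditions of the given postcondition `q`, for the
rest of an execution. This rest is represented by the code `k` of a stack of statements that are
to be executed, and of tuples of values to which local variables are to be restored; the values
occur by their codes in the enumerations `h_T`. A stack machine (`MStep`) executes such stacks,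
and `WP` is its weakest precondition of `q`: the machine neither fails nor ends in a state that
violates `q`.

The predicate `WP` is expressed by a single assertion `Ψ` with one further variable, for `k`
(`exists_assn_wp`). A terminating computation modifies the initial state `σ` at finitely many places
only, so each state in it is `σ.patch w` for a number `w`, and the values of expressions and the
truth of assertions in `σ.patch w` are definable in `σ`. Hence the steps of the machine are
definable, and so is their reflexive transitive closure, as finite sequences of numbers have codes
in the language. The array variables themselves need not be quantified.

For a fresh variable `z` that stands for an arbitrary rest of the execution, all triples
`{Ψ(S :: z)} S {Ψ(z)}` with `S` in the program are derivable in `SPR` from those in which `S` is a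
call (`WPData.derive`): this is an induction on `S`, in which the substitution rule replaces `z` by
a larger stack. For a block, or the block that replaces a call, the old values of the local
variables are frozen as the code of a tuple in a fresh variable `y`; the absence of name clashes
makes the invariance rule applicable to the statement that the current values are those coded by `y`
(`WPData.derive_block`). The recursion rule then discharges the finitely many assumptions about
calls. Finally, `p` implies `Ψ(S :: [])` by the validity of `{p} S {q}`, because the outcomes of the
machine are outcomes of the operational semantics (`wp_of_semSP`), and `Ψ([])` implies `q`.
-/

namespace RecProg

/-! ### Substitution, coincidence and free variables -/

section Update
variable {X : Type} {F : X → Type} {n : ℕ}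

theorem updMany_apply (f : ∀ y, F y) {x : Fin n → X} (hx : Function.Injective x)
    (v : ∀ i, F (x i)) (i : Fin n) : updMany f x v (x i) = v i := by
  have hy : ∃ j, x j = x i := ⟨i, rfl⟩
  rw [updMany, dif_pos hy]
  have key : ∀ (j : Fin n) (e : x j = x i), (e ▸ v j : F (x i)) = v i := by
    intro j e
    obtain rfl := hx e
    rfl
  exact key _ hy.choose_spec

theorem updMany_of_notMem (f : ∀ y, F y) (x : Fin n → X) (v : ∀ i, F (x i)) {y : X}
    (hy : ∀ i, x i ≠ y) : updMany f x v y = f y := by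
  rw [updMany, dif_neg (by simpa using hy)]

end Update

variable {L : Lang} {M : Model L}

theorem State.ext' {σ τ : State M} (h₁ : ∀ x, σ.simple x = τ.simple x)
    (h₂ : ∀ a v, σ.array a v = τ.array a v) : σ = τ := by
  cases σ; cases τ
  congr
  · exact funext h₁
  · exact funext fun a => funext (h₂ a)

theorem State.set_simple_self (σ : State M) (x : SVar L) (d : M.Val x.ty) :
    (σ.set x d).simple x = d := by
  simp [State.set]

theorem State.set_simple_of_ne (σ : State M) {x y : SVar L} (d : M.Val x.ty) (hy : y ≠ x) :
    (σ.set x d).simple y = σ.simple y := by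
  simp [State.set, hy]

theorem State.setMany_simple_apply (σ : State M) {n : ℕ} {x : Fin n → SVar L}
    (hx : Function.Injective x) (d : ∀ i, M.Val (x i).ty) (i : Fin n) :
    (σ.setMany x d).simple (x i) = d i :=
  updMany_apply (F := fun y : SVar L => M.Val y.ty) σ.simple hx d i

theorem State.setMany_simple_of_notMem (σ : State M) {n : ℕ} (x : Fin n → SVar L)
    (d : ∀ i, M.Val (x i).ty) {y : SVar L} (hy : ∀ i, x i ≠ y) :
    (σ.setMany x d).simple y = σ.simple y :=
  updMany_of_notMem (F := fun y : SVar L => M.Val y.ty) σ.simple x d hy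

theorem State.setMany_self (σ : State M) {n : ℕ} {x : Fin n → SVar L}
    (hx : Function.Injective x) : (σ.setMany x fun i => σ.simple (x i)) = σ := by
  refine State.ext' (fun y => ?_) fun _ _ => rfl
  by_cases hy : ∃ i, x i = y
  · obtain ⟨i, rfl⟩ := hy
    exact σ.setMany_simple_apply hx _ i
  · exact σ.setMany_simple_of_notMem x _ (by simpa using hy)

/-- A simultaneous update is a sequence of single updates. -/
theorem State.setMany_succ (σ : State M) {n : ℕ} {x : Fin (n + 1) → SVar L}
    (hx : Function.Injective x) (d : ∀ i, M.Val (x i).ty) :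
    σ.setMany x d = (σ.setMany (fun i : Fin n => x i.succ) fun i => d i.succ).set (x 0) (d 0) := by
  have hx' : Function.Injective fun i : Fin n => x i.succ :=
    hx.comp (Fin.succ_injective n)
  refine State.ext' (fun y => ?_) fun _ _ => rfl
  by_cases h0 : y = x 0
  · subst h0
    rw [State.set_simple_self, State.setMany_simple_apply _ hx]
  · rw [State.set_simple_of_ne _ _ h0]
    by_cases hy : ∃ i : Fin n, x i.succ = y
    · obtain ⟨i, rfl⟩ := hy
      rw [State.setMany_simple_apply _ hx,
        State.setMany_simple_apply σ hx' (fun i => d i.succ) i]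
    · have hy' : ∀ i : Fin n, x i.succ ≠ y := by simpa using hy
      rw [State.setMany_simple_of_notMem _ _ _ hy', State.setMany_simple_of_notMem]
      intro i
      refine Fin.cases ?_ ?_ i
      · exact fun e => h0 e.symm
      · exact hy'

theorem State.setMany_zero (σ : State M) (x : Fin 0 → SVar L) (d : ∀ i, M.Val (x i).ty) :
    σ.setMany x d = σ :=
  State.ext' (fun _ => σ.setMany_simple_of_notMem x d fun i => i.elim0) fun _ _ => rfl

theorem State.setMany_one (σ : State M) (x : Fin 1 → SVar L) (d : ∀ i, M.Val (x i).ty) :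
    σ.setMany x d = σ.set (x 0) (d 0) := by
  rw [State.setMany_succ σ (Function.injective_of_subsingleton x), State.setMany_zero]

/-- Two states agree on a set of variables. -/
def State.AgreeOn (V : Set (Var L)) (σ τ : State M) : Prop :=
  (∀ x, Var.simple x ∈ V → σ.simple x = τ.simple x) ∧
    ∀ a, Var.array a ∈ V → σ.array a = τ.array a

theorem State.AgreeOn.mono {V W : Set (Var L)} {σ τ : State M} (h : σ.AgreeOn W τ)
    (hVW : V ⊆ W) : σ.AgreeOn V τ :=
  ⟨fun x hx => h.1 x (hVW hx), fun a ha => h.2 a (hVW ha)⟩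

theorem Expr.eval_congr (I : M.Interp) {σ τ : State M} {Γ : List L.Ty} (ρ : Env M Γ) {T : L.Ty}
    (e : Expr L Γ T) (h : σ.AgreeOn e.vars τ) : e.eval I σ ρ = e.eval I τ ρ := by
  induction e with
  | bvar b => rfl
  | var x => exact h.1 x rfl
  | arr a s ih =>
    have h' : ∀ i, (s i).eval I σ ρ = (s i).eval I τ ρ := fun i =>
      ih i (h.mono ((Set.subset_iUnion (fun i => (s i).vars) i).trans Set.subset_union_right))
    simp only [Expr.eval, h', h.2 a (Or.inl rfl)]
  | op f s ih =>
    have h' : ∀ i, (s i).eval I σ ρ = (s i).eval I τ ρ := fun i =>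
      ih i (h.mono (Set.subset_iUnion (fun i => (s i).vars) i))
    simp only [Expr.eval, h']
  | ite B s t ihB ihs iht =>
    simp only [Expr.eval]
    rw [ihB (h.mono fun v hv => Or.inl (Or.inl hv)), ihs (h.mono fun v hv => Or.inl (Or.inr hv)),
      iht (h.mono fun v hv => Or.inr hv)]

theorem Assn.sat_congr (I : M.Interp) {σ τ : State M} {Γ : List L.Ty} (p : Assn L Γ)
    (h : σ.AgreeOn p.free τ) (ρ : Env M Γ) : p.sat I σ ρ ↔ p.sat I τ ρ := by
  induction p with
  | atom B => simp only [Assn.sat, B.eval_congr I ρ h]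
  | neg p ih => simp only [Assn.sat, ih h]
  | conj p q ihp ihq =>
    simp only [Assn.sat, ihp (h.mono Set.subset_union_left), ihq (h.mono Set.subset_union_right)]
  | disj p q ihp ihq =>
    simp only [Assn.sat, ihp (h.mono Set.subset_union_left), ihq (h.mono Set.subset_union_right)]
  | ex T p ih => simp only [Assn.sat, ih h]
  | all T p ih => simp only [Assn.sat, ih h]

theorem Expr.eval_lift (I : M.Interp) (σ : State M) {Γ : List L.Ty} (ρ : Env M Γ) {T : L.Ty}
    (e : PExpr L T) : (e.lift : Expr L Γ T).eval I σ ρ = σ.eval I e := by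
  induction e using Expr.lift.induct with
  | case1 x => rfl
  | case2 a s ih => simp only [Expr.lift, Expr.eval, State.eval, ih]
  | case3 T n A f s ih => simp only [Expr.lift, Expr.eval, State.eval, ih]
  | case4 T B s t ihB ihs iht => simp only [Expr.lift, Expr.eval, State.eval, ihB, ihs, iht]

theorem Expr.vars_lift {Γ : List L.Ty} {T : L.Ty} (e : PExpr L T) :
    (e.lift : Expr L Γ T).vars = e.vars := by
  induction e using Expr.lift.induct with
  | case1 x => rfl
  | case2 a s ih => simp only [Expr.lift, Expr.vars, ih]
  | case3 T n A f s ih => simp only [Expr.lift, Expr.vars, ih]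
  | case4 T B s t ihB ihs iht => simp only [Expr.lift, Expr.vars, ihB, ihs, iht]

/-- The state in which the simple variables have the values of the expressions `θ`. -/
noncomputable def State.substBy (I : M.Interp) (σ : State M) (θ : ∀ x : SVar L, PExpr L x.ty) :
    State M :=
  { σ with simple := fun x => σ.eval I (θ x) }

theorem Expr.eval_subst (I : M.Interp) (σ : State M) (θ : ∀ x : SVar L, PExpr L x.ty)
    {Γ : List L.Ty} (ρ : Env M Γ) {T : L.Ty} (e : Expr L Γ T) :
    (e.subst θ).eval I σ ρ = e.eval I (σ.substBy I θ) ρ := by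
  induction e with
  | bvar b => rfl
  | var x => exact Expr.eval_lift I σ ρ (θ x)
  | arr a s ih => simp only [Expr.subst, Expr.eval, ih]; rfl
  | op f s ih => simp only [Expr.subst, Expr.eval, ih]
  | ite B s t ihB ihs iht => simp only [Expr.subst, Expr.eval, ihB, ihs, iht]

theorem Assn.sat_subst (I : M.Interp) (σ : State M) (θ : ∀ x : SVar L, PExpr L x.ty)
    {Γ : List L.Ty} (p : Assn L Γ) (ρ : Env M Γ) :
    (p.subst θ).sat I σ ρ ↔ p.sat I (σ.substBy I θ) ρ := by
  induction p with
  | atom B => simp only [Assn.subst, Assn.sat, B.eval_subst]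
  | neg p ih => simp only [Assn.subst, Assn.sat, ih]
  | conj p q ihp ihq => simp only [Assn.subst, Assn.sat, ihp, ihq]
  | disj p q ihp ihq => simp only [Assn.subst, Assn.sat, ihp, ihq]
  | ex T p ih => simp only [Assn.subst, Assn.sat, ih]
  | all T p ih => simp only [Assn.subst, Assn.sat, ih]

theorem Assn.sat_substMany (I : M.Interp) (σ : State M) {Γ : List L.Ty} (p : Assn L Γ) {n : ℕ}
    {x : Fin n → SVar L} (hx : Function.Injective x) (t : ∀ i, PExpr L (x i).ty) (ρ : Env M Γ) :
    (p.substMany x t).sat I σ ρ ↔ p.sat I (σ.setMany x fun i => σ.eval I (t i)) ρ := by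
  rw [Assn.substMany, Assn.sat_subst]
  suffices h : σ.substBy I (updMany (F := fun y : SVar L => PExpr L y.ty) (fun y => .var y) x t) =
      σ.setMany x fun i => σ.eval I (t i) by rw [h]
  refine State.ext' (fun y => ?_) fun _ _ => rfl
  by_cases hy : ∃ i, x i = y
  · obtain ⟨i, rfl⟩ := hy
    rw [State.setMany_simple_apply _ hx]
    exact congrArg (State.eval I σ)
      (updMany_apply (F := fun y : SVar L => PExpr L y.ty) (fun y => .var y) hx t i)
  · have hy' : ∀ i, x i ≠ y := by simpa using hy
    rw [State.setMany_simple_of_notMem _ _ _ hy']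
    exact congrArg (State.eval I σ)
      (updMany_of_notMem (F := fun y : SVar L => PExpr L y.ty) (fun y => .var y) x t hy')

open scoped Classical in
theorem Assn.sat_substOne (I : M.Interp) (σ : State M) {Γ : List L.Ty} (p : Assn L Γ)
    (x : SVar L) (t : PExpr L x.ty) (ρ : Env M Γ) :
    (p.substOne x t).sat I σ ρ ↔ p.sat I (σ.set x (σ.eval I t)) ρ := by
  rw [Assn.substOne, Assn.sat_subst]
  suffices h : σ.substBy I (Function.update (β := fun y : SVar L => PExpr L y.ty)
      (fun y => .var y) x t) = σ.set x (σ.eval I t) by rw [h]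
  refine State.ext' (fun y => ?_) fun _ _ => rfl
  by_cases hy : y = x
  · subst hy
    rw [State.set_simple_self]
    simp [State.substBy]
  · rw [State.set_simple_of_ne _ _ hy]
    simp [State.substBy, hy, Expr.eval]

theorem Expr.eval_eq_iff (I : M.Interp) (σ : State M) {Γ : List L.Ty} (ρ : Env M Γ) {T : L.Ty}
    (s t : Expr L Γ T) : (Expr.eq s t).eval I σ ρ = true ↔ s.eval I σ ρ = t.eval I σ ρ := by
  simp only [Expr.eq, Expr.eval, Op.eval, if_pos, decide_eq_true_eq]
  rfl

theorem Expr.eval_conj_iff (I : M.Interp) (σ : State M) {Γ : List L.Ty} (ρ : Env M Γ) {n : ℕ}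
    (B : Fin n → Expr L Γ .bool) :
    (Expr.conj B).eval I σ ρ = true ↔ ∀ i, (B i).eval I σ ρ = true := by
  induction n with
  | zero => exact ⟨fun _ i => i.elim0, fun _ => rfl⟩
  | succ n ih =>
    rw [Fin.forall_fin_succ, ← ih fun i => B i.succ]
    exact Bool.and_eq_true_iff

open scoped Classical in
theorem Expr.eval_substArr (I : M.Interp) (σ : State M) (a : AVar L)
    (s : ∀ i, PExpr L (a.arg i)) (t : PExpr L a.val) {Γ : List L.Ty} (ρ : Env M Γ) {T : L.Ty}
    (e : Expr L Γ T) :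
    (Expr.substArr a s t e).eval I σ ρ =
      e.eval I (σ.setArr a (fun i => σ.eval I (s i)) (σ.eval I t)) ρ := by
  induction e with
  | bvar b => rfl
  | var x => rfl
  | arr b r ih =>
    by_cases hb : b = a
    · subst hb
      simp only [Expr.substArr, Function.update_self, Expr.eval, ih, State.setArr,
        Expr.eval_lift]
      by_cases h : (fun i => (r i).eval I (σ.setArr b (fun i => σ.eval I (s i)) (σ.eval I t)) ρ) =
          fun i => σ.eval I (s i)
      · have h' : (Expr.conj fun i => Expr.eq (Expr.substArr b s t (r i)) (s i).lift).eval I σ ρ =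
            true := by
          rw [Expr.eval_conj_iff]
          intro i
          rw [Expr.eval_eq_iff, ih, Expr.eval_lift]
          exact congrFun h i
        rw [h', cond_true]
        simp only [State.setArr] at h
        rw [h, Function.update_self]
      · have h' : (Expr.conj fun i => Expr.eq (Expr.substArr b s t (r i)) (s i).lift).eval I σ ρ =
            false := by
          rw [← Bool.not_eq_true, Expr.eval_conj_iff]
          intro h''
          refine h (funext fun i => ?_)
          have := h'' i
          rwa [Expr.eval_eq_iff, ih, Expr.eval_lift] at this
        rw [h', cond_false]
        simp only [State.setArr] at h
        rw [Function.update_of_ne h]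
    · simp only [Expr.substArr, Function.update_of_ne hb, Expr.eval, ih]
      simp only [State.setArr, Function.update_of_ne hb]
  | op f s ih => simp only [Expr.substArr, Expr.eval, ih]
  | ite B s t ihB ihs iht => simp only [Expr.substArr, Expr.eval, ihB, ihs, iht]

theorem Assn.sat_substArr (I : M.Interp) (σ : State M) (a : AVar L)
    (s : ∀ i, PExpr L (a.arg i)) (t : PExpr L a.val) {Γ : List L.Ty} (p : Assn L Γ)
    (ρ : Env M Γ) :
    (Assn.substArr a s t p).sat I σ ρ ↔
      p.sat I (σ.setArr a (fun i => σ.eval I (s i)) (σ.eval I t)) ρ := by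
  induction p with
  | atom B => simp only [Assn.substArr, Assn.sat, Expr.eval_substArr]
  | neg p ih => simp only [Assn.substArr, Assn.sat, ih]
  | conj p q ihp ihq => simp only [Assn.substArr, Assn.sat, ihp, ihq]
  | disj p q ihp ihq => simp only [Assn.substArr, Assn.sat, ihp, ihq]
  | ex T p ih => simp only [Assn.substArr, Assn.sat, ih]
  | all T p ih => simp only [Assn.substArr, Assn.sat, ih]

/-- The extension of an environment by a value for a further outermost variable. -/
def Env.snoc {T : L.Ty} (d : M.Val T) : {Γ : List L.Ty} → Env M Γ → Env M (Γ ++ [T])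
  | [], _ => Env.cons d Env.nil
  | _ :: _, ρ => Env.cons (ρ _ .zero) (Env.snoc d fun _ b => ρ _ (.succ b))

theorem Env.snoc_last {T : L.Ty} (d : M.Val T) {Γ : List L.Ty} (ρ : Env M Γ) :
    Env.snoc d ρ T (BVar.last Γ T) = d := by
  induction Γ with
  | nil => rfl
  | cons U Γ ih => exact ih fun _ b => ρ _ (.succ b)

theorem Env.snoc_inl {T : L.Ty} (d : M.Val T) {Γ : List L.Ty} (ρ : Env M Γ) {U : L.Ty}
    (b : BVar Γ U) : Env.snoc d ρ U (b.inl T) = ρ U b := by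
  induction b with
  | zero => rfl
  | succ b ih => exact ih fun _ b => ρ _ (.succ b)

open scoped Classical in
theorem Expr.eval_abs (I : M.Interp) (σ : State M) (x : SVar L) (d : M.Val x.ty)
    {Γ : List L.Ty} (ρ : Env M Γ) {T : L.Ty} (e : Expr L Γ T) :
    (e.abs x).eval I σ (Env.snoc d ρ) = e.eval I (σ.set x d) ρ := by
  induction e with
  | bvar b => exact Env.snoc_inl d ρ b
  | var y =>
    by_cases hy : y = x
    · subst hy
      simp only [Expr.abs, Function.update_self, Expr.eval, State.set_simple_self]
      exact Env.snoc_last d ρ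
    · simp only [Expr.abs, Function.update_of_ne hy, Expr.eval, State.set_simple_of_ne _ _ hy]
  | arr a s ih => simp only [Expr.abs, Expr.eval, ih]; rfl
  | op f s ih => simp only [Expr.abs, Expr.eval, ih]
  | ite B s t ihB ihs iht => simp only [Expr.abs, Expr.eval, ihB, ihs, iht]

theorem Assn.sat_abs (I : M.Interp) (σ : State M) (x : SVar L) (d : M.Val x.ty)
    {Γ : List L.Ty} (p : Assn L Γ) (ρ : Env M Γ) :
    (p.abs x).sat I σ (Env.snoc d ρ) ↔ p.sat I (σ.set x d) ρ := by
  induction p with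
  | atom B => simp only [Assn.abs, Assn.sat, B.eval_abs]
  | neg p ih => simp only [Assn.abs, Assn.sat, ih]
  | conj p q ihp ihq => simp only [Assn.abs, Assn.sat, ihp, ihq]
  | disj p q ihp ihq => simp only [Assn.abs, Assn.sat, ihp, ihq]
  | ex T p ih => exact exists_congr fun c => ih (Env.cons c ρ)
  | all T p ih => exact forall_congr' fun c => ih (Env.cons c ρ)

theorem Assn.sat_exists (I : M.Interp) (σ : State M) (x : SVar L) (p : Assertion L) :
    (p.exists x).sat I σ Env.nil ↔ ∃ d, p.sat I (σ.set x d) Env.nil :=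
  exists_congr fun d => Assn.sat_abs I σ x d p Env.nil

theorem Expr.notMem_vars_subst {θ : ∀ x : SVar L, PExpr L x.ty} {x : SVar L}
    (hθ : ∀ y, Var.simple x ∉ (θ y).vars) {Γ : List L.Ty} {T : L.Ty} (e : Expr L Γ T) :
    Var.simple x ∉ (e.subst θ).vars := by
  induction e with
  | bvar b => exact id
  | var y => exact (Expr.vars_lift (Γ := Γ) (θ y)).symm ▸ hθ y
  | arr a s ih => simpa [Expr.subst, Expr.vars] using ih
  | op f s ih => simpa [Expr.subst, Expr.vars] using ih
  | ite B s t ihB ihs iht => simp [Expr.subst, Expr.vars, ihB, ihs, iht]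

theorem Assn.notMem_free_subst {θ : ∀ x : SVar L, PExpr L x.ty} {x : SVar L}
    (hθ : ∀ y, Var.simple x ∉ (θ y).vars) {Γ : List L.Ty} (p : Assn L Γ) :
    Var.simple x ∉ (p.subst θ).free := by
  induction p with
  | atom B => exact B.notMem_vars_subst hθ
  | neg p ih => exact ih
  | conj p q ihp ihq => simp [Assn.subst, Assn.free, ihp, ihq]
  | disj p q ihp ihq => simp [Assn.subst, Assn.free, ihp, ihq]
  | ex T p ih => exact ih
  | all T p ih => exact ih

/-- A simple variable for which expressions without it are substituted does not occur any more. -/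
theorem Assn.disjoint_free_substMany {Γ : List L.Ty} (p : Assn L Γ) {n : ℕ}
    {x : Fin n → SVar L} (hx : Function.Injective x) (t : ∀ i, PExpr L (x i).ty)
    (ht : ∀ i j, Var.simple (x i) ∉ (t j).vars) : Disjoint (varSet x) (p.substMany x t).free := by
  rw [Set.disjoint_left]
  rintro _ ⟨i, rfl⟩
  refine Assn.notMem_free_subst (fun y => ?_) p
  by_cases hy : ∃ j, x j = y
  · obtain ⟨j, rfl⟩ := hy
    rw [updMany_apply (F := fun y : SVar L => PExpr L y.ty) _ hx]
    exact ht i j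
  · have hy' : ∀ i, x i ≠ y := by simpa using hy
    rw [updMany_of_notMem (F := fun y : SVar L => PExpr L y.ty) _ _ _ hy']
    simpa [Expr.vars] using hy' i

theorem Expr.finite_vars {Γ : List L.Ty} {T : L.Ty} (e : Expr L Γ T) : e.vars.Finite := by
  induction e with
  | bvar b => exact Set.finite_empty
  | var x => exact Set.finite_singleton _
  | arr a s ih => exact (Set.finite_singleton _).union (Set.finite_iUnion ih)
  | op f s ih => exact Set.finite_iUnion ih
  | ite B s t ihB ihs iht => exact (ihB.union ihs).union iht

theorem Assn.finite_free {Γ : List L.Ty} (p : Assn L Γ) : p.free.Finite := by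
  induction p with
  | atom B => exact B.finite_vars
  | neg p ih => exact ih
  | conj p q ihp ihq => exact ihp.union ihq
  | disj p q ihp ihq => exact ihp.union ihq
  | ex T p ih => exact ih
  | all T p ih => exact ih

theorem varSet_finite {n : ℕ} (x : Fin n → SVar L) : (varSet x).Finite := Set.finite_range _

theorem Stmt.finite_vars {H : Header L} (S : Stmt H) : S.vars.Finite := by
  induction S with
  | skip => exact Set.finite_empty
  | assign x t => exact (Set.finite_singleton _).union t.finite_vars
  | assignArr a s t =>
    exact ((Set.finite_singleton _).union (Set.finite_iUnion fun i => (s i).finite_vars)).union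
      t.finite_vars
  | par x hx t => exact (varSet_finite x).union (Set.finite_iUnion fun i => (t i).finite_vars)
  | seq S₁ S₂ ih₁ ih₂ => exact ih₁.union ih₂
  | cond B S₁ S₂ ih₁ ih₂ => exact (B.finite_vars.union ih₁).union ih₂
  | guard B S ih => exact B.finite_vars.union ih
  | loop B S ih => exact B.finite_vars.union ih
  | block x hx t S ih =>
    exact ((varSet_finite x).union (Set.finite_iUnion fun i => (t i).finite_vars)).union ih
  | call P t => exact Set.finite_iUnion fun i => (t i).finite_vars

theorem Decls.finite_vars {H : Header L} (D : Decls H) : D.vars.Finite :=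
  Set.finite_iUnion fun P => (varSet_finite _).union (D.body P).finite_vars

theorem Stmt.change_subset_globals {H : Header L} (S : Stmt H) : S.change ⊆ S.globals := by
  induction S with
  | skip => exact subset_rfl
  | assign x t => exact Set.subset_union_left
  | assignArr a s t => exact Set.subset_union_left.trans Set.subset_union_left
  | par x hx t => exact Set.subset_union_left
  | seq S₁ S₂ ih₁ ih₂ => exact Set.union_subset_union ih₁ ih₂
  | cond B S₁ S₂ ih₁ ih₂ =>
    exact Set.union_subset_union (ih₁.trans Set.subset_union_right) ih₂
  | guard B S ih => exact ih.trans Set.subset_union_right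
  | loop B S ih => exact ih.trans Set.subset_union_right
  | block x hx t S ih => exact (Set.sdiff_subset_sdiff_left ih).trans Set.subset_union_right
  | call P t => exact Set.empty_subset _

theorem Stmt.globals_subset_vars {H : Header L} (S : Stmt H) : S.globals ⊆ S.vars := by
  induction S with
  | skip => exact subset_rfl
  | assign x t => exact subset_rfl
  | assignArr a s t => exact subset_rfl
  | par x hx t => exact subset_rfl
  | seq S₁ S₂ ih₁ ih₂ => exact Set.union_subset_union ih₁ ih₂
  | cond B S₁ S₂ ih₁ ih₂ => exact Set.union_subset_union (Set.union_subset_union subset_rfl ih₁) ih₂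
  | guard B S ih => exact Set.union_subset_union subset_rfl ih
  | loop B S ih => exact Set.union_subset_union subset_rfl ih
  | block x hx t S ih =>
    exact Set.union_subset_union Set.subset_union_right (Set.sdiff_subset.trans ih)
  | call P t => exact subset_rfl

theorem Decls.change_subset_globals {H : Header L} (D : Decls H) : D.change ⊆ D.globals :=
  Set.iUnion_mono fun P => Set.sdiff_subset_sdiff_left (D.body P).change_subset_globals

theorem Decls.globals_subset_vars {H : Header L} (D : Decls H) : D.globals ⊆ D.vars :=
  Set.iUnion_mono fun P => (Set.sdiff_subset.trans (D.body P).globals_subset_vars).trans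
    Set.subset_union_right

/-! ### Codes of values and of finite sequences -/

section Coding

/-- The code of a finite sequence of natural numbers. -/
def encodeSeq (l : List ℕ) : ℕ := Denumerable.eqv (List ℕ) l

/-- The `i`-th element, counted from `1`, of the sequence coded by `w`. -/
def elemAt (w i : ℕ) : ℕ := (0 :: decodeSeq w).getD i 0

theorem decodeSeq_encodeSeq (l : List ℕ) : decodeSeq (encodeSeq l) = l :=
  (Denumerable.eqv (List ℕ)).symm_apply_apply l

theorem encodeSeq_injective : Function.Injective encodeSeq := (Denumerable.eqv (List ℕ)).injective

theorem elemAt_succ (w i : ℕ) : elemAt w (i + 1) = (decodeSeq w).getD i 0 := rfl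

theorem elemAt_encodeSeq_succ (l : List ℕ) (i : ℕ) : elemAt (encodeSeq l) (i + 1) = l.getD i 0 := by
  rw [elemAt_succ, decodeSeq_encodeSeq]

/-- Every function is given by a sequence code on an initial segment. -/
theorem exists_elemAt_eq (f : ℕ → ℕ) (n : ℕ) : ∃ w, ∀ i < n, elemAt w (i + 1) = f i := by
  refine ⟨encodeSeq ((List.range n).map f), fun i hi => ?_⟩
  rw [elemAt_encodeSeq_succ]
  simp [List.getD, hi]

variable {L : Lang} {M : Model L} (h : L.Ty → ℕ)

/-- The value of type `T` with the code `k` in the enumeration by the array variable `h_T`. -/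
def State.dec (σ : State M) (T : L.Ty) (k : ℕ) : M.Val T := σ.array (enumVar h T) fun _ => k

/-- The `i`-th value, counted from `0`, of the tuple of values coded by `c`. -/
def State.decTuple (σ : State M) {n : ℕ} (A : Fin n → L.Ty) (c : ℕ) (i : Fin n) : M.Val (A i) :=
  σ.dec h (A i) (elemAt c (i + 1))

variable {h}

theorem State.Enumerates.exists_dec {σ : State M} (hσ : σ.Enumerates h) {T : L.Ty} (d : M.Val T) :
    ∃ k, d = σ.dec h T k :=
  (hσ T d).imp fun _ hk => hk.symm

theorem State.Enumerates.exists_decTuple {σ : State M} (hσ : σ.Enumerates h) {n : ℕ}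
    {A : Fin n → L.Ty} (v : ∀ i, M.Val (A i)) : ∃ c, ∀ i, v i = σ.decTuple h A c i := by
  choose k hk using fun i => hσ.exists_dec (v i)
  obtain ⟨c, hc⟩ := exists_elemAt_eq (fun i => if hi : i < n then k ⟨i, hi⟩ else 0) n
  refine ⟨c, fun i => ?_⟩
  rw [State.decTuple, hc i i.2, dif_pos i.2, ← hk i]

end Coding

/-! ### Renaming of quantified variables -/

section Rename
variable {L : Lang} {M : Model L}

/-- A map between contexts of quantified variables. -/
abbrev Renaming (Γ Δ : List L.Ty) : Type := ∀ T : L.Ty, BVar Γ T → BVar Δ T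

/-- The extension of a renaming below a quantifier. -/
def Renaming.up {Γ Δ : List L.Ty} (ξ : Renaming Γ Δ) (U : L.Ty) : Renaming (U :: Γ) (U :: Δ)
  | _, .zero => .zero
  | _, .succ b => .succ (ξ _ b)

/-- Renaming of the quantified variables of an expression. -/
def Expr.rename {Γ Δ : List L.Ty} (ξ : Renaming Γ Δ) : {T : L.Ty} → Expr L Γ T → Expr L Δ T
  | _, .bvar b => .bvar (ξ _ b)
  | _, .var x => .var x
  | _, .arr a s => .arr a fun i => (s i).rename ξ
  | _, .op f s => .op f fun i => (s i).rename ξ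
  | _, .ite B s t => .ite (B.rename ξ) (s.rename ξ) (t.rename ξ)

/-- Renaming of the variables of an assertion that are bound outside of it. -/
def Assn.rename : {Γ Δ : List L.Ty} → Renaming Γ Δ → Assn L Γ → Assn L Δ
  | _, _, ξ, .atom B => .atom (B.rename ξ)
  | _, _, ξ, .neg p => .neg (p.rename ξ)
  | _, _, ξ, .conj p q => .conj (p.rename ξ) (q.rename ξ)
  | _, _, ξ, .disj p q => .disj (p.rename ξ) (q.rename ξ)
  | _, _, ξ, .ex T p => .ex T (p.rename (ξ.up T))
  | _, _, ξ, .all T p => .all T (p.rename (ξ.up T))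

theorem Expr.eval_rename (I : M.Interp) (σ : State M) {Γ Δ : List L.Ty} (ξ : Renaming Γ Δ)
    (ρ : Env M Δ) {T : L.Ty} (e : Expr L Γ T) :
    (e.rename ξ).eval I σ ρ = e.eval I σ fun T b => ρ T (ξ T b) := by
  induction e with
  | bvar b => rfl
  | var x => rfl
  | arr a s ih => simp only [Expr.rename, Expr.eval, ih]
  | op f s ih => simp only [Expr.rename, Expr.eval, ih]
  | ite B s t ihB ihs iht => simp only [Expr.rename, Expr.eval, ihB, ihs, iht]

theorem Env.cons_up {Γ Δ : List L.Ty} (ξ : Renaming Γ Δ) (ρ : Env M Δ) {U : L.Ty} (d : M.Val U) :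
    (fun T b => Env.cons d ρ T (ξ.up U T b)) = Env.cons d fun T b => ρ T (ξ T b) := by
  funext T b
  cases b <;> rfl

theorem Assn.sat_rename (I : M.Interp) (σ : State M) {Γ Δ : List L.Ty} (ξ : Renaming Γ Δ)
    (ρ : Env M Δ) (p : Assn L Γ) :
    (p.rename ξ).sat I σ ρ ↔ p.sat I σ fun T b => ρ T (ξ T b) := by
  induction p generalizing Δ with
  | atom B => simp only [Assn.rename, Assn.sat, Expr.eval_rename]
  | neg p ih => simp only [Assn.rename, Assn.sat, ih]
  | conj p q ihp ihq => simp only [Assn.rename, Assn.sat, ihp, ihq]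
  | disj p q ihp ihq => simp only [Assn.rename, Assn.sat, ihp, ihq]
  | ex T p ih => simp only [Assn.rename, Assn.sat, ih, Env.cons_up]
  | all T p ih => simp only [Assn.rename, Assn.sat, ih, Env.cons_up]

end Rename

/-! ### Definable predicates -/

section Definable
variable {L : Lang} {M : Model L}

/-- A type whose elements consist of a state and of values of the variables of a context. -/
class VCtx (M : Model L) (α : Type) where
  Γ : List L.Ty
  st : α → State M
  env : α → Env M Γ

instance : VCtx M (State M) := ⟨[], id, fun _ => Env.nil⟩

instance {α : Type} [VCtx M α] : VCtx M (α × ℕ) :=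
  ⟨.nat :: VCtx.Γ M α, fun p => VCtx.st p.1, fun p => Env.cons (T := .nat) p.2 (VCtx.env p.1)⟩

variable (I : M.Interp) (h : L.Ty → ℕ)

/-- A predicate is definable if some assertion expresses it, in all states in which the array
variables `h_T` are enumerations. -/
def Def {α : Type} [VCtx M α] (X : α → Prop) : Prop :=
  ∃ p : Assn L (VCtx.Γ M α), ∀ a : α, (VCtx.st a : State M).Enumerates h →
    (p.sat I (VCtx.st a) (VCtx.env a) ↔ X a)

/-- A function to the natural numbers is definable if its graph is. -/
def NFn {α : Type} [VCtx M α] (f : α → ℕ) : Prop := Def I h fun p : α × ℕ => f p.1 = p.2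

/-- A function to the values of type `T` is definable if its graph is, where values are
represented by their codes. -/
def VFn {α : Type} [VCtx M α] (T : L.Ty) (f : α → M.Val T) : Prop :=
  Def I h fun p : α × ℕ => f p.1 = (VCtx.st p.1).dec h T p.2

/-- A map of contexts that keeps the state and selects values. -/
def IsProj {α β : Type} [VCtx M α] [VCtx M β] (g : β → α) : Prop :=
  ∃ ξ : Renaming (VCtx.Γ M α) (VCtx.Γ M β), ∀ b, (VCtx.st (g b) : State M) = VCtx.st b ∧
    VCtx.env (M := M) (g b) = fun T v => VCtx.env b T (ξ T v)

variable {I h} {α β : Type} [VCtx M α] [VCtx M β] {X Y : α → Prop}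

variable (M α) in
/-- The last variable of a context, as an expression. -/
abbrev lastVar : Expr L (VCtx.Γ M (α × ℕ)) .nat := .bvar (.zero (Γ := VCtx.Γ M α))

variable (M α) in
/-- The last but one variable of a context, as an expression. -/
abbrev prevVar : Expr L (VCtx.Γ M ((α × ℕ) × ℕ)) .nat :=
  .bvar (.succ (.zero (Γ := VCtx.Γ M α)))

theorem IsProj.fst : IsProj (M := M) (Prod.fst : α × ℕ → α) := ⟨fun _ => .succ, fun _ => ⟨rfl, rfl⟩⟩

theorem IsProj.st : IsProj (M := M) (VCtx.st : α → State M) :=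
  ⟨fun _ b => (nomatch b : False).elim,
    fun _ => ⟨rfl, funext fun _ => funext fun b => (nomatch b : False).elim⟩⟩

theorem IsProj.prod {g : β → α} (hg : IsProj (M := M) g) :
    IsProj (M := M) fun p : β × ℕ => (g p.1, p.2) := by
  obtain ⟨ξ, hξ⟩ := hg
  refine ⟨ξ.up .nat, fun b => ⟨(hξ b.1).1, ?_⟩⟩
  change Env.cons (T := .nat) b.2 (VCtx.env (g b.1)) = _
  rw [(hξ b.1).2]
  exact (Env.cons_up ξ (VCtx.env b.1) (U := .nat) b.2).symm

theorem IsProj.comp {γ : Type} [VCtx M γ] {g : β → α} {f : γ → β} (hg : IsProj (M := M) g)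
    (hf : IsProj (M := M) f) : IsProj (M := M) fun c => g (f c) := by
  obtain ⟨ξ, hξ⟩ := hg
  obtain ⟨η, hη⟩ := hf
  refine ⟨fun T b => η T (ξ T b), fun c => ⟨(hξ _).1.trans (hη c).1, ?_⟩⟩
  rw [(hξ _).2, (hη c).2]

namespace Def

theorem congr (hX : Def I h X) (hXY : ∀ a, (VCtx.st a : State M).Enumerates h → (X a ↔ Y a)) :
    Def I h Y :=
  hX.imp fun _ hp a ha => (hp a ha).trans (hXY a ha)

theorem comp {g : β → α} (hg : IsProj (M := M) g) (hX : Def I h X) : Def I h fun b => X (g b) := by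
  obtain ⟨ξ, hξ⟩ := hg
  obtain ⟨p, hp⟩ := hX
  refine ⟨p.rename ξ, fun b hb => ?_⟩
  rw [Assn.sat_rename, ← (hξ b).2, ← (hξ b).1]
  exact hp (g b) ((hξ b).1.symm ▸ hb)

theorem not (hX : Def I h X) : Def I h fun a => ¬ X a := by
  obtain ⟨p, hp⟩ := hX
  exact ⟨.neg p, fun a ha => not_congr (hp a ha)⟩

theorem and (hX : Def I h X) (hY : Def I h Y) : Def I h fun a => X a ∧ Y a := by
  obtain ⟨p, hp⟩ := hX
  obtain ⟨q, hq⟩ := hY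
  exact ⟨.conj p q, fun a ha => and_congr (hp a ha) (hq a ha)⟩

theorem or (hX : Def I h X) (hY : Def I h Y) : Def I h fun a => X a ∨ Y a := by
  obtain ⟨p, hp⟩ := hX
  obtain ⟨q, hq⟩ := hY
  exact ⟨.disj p q, fun a ha => or_congr (hp a ha) (hq a ha)⟩

theorem imp (hX : Def I h X) (hY : Def I h Y) : Def I h fun a => X a → Y a :=
  (hX.not.or hY).congr fun _ _ => imp_iff_not_or.symm

theorem ex {Q : α → ℕ → Prop} (hQ : Def I h fun p : α × ℕ => Q p.1 p.2) :
    Def I h fun a => ∃ k, Q a k := by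
  obtain ⟨p, hp⟩ := hQ
  exact ⟨.ex .nat p, fun a ha => exists_congr fun k => hp (a, k) ha⟩

theorem all {Q : α → ℕ → Prop} (hQ : Def I h fun p : α × ℕ => Q p.1 p.2) :
    Def I h fun a => ∀ k, Q a k := by
  obtain ⟨p, hp⟩ := hQ
  exact ⟨.all .nat p, fun a ha => forall_congr' fun k => hp (a, k) ha⟩

theorem const (P : Prop) : Def I h fun _ : α => P := by
  by_cases hP : P
  · exact ⟨.atom (.op .tt fun i => i.elim0), fun _ _ => ⟨fun _ => hP, fun _ => rfl⟩⟩
  · exact ⟨.atom (.op .ff fun i => i.elim0), fun _ _ => ⟨fun e => (Bool.false_ne_true e).elim,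
      fun hP' => (hP hP').elim⟩⟩

theorem exists_mem {ι : Type} (l : List ι) {Q : α → ι → Prop}
    (hQ : ∀ i ∈ l, Def I h fun a => Q a i) : Def I h fun a => ∃ i ∈ l, Q a i := by
  induction l with
  | nil => exact (const False).congr fun _ _ => by simp
  | cons i l ih =>
    exact ((hQ i (by simp)).or (ih fun j hj => hQ j (by simp [hj]))).congr fun _ _ => by simp

theorem forall_mem {ι : Type} (l : List ι) {Q : α → ι → Prop}
    (hQ : ∀ i ∈ l, Def I h fun a => Q a i) : Def I h fun a => ∀ i ∈ l, Q a i := by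
  induction l with
  | nil => exact (const True).congr fun _ _ => by simp
  | cons i l ih =>
    exact ((hQ i (by simp)).and (ih fun j hj => hQ j (by simp [hj]))).congr fun _ _ => by simp

theorem forall_fin {n : ℕ} {Q : α → Fin n → Prop} (hQ : ∀ i, Def I h fun a => Q a i) :
    Def I h fun a => ∀ i, Q a i :=
  (forall_mem (List.finRange n) fun i _ => hQ i).congr fun _ _ => by simp

/-- Substitution of a definable function for the last variable. -/
theorem subst {X : α × ℕ → Prop} (hX : Def I h X) {f : α → ℕ} (hf : NFn I h f) :
    Def I h fun a => X (a, f a) :=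
  (ex (Q := fun a k => f a = k ∧ X (a, k)) (hf.and hX)).congr fun a _ =>
    by
      constructor
      · rintro ⟨k, rfl, hk⟩
        exact hk
      · exact fun hk => ⟨_, rfl, hk⟩

theorem expr_eq {T : L.Ty} (s t : Expr L (VCtx.Γ M α) T) :
    Def I h fun a : α => s.eval I (VCtx.st a) (VCtx.env a) = t.eval I (VCtx.st a) (VCtx.env a) :=
  ⟨.atom (.eq s t), fun _ _ => Expr.eval_eq_iff I _ _ s t⟩

end Def

theorem NFn.fst {f : α → ℕ} (hf : NFn I h f) : NFn I h fun p : α × ℕ => f p.1 :=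
  Def.comp IsProj.fst.prod hf

theorem NFn.snd : NFn I h fun p : α × ℕ => p.2 :=
  Def.expr_eq (M := M) (α := (α × ℕ) × ℕ) (prevVar M α) (lastVar M (α × ℕ))

theorem VFn.comp {g : β → α} (hg : IsProj (M := M) g) {T : L.Ty} {f : α → M.Val T}
    (hf : VFn I h T f) : VFn I h T fun b => f (g b) := by
  refine (Def.comp hg.prod hf).congr fun p _ => ?_
  obtain ⟨ξ, hξ⟩ := hg
  simp only [(hξ p.1).1]

theorem VFn.fst {T : L.Ty} {f : α → M.Val T} (hf : VFn I h T f) :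
    VFn I h T fun p : α × ℕ => f p.1 :=
  hf.comp IsProj.fst

/-- Substitution of definable functions into a definable relation between a state and numbers. -/
theorem Def.rel₂ {R : State M → ℕ → ℕ → Prop}
    (hR : Def I h fun p : (State M × ℕ) × ℕ => R p.1.1 p.1.2 p.2)
    {f g : α → ℕ} (hf : NFn I h f) (hg : NFn I h g) : Def I h fun a => R (VCtx.st a) (f a) (g a) :=
  ((hR.comp (IsProj.st (α := α)).prod.prod).subst hg.fst).subst hf

theorem Def.rel₃ {R : State M → ℕ → ℕ → ℕ → Prop}
    (hR : Def I h fun p : ((State M × ℕ) × ℕ) × ℕ => R p.1.1.1 p.1.1.2 p.1.2 p.2)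
    {f g k : α → ℕ} (hf : NFn I h f) (hg : NFn I h g) (hk : NFn I h k) :
    Def I h fun a => R (VCtx.st a) (f a) (g a) (k a) :=
  (((hR.comp (IsProj.st (α := α)).prod.prod.prod).subst hk.fst.fst).subst hg.fst).subst hf

namespace NFn
variable {f g : α → ℕ}

theorem const (k : ℕ) : NFn I h fun _ : α => k :=
  Def.expr_eq (M := M) (α := α × ℕ) (.op (.natConst k) fun i => i.elim0) (lastVar M α)

theorem comp₂ {F : ℕ → ℕ → ℕ} (e : Expr L [.nat, .nat] .nat)
    (he : ∀ (σ : State M) (ρ : Env M [.nat, .nat]),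
      e.eval I σ ρ = F (ρ .nat (.succ .zero)) (ρ .nat .zero))
    (hf : NFn I h f) (hg : NFn I h g) : NFn I h fun a => F (f a) (g a) := by
  refine Def.rel₃ (R := fun _ i j k => F i j = k) ?_ hf.fst hg.fst snd
  refine (Def.expr_eq (M := M) (α := ((State M × ℕ) × ℕ) × ℕ)
    (e.rename fun _ => .succ) (lastVar M ((State M × ℕ) × ℕ))).congr fun p _ => ?_
  rw [Expr.eval_rename, he]
  rfl

theorem elemAt (hf : NFn I h f) (hg : NFn I h g) : NFn I h fun a => elemAt (f a) (g a) :=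
  comp₂ (.op .elem ![.bvar (.succ .zero), .bvar .zero]) (fun _ _ => rfl) hf hg

theorem len (hf : NFn I h f) : NFn I h fun a => (decodeSeq (f a)).length :=
  comp₂ (F := fun i _ => (decodeSeq i).length) (.op .len ![.bvar (.succ .zero)])
    (fun _ _ => rfl) hf hf

theorem add (hf : NFn I h f) (hg : NFn I h g) : NFn I h fun a => f a + g a :=
  comp₂ (.op .natAdd ![.bvar (.succ .zero), .bvar .zero]) (fun _ _ => rfl) hf hg

theorem eq (hf : NFn I h f) (hg : NFn I h g) : Def I h fun a => f a = g a :=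
  Def.subst hf hg

theorem le (hf : NFn I h f) (hg : NFn I h g) : Def I h fun a => f a ≤ g a := by
  refine Def.rel₂ (R := fun _ i j => i ≤ j) ?_ hf hg
  refine ⟨.atom (.op .natLe ![.bvar (.succ .zero), .bvar .zero]), fun p _ => ?_⟩
  exact decide_eq_true_iff

theorem lt (hf : NFn I h f) (hg : NFn I h g) : Def I h fun a => f a < g a :=
  (hf.add (const 1)).le hg

end NFn

/-- The expression for the value of type `T` that is coded by `e`. -/
def decExpr (h : L.Ty → ℕ) {Γ : List L.Ty} (T : L.Ty) (e : Expr L Γ .nat) : Expr L Γ T :=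
  .arr (enumVar h T) fun _ => e

/-- The expression for the `i`-th value of the tuple of values that is coded by `e`. -/
def decTupleExpr (h : L.Ty → ℕ) {Γ : List L.Ty} {n : ℕ} (A : Fin n → L.Ty) (e : Expr L Γ .nat)
    (i : Fin n) : Expr L Γ (A i) :=
  decExpr h (A i) (.op .elem ![e, .op (.natConst (i + 1)) fun i => i.elim0])

namespace VFn
variable {T : L.Ty}

theorem expr (e : Expr L (VCtx.Γ M α) T) :
    VFn I h T fun a : α => e.eval I (VCtx.st a) (VCtx.env a) := by
  refine (Def.expr_eq (M := M) (α := α × ℕ) (e.rename fun _ => .succ)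
    (decExpr h T (lastVar M α))).congr fun p _ => ?_
  rw [Expr.eval_rename]
  rfl

theorem dec {f : α → ℕ} (hf : NFn I h f) : VFn I h T fun a => (VCtx.st a).dec h T (f a) :=
  Def.rel₂ (R := fun σ i j => σ.dec h T i = σ.dec h T j)
    (Def.expr_eq (M := M) (α := (State M × ℕ) × ℕ) (decExpr h T (prevVar M (State M)))
      (decExpr h T (lastVar M (State M × ℕ)))) hf.fst NFn.snd

theorem decTuple {n : ℕ} {A : Fin n → L.Ty} {f : α → ℕ} (hf : NFn I h f) (i : Fin n) :
    VFn I h (A i) fun a => (VCtx.st a).decTuple h A (f a) i :=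
  dec (hf.elemAt (NFn.const _))

theorem eq {f g : α → M.Val T} (hf : VFn I h T f) (hg : VFn I h T g) :
    Def I h fun a => f a = g a := by
  refine (Def.ex (Q := fun a k => f a = (VCtx.st a).dec h T k ∧ g a = (VCtx.st a).dec h T k)
    (hf.and hg)).congr fun a ha => ⟨fun ⟨k, e₁, e₂⟩ => e₁.trans e₂.symm, fun e => ?_⟩
  obtain ⟨k, hk⟩ := ha.exists_dec (f a)
  exact ⟨k, hk, e ▸ hk⟩

theorem congr {f g : α → M.Val T} (hf : VFn I h T f)
    (hfg : ∀ a, (VCtx.st a : State M).Enumerates h → f a = g a) : VFn I h T g :=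
  Def.congr hf fun p hp => by rw [hfg p.1 hp]

/-- The predicate that a number codes the tuple of the values of definable functions. -/
theorem eq_decTuple {n : ℕ} {A : Fin n → L.Ty} {f : ∀ i, α → M.Val (A i)}
    (hf : ∀ i, VFn I h (A i) (f i)) :
    Def I h fun p : α × ℕ => ∀ i, f i p.1 = (VCtx.st p.1).decTuple h A p.2 i :=
  Def.forall_fin fun i => (hf i).fst.eq (decTuple NFn.snd i)

/-- Definable functions may be substituted for the members of a tuple. -/
theorem comp_tuple {n : ℕ} {A : Fin n → L.Ty} {f : ∀ i, α → M.Val (A i)}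
    (hf : ∀ i, VFn I h (A i) (f i)) {F : α → (∀ i, M.Val (A i)) → M.Val T}
    (hF : VFn I h T fun p : α × ℕ => F p.1 ((VCtx.st p.1).decTuple h A p.2)) :
    VFn I h T fun a => F a fun i => f i a := by
  refine (Def.ex (Q := fun (p : α × ℕ) c => (∀ i, f i p.1 = (VCtx.st p.1).decTuple h A c i) ∧
    F p.1 ((VCtx.st p.1).decTuple h A c) = (VCtx.st p.1).dec h T p.2) ?_).congr fun p hp => ?_
  · refine (eq_decTuple fun i => (hf i).fst).and ?_
    exact (VFn.comp IsProj.fst.prod hF).eq (dec NFn.snd.fst)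
  · constructor
    · rintro ⟨c, hc, e⟩
      change F p.1 (fun i => f i p.1) = _
      rwa [show (fun i => f i p.1) = (VCtx.st p.1).decTuple h A c from funext hc]
    · intro e
      change F p.1 (fun i => f i p.1) = _ at e
      obtain ⟨c, hc⟩ := State.Enumerates.exists_decTuple hp fun i => f i p.1
      refine ⟨c, hc, ?_⟩
      rwa [show (fun i => f i p.1) = (VCtx.st p.1).decTuple h A c from funext hc] at e

theorem op {n : ℕ} {A : Fin n → L.Ty} (c : Op L n A T) {f : ∀ i, α → M.Val (A i)}
    (hf : ∀ i, VFn I h (A i) (f i)) : VFn I h T fun a => c.eval M I fun i => f i a :=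
  comp_tuple (F := fun _ v => c.eval M I v) hf
    (expr (M := M) (α := α × ℕ) (.op c (decTupleExpr h A (lastVar M α))))

theorem ite {b : α → Bool} {f g : α → M.Val T} (hb : VFn I h .bool b) (hf : VFn I h T f)
    (hg : VFn I h T g) : VFn I h T fun a => bif b a then f a else g a := by
  have ht : VFn I h .bool fun _ : α => true :=
    expr (M := M) (α := α) (T := .bool) (.op .tt fun i => i.elim0)
  refine (((hb.eq ht).comp IsProj.fst |>.and hf).or
    (((hb.eq ht).comp IsProj.fst).not.and hg)).congr fun p _ => ?_
  cases hb : b p.1 <;> simp [hb]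

theorem bool_eq {b : α → Bool} (hb : VFn I h .bool b) (c : Bool) : Def I h fun a => b a = c :=
  VFn.eq (T := .bool) hb (by
    cases c
    · exact expr (M := M) (α := α) (T := .bool) (.op .ff fun i => i.elim0)
    · exact expr (M := M) (α := α) (T := .bool) (.op .tt fun i => i.elim0))

end VFn

variable (I h) in
/-- A definable function to states. The value of an array variable is represented by its
values at all coded tuples of arguments. -/
structure DefState (τ : α → State M) : Prop where
  simple : ∀ x, VFn I h x.ty fun a => (τ a).simple x
  array : ∀ b, VFn I h b.val fun p : α × ℕ =>
    (τ p.1).array b ((VCtx.st p.1).decTuple h b.arg p.2)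

namespace DefState
variable {τ : α → State M}

theorem st : DefState I h (VCtx.st : α → State M) where
  simple x := VFn.expr (M := M) (α := α) (.var x)
  array b := VFn.expr (M := M) (α := α × ℕ) (.arr b (decTupleExpr h b.arg (lastVar M α)))

theorem fst (hτ : DefState I h τ) : DefState I h fun p : α × ℕ => τ p.1 where
  simple x := (hτ.simple x).fst
  array b := VFn.comp IsProj.fst.prod (hτ.array b)

theorem arr (hτ : DefState I h τ) (b : AVar L) {f : ∀ i, α → M.Val (b.arg i)}
    (hf : ∀ i, VFn I h (b.arg i) (f i)) : VFn I h b.val fun a => (τ a).array b fun i => f i a :=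
  VFn.comp_tuple (F := fun a v => (τ a).array b v) hf (hτ.array b)

theorem eval (hτ : DefState I h τ) {Γ : List L.Ty} {ρ : α → Env M Γ}
    (hρ : ∀ T b, VFn I h T fun a => ρ a T b) {T : L.Ty} (e : Expr L Γ T) :
    VFn I h T fun a => e.eval I (τ a) (ρ a) := by
  induction e with
  | bvar b => exact hρ _ b
  | var x => exact hτ.simple x
  | arr b s ih => exact hτ.arr b ih
  | op c s ih => exact VFn.op c ih
  | ite B s t ihB ihs iht => exact VFn.ite ihB ihs iht

theorem peval (hτ : DefState I h τ) {T : L.Ty} (e : PExpr L T) :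
    VFn I h T fun a => (τ a).eval I e :=
  hτ.eval (ρ := fun _ => Env.nil) (fun _ b => (nomatch b : False).elim) e

theorem env_cons {Γ : List L.Ty} {ρ : α → Env M Γ} (hρ : ∀ T b, VFn I h T fun a => ρ a T b)
    {U : L.Ty} (T : L.Ty) (b : BVar (U :: Γ) T) :
    VFn I h T fun p : α × ℕ => Env.cons ((VCtx.st p.1).dec h U p.2) (ρ p.1) T b := by
  cases b with
  | zero => exact VFn.dec NFn.snd
  | succ b => exact (hρ T b).fst

theorem sat (hτ : DefState I h τ) {Γ : List L.Ty} {ρ : α → Env M Γ}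
    (hρ : ∀ T b, VFn I h T fun a => ρ a T b) (p : Assn L Γ) :
    Def I h fun a => p.sat I (τ a) (ρ a) := by
  induction p generalizing α with
  | atom B => exact (hτ.eval hρ B).bool_eq true
  | neg p ih => exact (ih hτ hρ).not
  | conj p q ihp ihq => exact (ihp hτ hρ).and (ihq hτ hρ)
  | disj p q ihp ihq => exact (ihp hτ hρ).or (ihq hτ hρ)
  | ex T p ih =>
    refine (Def.ex (Q := fun a k => p.sat I (τ a) (Env.cons ((VCtx.st a).dec h T k) (ρ a)))
      (ih hτ.fst (env_cons hρ))).congr fun a ha => ⟨fun ⟨k, hk⟩ => ⟨_, hk⟩, fun ⟨d, hd⟩ => ?_⟩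
    obtain ⟨k, rfl⟩ := ha.exists_dec d
    exact ⟨k, hd⟩
  | all T p ih =>
    refine (Def.all (Q := fun a k => p.sat I (τ a) (Env.cons ((VCtx.st a).dec h T k) (ρ a)))
      (ih hτ.fst (env_cons hρ))).congr fun a ha => ⟨fun hk d => ?_, fun hd k => hd _⟩
    obtain ⟨k, rfl⟩ := ha.exists_dec d
    exact hk k

theorem psat (hτ : DefState I h τ) (p : Assertion L) :
    Def I h fun a => p.sat I (τ a) Env.nil :=
  hτ.sat (ρ := fun _ => Env.nil) (fun _ b => (nomatch b : False).elim) p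

end DefState

end Definable

/-! ### A stack machine for recursive programs -/

section Machine
variable {L : Lang} {M : Model L} {H : Header L}

open scoped Classical in
/-- The code of a stack with the rest `r` and an uppermost frame that refers to the statement `S`
of the list `N`; `tag` is the kind of the frame and `y` a parameter of it. -/
noncomputable def frame (N : List (Stmt H)) (tag : ℕ) (S : Stmt H) (r y : ℕ) : ℕ :=
  encodeSeq [tag, N.idxOf S, r, y]

/-- The stack with the rest `r` on which the statement `S` is to be executed first. -/
noncomputable def pushStmt (N : List (Stmt H)) (S : Stmt H) (r : ℕ) : ℕ := frame N 0 S r 0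

/-- The stack with the rest `r` on which first the local variables of the block or call `S` are
to be restored, to the tuple of values coded by `y`. -/
noncomputable def pushRestore (N : List (Stmt H)) (S : Stmt H) (r y : ℕ) : ℕ := frame N 1 S r y

/-- The code of the empty stack. -/
def emptyStack : ℕ := encodeSeq []

section
variable {N : List (Stmt H)} {S T : Stmt H} {r r' y y' : ℕ}

theorem frame_inj {tag tag' : ℕ} (hS : S ∈ N) (e : frame N tag S r y = frame N tag' T r' y') :
    tag = tag' ∧ S = T ∧ r = r' ∧ y = y' := by
  classical
  have := encodeSeq_injective e
  simp only [List.cons.injEq, and_true] at this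
  exact ⟨this.1, (List.idxOf_inj hS).1 this.2.1, this.2.2⟩

theorem pushStmt_inj (hS : S ∈ N) (e : pushStmt N S r = pushStmt N T r') : S = T ∧ r = r' :=
  ⟨(frame_inj hS e).2.1, (frame_inj hS e).2.2.1⟩

theorem pushRestore_inj (hS : S ∈ N) (e : pushRestore N S r y = pushRestore N T r' y') :
    S = T ∧ r = r' ∧ y = y' :=
  (frame_inj hS e).2

theorem pushStmt_ne_pushRestore (hS : S ∈ N) : pushStmt N S r ≠ pushRestore N T r' y' := fun e =>
  zero_ne_one (frame_inj hS e).1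

theorem pushStmt_ne_emptyStack : pushStmt N S r ≠ emptyStack := fun e =>
  List.cons_ne_nil _ _ (encodeSeq_injective e)

theorem pushRestore_ne_emptyStack : pushRestore N S r y ≠ emptyStack := fun e =>
  List.cons_ne_nil _ _ (encodeSeq_injective e)

end

/-- The tuple of values coded by `c`, for a decoding `e` of values. -/
def tupleOf (e : ∀ T : L.Ty, ℕ → M.Val T) {n : ℕ} (A : Fin n → L.Ty) (c : ℕ) (i : Fin n) :
    M.Val (A i) :=
  e (A i) (elemAt c (i + 1))

variable (I : M.Interp) (D : Decls H) (N : List (Stmt H)) (e : ∀ T : L.Ty, ℕ → M.Val T)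

/-- Entering the block, or procedure body, `B` with the local variables `x` and their initial
values `t`: the old values of `x` are saved on the stack, in a frame that refers to `S`. -/
def EnterStep (S : Stmt H) {n : ℕ} (x : Fin n → SVar L) (t : ∀ i, PExpr L (x i).ty) (B : Stmt H)
    (r : ℕ) (σ : State M) (k' : ℕ) (σ' : State M) : Prop :=
  (∃ y, (∀ i, σ.simple (x i) = tupleOf e (fun i => (x i).ty) y i) ∧
    k' = pushStmt N B (pushRestore N S r y)) ∧ σ' = σ.setMany x fun i => σ.eval I (t i)

/-- One step of the machine from the stack with the statement `S` on top of `r`, and the state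
`σ`, to the stack `k'` and the state `σ'`. -/
def StmtStep (S : Stmt H) (r : ℕ) (σ : State M) (k' : ℕ) (σ' : State M) : Prop :=
  match S with
  | .skip => k' = r ∧ σ' = σ
  | .assign x t => k' = r ∧ σ' = σ.set x (σ.eval I t)
  | .assignArr a s t => k' = r ∧ σ' = σ.setArr a (fun i => σ.eval I (s i)) (σ.eval I t)
  | .par x _ t => k' = r ∧ σ' = σ.setMany x fun i => σ.eval I (t i)
  | .seq S₁ S₂ => k' = pushStmt N S₁ (pushStmt N S₂ r) ∧ σ' = σ
  | .cond B S₁ S₂ =>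
      (σ.eval I B = true ∧ k' = pushStmt N S₁ r ∨ σ.eval I B = false ∧ k' = pushStmt N S₂ r) ∧
        σ' = σ
  | .guard B S => (σ.eval I B = true ∧ k' = pushStmt N S r) ∧ σ' = σ
  | .loop B S =>
      (σ.eval I B = true ∧ k' = pushStmt N S (pushStmt N (.loop B S) r) ∨
        σ.eval I B = false ∧ k' = r) ∧ σ' = σ
  | .block x hx t B => EnterStep I N e (.block x hx t B) x t B r σ k' σ'
  | .call P t => EnterStep I N e (.call P t) (H.formal P) t (D.body P) r σ k' σ'

/-- The step of the machine that restores the local variables of the block or call `S`. -/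
def RestoreStep (S : Stmt H) (r y : ℕ) (σ : State M) (k' : ℕ) (σ' : State M) : Prop :=
  match S with
  | .block x _ _ _ => k' = r ∧ σ' = σ.setMany x (tupleOf e (fun i => (x i).ty) y)
  | .call P _ =>
      k' = r ∧ σ' = σ.setMany (H.formal P) (tupleOf e (fun i => (H.formal P i).ty) y)
  | _ => False

/-- The steps of the machine, between pairs of a stack and a state. -/
def MStep (c c' : ℕ × State M) : Prop :=
  ∃ S ∈ N, ∃ r, (c.1 = pushStmt N S r ∧ StmtStep I D N e S r c.2 c'.1 c'.2) ∨
    ∃ y, c.1 = pushRestore N S r y ∧ RestoreStep e S r y c.2 c'.1 c'.2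

/-- The condition under which the statement does not fail at once. -/
def Guarded (σ : State M) : Stmt H → Prop
  | .guard B _ => σ.eval I B = true
  | _ => True

/-- A configuration of the machine in which neither failure is imminent nor the execution has
ended with the assertion `q` being false. -/
def Good (q : Assertion L) (c : ℕ × State M) : Prop :=
  (c.1 = emptyStack → q.sat I c.2 Env.nil) ∧
    ∀ S ∈ N, ∀ r, c.1 = pushStmt N S r → Guarded I c.2 S

/-- The weakest precondition of the assertion `q` for the stack `k`. -/
def WP (q : Assertion L) (k : ℕ) (σ : State M) : Prop :=
  ∀ c, Relation.ReflTransGen (MStep I D N e) (k, σ) c → Good I N q c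

variable {I D N e} {q : Assertion L}

theorem WP.step {k k' : ℕ} {σ σ' : State M} (hw : WP I D N e q k σ)
    (hs : MStep I D N e (k, σ) (k', σ')) : WP I D N e q k' σ' :=
  fun c hc => hw c (.head hs hc)

theorem WP.stmtStep {S : Stmt H} (hS : S ∈ N) {r k' : ℕ} {σ σ' : State M}
    (hw : WP I D N e q (pushStmt N S r) σ) (hs : StmtStep I D N e S r σ k' σ') :
    WP I D N e q k' σ' :=
  hw.step ⟨S, hS, r, .inl ⟨rfl, hs⟩⟩

theorem WP.restoreStep {S : Stmt H} (hS : S ∈ N) {r y k' : ℕ} {σ σ' : State M}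
    (hw : WP I D N e q (pushRestore N S r y) σ) (hs : RestoreStep e S r y σ k' σ') :
    WP I D N e q k' σ' :=
  hw.step ⟨S, hS, r, .inr ⟨y, rfl, hs⟩⟩

theorem WP.guarded {S : Stmt H} (hS : S ∈ N) {r : ℕ} {σ : State M}
    (hw : WP I D N e q (pushStmt N S r) σ) : Guarded I σ S :=
  (hw _ .refl).2 S hS r rfl

theorem WP.sat {σ : State M} (hw : WP I D N e q emptyStack σ) : q.sat I σ Env.nil :=
  (hw _ .refl).1 rfl

end Machine

/-! ### Finite modifications of a state -/

section Patch
variable {L : Lang} {M : Model L}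

open scoped Classical in
/-- The first element of the sequence coded by `w` with the property `P`. -/
noncomputable def lookup (w : ℕ) (P : ℕ → Prop) : Option ℕ := (decodeSeq w).find? fun c => P c

theorem lookup_nil (P : ℕ → Prop) : lookup (encodeSeq []) P = none := by
  rw [lookup, decodeSeq_encodeSeq, List.find?_nil]

theorem lookup_cons_of_pos {P : ℕ → Prop} {c : ℕ} (hc : P c) (w : ℕ) :
    lookup (encodeSeq (c :: decodeSeq w)) P = some c := by
  rw [lookup, decodeSeq_encodeSeq, List.find?_cons_of_pos (by simpa using hc)]

theorem lookup_cons_of_neg {P : ℕ → Prop} {c : ℕ} (hc : ¬ P c) (w : ℕ) :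
    lookup (encodeSeq (c :: decodeSeq w)) P = lookup w P := by
  rw [lookup, decodeSeq_encodeSeq, List.find?_cons_of_neg (by simpa using hc), lookup]

variable (h : L.Ty → ℕ) (V : List (Var L))

open scoped Classical in
/-- An entry of a modification concerns the simple variable `x`. -/
def MatchSimple (x : SVar L) (c : ℕ) : Prop := elemAt c 1 = V.idxOf (Var.simple x)

open scoped Classical in
/-- An entry of a modification concerns the array variable `a` at the arguments `v`. -/
def MatchArray (σ : State M) (a : AVar L) (v : ∀ i, M.Val (a.arg i)) (c : ℕ) : Prop :=
  elemAt c 1 = V.idxOf (Var.array a) ∧ ∀ i, v i = σ.decTuple h a.arg (elemAt c 3) i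

open scoped Classical in
/-- The modification, coded by `w`, of a state: `w` codes a sequence of entries, each of which
codes a variable of the list `V` by its index, a value by its code, and a tuple of arguments by
its code. The first matching entry counts. -/
noncomputable def State.patch (σ : State M) (w : ℕ) : State M where
  simple x := if Var.simple x ∈ V then
      (lookup w (MatchSimple V x)).elim (σ.simple x) fun c => σ.dec h x.ty (elemAt c 2)
    else σ.simple x
  array a v := if Var.array a ∈ V then
      (lookup w (MatchArray h V σ a v)).elim (σ.array a v) fun c => σ.dec h a.val (elemAt c 2)
    else σ.array a v

variable {h V}

theorem elemAt_triple (a b c : ℕ) : elemAt (encodeSeq [a, b, c]) 1 = a ∧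
    elemAt (encodeSeq [a, b, c]) 2 = b ∧ elemAt (encodeSeq [a, b, c]) 3 = c :=
  ⟨elemAt_encodeSeq_succ _ 0, elemAt_encodeSeq_succ _ 1, elemAt_encodeSeq_succ _ 2⟩

open scoped Classical in
theorem matchSimple_iff {v : Var L} (hv : v ∈ V) (k c : ℕ) (x : SVar L) :
    MatchSimple V x (encodeSeq [V.idxOf v, k, c]) ↔ v = Var.simple x := by
  rw [MatchSimple, (elemAt_triple _ _ _).1, List.idxOf_inj hv]

open scoped Classical in
theorem matchArray_iff {σ : State M} {v : Var L} (hv : v ∈ V) (k c : ℕ) (a : AVar L)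
    (u : ∀ i, M.Val (a.arg i)) : MatchArray h V σ a u (encodeSeq [V.idxOf v, k, c]) ↔
      v = Var.array a ∧ ∀ i, u i = σ.decTuple h a.arg c i := by
  rw [MatchArray, (elemAt_triple _ _ _).1, (elemAt_triple _ _ _).2.2, List.idxOf_inj hv]

theorem State.patch_nil (σ : State M) : σ.patch h V (encodeSeq []) = σ := by
  refine State.ext' (fun x => ?_) fun a v => ?_ <;> simp [State.patch, lookup_nil]

theorem State.patch_simple_of_notMem (σ : State M) (w : ℕ) {x : SVar L}
    (hx : Var.simple x ∉ V) : (σ.patch h V w).simple x = σ.simple x :=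
  if_neg hx

theorem State.patch_array_of_notMem (σ : State M) (w : ℕ) {a : AVar L}
    (ha : Var.array a ∉ V) : (σ.patch h V w).array a = σ.array a :=
  funext fun _ => if_neg ha

variable {σ : State M} (hσ : σ.Enumerates h)
include hσ

open scoped Classical in
theorem State.exists_patch_set {x : SVar L} (hx : Var.simple x ∈ V) (w : ℕ) (d : M.Val x.ty) :
    ∃ w', (σ.patch h V w).set x d = σ.patch h V w' := by
  obtain ⟨k, hk⟩ := hσ.exists_dec d
  refine ⟨encodeSeq (encodeSeq [V.idxOf (Var.simple x), k, 0] :: decodeSeq w),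
    State.ext' (fun y => ?_) fun a v => ?_⟩
  · by_cases hy : y = x
    · subst hy
      rw [State.set_simple_self]
      simp only [State.patch]
      rw [if_pos hx, lookup_cons_of_pos ((matchSimple_iff hx _ _ _).2 rfl), Option.elim_some,
        (elemAt_triple _ _ _).2.1]
      exact hk
    · rw [State.set_simple_of_ne _ _ hy]
      simp only [State.patch]
      rw [lookup_cons_of_neg]
      rw [matchSimple_iff hx]
      intro e
      cases e
      exact hy rfl
  · change (σ.patch h V w).array a v = _
    simp only [State.patch]
    rw [lookup_cons_of_neg]
    rw [matchArray_iff hx]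
    exact fun e => nomatch e.1

open scoped Classical in
theorem State.exists_patch_setArr {a : AVar L} (ha : Var.array a ∈ V) (w : ℕ)
    (v : ∀ i, M.Val (a.arg i)) (d : M.Val a.val) :
    ∃ w', (σ.patch h V w).setArr a v d = σ.patch h V w' := by
  obtain ⟨k, hk⟩ := hσ.exists_dec d
  obtain ⟨c, hc⟩ := hσ.exists_decTuple v
  refine ⟨encodeSeq (encodeSeq [V.idxOf (Var.array a), k, c] :: decodeSeq w),
    State.ext' (fun y => ?_) fun b u => ?_⟩
  · change (σ.patch h V w).simple y = _
    simp only [State.patch]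
    rw [lookup_cons_of_neg]
    rw [matchSimple_iff ha]
    exact fun e => nomatch e
  · by_cases hb : b = a
    · subst hb
      simp only [State.setArr, Function.update_self]
      by_cases hu : u = v
      · subst hu
        rw [Function.update_self]
        simp only [State.patch]
        rw [if_pos ha, lookup_cons_of_pos ((matchArray_iff ha _ _ _ _).2 ⟨rfl, hc⟩),
          Option.elim_some, (elemAt_triple _ _ _).2.1]
        exact hk
      · rw [Function.update_of_ne hu]
        simp only [State.patch]
        rw [lookup_cons_of_neg]
        rw [matchArray_iff ha]
        exact fun e => hu (funext fun i => (e.2 i).trans (hc i).symm)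
    · simp only [State.setArr, Function.update_of_ne hb]
      simp only [State.patch]
      rw [lookup_cons_of_neg]
      rw [matchArray_iff ha]
      rintro ⟨e, -⟩
      cases e
      exact hb rfl

theorem State.exists_patch_setMany {n : ℕ} {x : Fin n → SVar L} (hx : Function.Injective x)
    (hxV : ∀ i, Var.simple (x i) ∈ V) (w : ℕ) (d : ∀ i, M.Val (x i).ty) :
    ∃ w', (σ.patch h V w).setMany x d = σ.patch h V w' := by
  induction n with
  | zero => exact ⟨w, State.setMany_zero _ _ _⟩
  | succ n ih =>
    obtain ⟨w', hw'⟩ := ih (hx.comp (Fin.succ_injective n)) (fun i => hxV i.succ)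
      fun i => d i.succ
    rw [State.setMany_succ _ hx]
    simp only [Function.comp_def] at hw'
    rw [hw']
    exact State.exists_patch_set hσ (hxV 0) w' (d 0)

end Patch

/-! ### Definability of the weakest preconditions -/

section DefWP
variable {L : Lang} {M : Model L} {I : M.Interp} {h : L.Ty → ℕ} {α : Type} [VCtx M α]

theorem Def.comp_last {Q : α → ℕ → Prop} (hQ : Def I h fun p : α × ℕ => Q p.1 p.2) {β : Type}
    [VCtx M β] {g : β → α} (hg : IsProj (M := M) g) {f : β → ℕ} (hf : NFn I h f) :
    Def I h fun b => Q (g b) (f b) :=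
  (hQ.comp hg.prod).subst hf

open scoped Classical in
theorem VFn.ite_prop {P : α → Prop} (hP : Def I h P) {T : L.Ty} {f g : α → M.Val T}
    (hf : VFn I h T f) (hg : VFn I h T g) : VFn I h T fun a => if P a then f a else g a := by
  refine (((hP.comp IsProj.fst).and hf).or ((hP.comp IsProj.fst).not.and hg)).congr fun p _ => ?_
  by_cases hp : P p.1 <;> simp [hp]

theorem lookup_elim_eq_iff {X : Type} (w : ℕ) (P : ℕ → Prop) (x y : X) (f : ℕ → X) :
    (lookup w P).elim x f = y ↔
      (∃ i, i < (decodeSeq w).length ∧ P (elemAt w (i + 1)) ∧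
        (∀ j, j < i → ¬ P (elemAt w (j + 1))) ∧ f (elemAt w (i + 1)) = y) ∨
      (∀ i, i < (decodeSeq w).length → ¬ P (elemAt w (i + 1))) ∧ x = y := by
  classical
  simp only [elemAt_succ]
  cases hl : lookup w P with
  | none =>
    rw [lookup, List.find?_eq_none] at hl
    have hl' : ∀ i, i < (decodeSeq w).length → ¬ P ((decodeSeq w).getD i 0) := by
      intro i hi
      rw [List.getD_eq_getElem _ _ hi]
      simpa using hl _ (List.getElem_mem hi)
    rw [Option.elim_none]
    constructor
    · exact fun e => .inr ⟨hl', e⟩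
    · rintro (⟨i, hi, hP, -⟩ | ⟨-, e⟩)
      · exact (hl' i hi hP).elim
      · exact e
  | some c =>
    rw [lookup, List.find?_eq_some_iff_getElem] at hl
    obtain ⟨hc, i, hi, rfl, hj⟩ := hl
    have hc' : P ((decodeSeq w).getD i 0) := by
      rw [List.getD_eq_getElem _ _ hi]
      simpa using hc
    have hj' : ∀ j, j < i → ¬ P ((decodeSeq w).getD j 0) := by
      intro j hji
      rw [List.getD_eq_getElem _ _ (hji.trans hi)]
      simpa using hj j hji
    rw [Option.elim_some, ← List.getD_eq_getElem _ 0 hi]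
    constructor
    · exact fun e => .inl ⟨i, hi, hc', hj', e⟩
    · rintro (⟨k, hk, hP, hk', e⟩ | ⟨hn, -⟩)
      · obtain rfl : k = i := by
          rcases lt_trichotomy k i with hki | rfl | hki
          · exact (hj' k hki hP).elim
          · rfl
          · exact (hk' i hki hc').elim
        exact e
      · exact (hn i hi hc').elim

theorem VFn.lookup {Q : α → ℕ → Prop} (hQ : Def I h fun p : α × ℕ => Q p.1 p.2) {w : α → ℕ}
    (hw : NFn I h w) {T : L.Ty} {g : α → M.Val T} (hg : VFn I h T g) :
    VFn I h T fun a => (lookup (w a) (Q a)).elim (g a) fun c =>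
      (VCtx.st a).dec h T (elemAt c 2) := by
  refine Def.congr (X := fun p : α × ℕ => _)
    (Def.or (Def.ex (Def.and ?_ (Def.and ?_ (Def.and ?_ ?_))))
    (Def.and (Def.all (Def.imp ?_ ?_)) ?_))
    fun p _ => (lookup_elim_eq_iff (w p.1) (Q p.1) (g p.1) ((VCtx.st p.1).dec h T p.2)
      fun c => (VCtx.st p.1).dec h T (elemAt c 2)).symm
  · exact NFn.snd.lt hw.fst.fst.len
  · exact hQ.comp_last (g := fun p : (α × ℕ) × ℕ => p.1.1) (IsProj.fst.comp IsProj.fst)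
      (hw.fst.fst.elemAt (NFn.snd.add (.const 1)))
  · exact .all (.imp (NFn.snd.lt NFn.snd.fst) (.not (hQ.comp_last
      (g := fun p : ((α × ℕ) × ℕ) × ℕ => p.1.1.1) ((IsProj.fst.comp IsProj.fst).comp IsProj.fst)
      (hw.fst.fst.fst.elemAt (NFn.snd.add (.const 1))))))
  · exact (VFn.dec ((hw.fst.fst.elemAt (NFn.snd.add (.const 1))).elemAt (.const 2))).eq
      (VFn.dec NFn.snd.fst)
  · exact NFn.snd.lt hw.fst.fst.len
  · exact .not (hQ.comp_last (g := fun p : (α × ℕ) × ℕ => p.1.1) (IsProj.fst.comp IsProj.fst)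
      (hw.fst.fst.elemAt (NFn.snd.add (.const 1))))
  · exact hg.fst.eq (VFn.dec NFn.snd)

namespace DefState

theorem patch (V : List (Var L)) {w : α → ℕ} (hw : NFn I h w) :
    DefState I h fun a : α => (VCtx.st a : State M).patch h V (w a) where
  simple x := by
    by_cases hx : Var.simple x ∈ V
    · simp only [State.patch, if_pos hx]
      exact VFn.lookup (Q := fun _ => MatchSimple V x) ((NFn.snd.elemAt (.const 1)).eq (.const _))
        hw (DefState.st.simple x)
    · simp only [State.patch, if_neg hx]
      exact DefState.st.simple x
  array b := by
    by_cases hb : Var.array b ∈ V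
    · simp only [State.patch, if_pos hb]
      refine VFn.lookup (α := α × ℕ) (Q := fun p => MatchArray h V (VCtx.st p.1) b
        ((VCtx.st p.1).decTuple h b.arg p.2)) (.and ?_ ?_) hw.fst (DefState.st.array b)
      · exact (NFn.snd.elemAt (.const 1)).eq (.const _)
      · exact .forall_fin fun i => (VFn.decTuple NFn.snd.fst i).eq
          (VFn.decTuple (NFn.snd.elemAt (.const 3)) i)
    · simp only [State.patch, if_neg hb]
      exact DefState.st.array b

variable {τ τ' : α → State M}

theorem set (hτ : DefState I h τ) (x : SVar L) {d : α → M.Val x.ty} (hd : VFn I h x.ty d) :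
    DefState I h fun a => (τ a).set x (d a) where
  simple y := by
    by_cases hy : y = x
    · subst hy
      simpa only [State.set_simple_self] using hd
    · simpa only [State.set_simple_of_ne _ _ hy] using hτ.simple y
  array b := hτ.array b

theorem setMany (hτ : DefState I h τ) {n : ℕ} {x : Fin n → SVar L} (hx : Function.Injective x)
    {d : ∀ i, α → M.Val (x i).ty} (hd : ∀ i, VFn I h (x i).ty (d i)) :
    DefState I h fun a => (τ a).setMany x fun i => d i a := by
  induction n with
  | zero => simpa only [State.setMany_zero] using hτ
  | succ n ih =>
    simp only [State.setMany_succ _ hx]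
    exact (ih (hx.comp (Fin.succ_injective n)) fun i => hd i.succ).set _ (hd 0)

open scoped Classical in
theorem setArr (hτ : DefState I h τ) (a : AVar L) {v : ∀ i, α → M.Val (a.arg i)}
    (hv : ∀ i, VFn I h (a.arg i) (v i)) {d : α → M.Val a.val} (hd : VFn I h a.val d) :
    DefState I h fun c => (τ c).setArr a (fun i => v i c) (d c) where
  simple y := hτ.simple y
  array b := by
    by_cases hb : b = a
    · subst hb
      simp only [State.setArr, Function.update_self]
      refine (VFn.ite_prop (VFn.eq_decTuple hv) hd.fst (hτ.array b)).congr fun p _ => ?_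
      by_cases hp : (VCtx.st p.1).decTuple h b.arg p.2 = fun i => v i p.1
      · rw [if_pos fun i => (congrFun hp i).symm, hp, Function.update_self]
      · rw [Function.update_of_ne hp, if_neg fun e => hp (funext fun i => (e i).symm)]
    · simp only [State.setArr, Function.update_of_ne hb]
      exact hτ.array b

/-- Equality is definable for states that can differ in finitely many variables only. -/
theorem eq (hτ : DefState I h τ) (hτ' : DefState I h τ') (V : List (Var L))
    (hV : ∀ a, (τ a).AgreeOn {v | v ∉ V} (τ' a)) : Def I h fun a => τ a = τ' a := by
  have key : Def I h fun a : α => ∀ v ∈ V, match v with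
      | .simple x => (τ a).simple x = (τ' a).simple x
      | .array b => ∀ c, (τ a).array b ((VCtx.st a).decTuple h b.arg c) =
          (τ' a).array b ((VCtx.st a).decTuple h b.arg c) := by
    refine Def.forall_mem V fun v _ => ?_
    cases v with
    | simple x => exact (hτ.simple x).eq (hτ'.simple x)
    | array b => exact .all ((hτ.array b).eq (hτ'.array b))
  refine key.congr fun a ha => ⟨fun hv => State.ext' (fun x => ?_) fun b u => ?_, ?_⟩
  · by_cases hx : Var.simple x ∈ V
    · exact hv _ hx
    · exact (hV a).1 x hx
  · by_cases hb : Var.array b ∈ V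
    · obtain ⟨c, hc⟩ := ha.exists_decTuple u
      rw [show u = (VCtx.st a).decTuple h b.arg c from funext hc]
      exact hv _ hb c
    · rw [(hV a).2 b hb]
  · intro e v _
    rw [e]
    cases v
    · rfl
    · exact fun _ => rfl

end DefState

theorem State.AgreeOn.symm {V : Set (Var L)} {σ τ : State M} (hστ : σ.AgreeOn V τ) :
    τ.AgreeOn V σ :=
  ⟨fun x hx => (hστ.1 x hx).symm, fun a ha => (hστ.2 a ha).symm⟩

theorem State.AgreeOn.trans {V : Set (Var L)} {σ τ υ : State M} (hστ : σ.AgreeOn V τ)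
    (hτυ : τ.AgreeOn V υ) : σ.AgreeOn V υ :=
  ⟨fun x hx => (hστ.1 x hx).trans (hτυ.1 x hx), fun a ha => (hστ.2 a ha).trans (hτυ.2 a ha)⟩

theorem State.patch_agreeOn (σ : State M) (V : List (Var L)) (w : ℕ) :
    (σ.patch h V w).AgreeOn {v | v ∉ V} σ :=
  ⟨fun _ hx => σ.patch_simple_of_notMem w hx, fun _ ha => σ.patch_array_of_notMem w ha⟩

theorem State.set_agreeOn (σ : State M) {x : SVar L} (d : M.Val x.ty) {V : Set (Var L)}
    (hx : Var.simple x ∉ V) : (σ.set x d).AgreeOn V σ :=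
  ⟨fun _ hy => σ.set_simple_of_ne d fun e => hx (e ▸ hy), fun _ _ => rfl⟩

theorem State.setMany_agreeOn (σ : State M) {n : ℕ} {x : Fin n → SVar L}
    (d : ∀ i, M.Val (x i).ty) {V : Set (Var L)} (hx : ∀ i, Var.simple (x i) ∉ V) :
    (σ.setMany x d).AgreeOn V σ :=
  ⟨fun _ hy => σ.setMany_simple_of_notMem x d fun i e => hx i (e ▸ hy), fun _ _ => rfl⟩

theorem State.setArr_agreeOn (σ : State M) (a : AVar L) (v : ∀ i, M.Val (a.arg i))
    (d : M.Val a.val) {V : Set (Var L)} (ha : Var.array a ∉ V) : (σ.setArr a v d).AgreeOn V σ := by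
  classical
  refine ⟨fun _ _ => rfl, fun b hb => ?_⟩
  have hba : b ≠ a := by
    rintro rfl
    exact ha hb
  simp only [State.setArr, Function.update_of_ne hba]

theorem reflTransGen_iff_exists_seq {X : Type} {r : X → X → Prop} {a b : X} :
    Relation.ReflTransGen r a b ↔
      ∃ (n : ℕ) (f : ℕ → X), f 0 = a ∧ f n = b ∧ ∀ i, i < n → r (f i) (f (i + 1)) := by
  constructor
  · intro hab
    induction hab with
    | refl => exact ⟨0, fun _ => a, rfl, rfl, fun i hi => absurd hi (Nat.not_lt_zero i)⟩
    | @tail b c _ hbc ih =>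
      obtain ⟨n, f, h0, hn, hf⟩ := ih
      refine ⟨n + 1, fun i => if i ≤ n then f i else c, by simp [h0], by simp, fun i hi => ?_⟩
      have hi' : i ≤ n := Nat.lt_succ_iff.1 hi
      rcases hi'.eq_or_lt with rfl | hlt
      · simpa [hn] using hbc
      · simpa [hi', Nat.succ_le_of_lt hlt] using hf i hlt
  · rintro ⟨n, f, rfl, rfl, hf⟩
    induction n with
    | zero => exact .refl
    | succ n ih => exact (ih fun i hi => hf i (hi.trans n.lt_succ_self)).tail (hf n n.lt_succ_self)

/-- The reflexive transitive closure of a definable relation between numbers is definable, by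
means of the codes of finite sequences. -/
theorem Def.reflTransGen {R : State M → ℕ → ℕ → Prop}
    (hR : Def I h fun p : (State M × ℕ) × ℕ => R p.1.1 p.1.2 p.2)
    {f g : α → ℕ} (hf : NFn I h f) (hg : NFn I h g) :
    Def I h fun a => Relation.ReflTransGen (R (VCtx.st a)) (f a) (g a) := by
  have key : Def I h fun a : α => ∃ n C, elemAt C 1 = f a ∧ elemAt C (n + 1) = g a ∧
      ∀ i, i < n → R (VCtx.st a) (elemAt C (i + 1)) (elemAt C (i + 1 + 1)) := by
    refine .ex (.ex (.and ?_ (.and ?_ (.all (.imp ?_ ?_)))))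
    · exact (NFn.snd.elemAt (.const 1)).eq hf.fst.fst
    · exact (NFn.snd.elemAt (NFn.snd.fst.add (.const 1))).eq hg.fst.fst
    · exact NFn.snd.lt NFn.snd.fst.fst
    · exact hR.rel₂ (α := ((α × ℕ) × ℕ) × ℕ) (NFn.snd.fst.elemAt (NFn.snd.add (.const 1)))
        (NFn.snd.fst.elemAt ((NFn.snd.add (.const 1)).add (.const 1)))
  refine key.congr fun a _ => ?_
  rw [reflTransGen_iff_exists_seq]
  constructor
  · rintro ⟨n, C, h0, hn, hC⟩
    exact ⟨n, fun i => elemAt C (i + 1), h0, hn, hC⟩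
  · rintro ⟨n, F, h0, hn, hF⟩
    obtain ⟨C, hC⟩ := exists_elemAt_eq F (n + 1)
    refine ⟨n, C, (hC 0 n.succ_pos).trans h0, (hC n n.lt_succ_self).trans hn, fun i hi => ?_⟩
    rw [hC i (hi.trans n.lt_succ_self), hC (i + 1) (Nat.succ_lt_succ hi)]
    exact hF i hi

variable {H : Header L} (D : Decls H) (N : List (Stmt H)) (V : List (Var L))

theorem NFn.frame (tag : ℕ) (S : Stmt H) {r y : α → ℕ} (hr : NFn I h r) (hy : NFn I h y) :
    NFn I h fun a => frame N tag S (r a) (y a) := by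
  classical
  refine comp₂ (F := fun r y => RecProg.frame N tag S r y)
    (.op (.seq 4) ![.op (.natConst tag) fun i => i.elim0,
    .op (.natConst (N.idxOf S)) fun i => i.elim0, .bvar (.succ .zero), .bvar .zero])
    (fun σ ρ => ?_) hr hy
  simp only [Expr.eval, Op.eval, RecProg.frame, encodeSeq]
  rfl

theorem NFn.pushStmt (S : Stmt H) {r : α → ℕ} (hr : NFn I h r) :
    NFn I h fun a => pushStmt N S (r a) :=
  .frame N 0 S hr (.const 0)

variable {N V} in
/-- The steps of the machine only modify the variables of the program. -/
theorem exists_patch_of_mstep {σ : State M} (hσ : σ.Enumerates h)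
    (hNV : ∀ S ∈ N, S.vars ⊆ {v | v ∈ V}) (hPV : ∀ P, varSet (H.formal P) ⊆ {v | v ∈ V})
    {k w : ℕ} {c' : ℕ × State M} (hs : MStep I D N (σ.dec h) (k, σ.patch h V w) c') :
    ∃ w', c'.2 = σ.patch h V w' := by
  have hmany : ∀ {n : ℕ} {x : Fin n → SVar L} (_ : Function.Injective x)
      (_ : varSet x ⊆ {v | v ∈ V}) (d : ∀ i, M.Val (x i).ty),
      ∃ w', (σ.patch h V w).setMany x d = σ.patch h V w' := fun hx hxV d =>
    State.exists_patch_setMany hσ hx (fun i => hxV ⟨i, rfl⟩) w d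
  obtain ⟨S, hS, r, ⟨-, hs⟩ | ⟨y, -, hs⟩⟩ := hs
  · have hSV := hNV S hS
    cases S with
    | skip => exact ⟨w, hs.2⟩
    | assign x t => exact hs.2 ▸ State.exists_patch_set hσ (hSV (.inl rfl)) w _
    | assignArr a s t => exact hs.2 ▸ State.exists_patch_setArr hσ (hSV (.inl (.inl rfl))) w _ _
    | par x hx t => exact hs.2 ▸ hmany hx (Set.subset_union_left.trans hSV) _
    | seq S₁ S₂ => exact ⟨w, hs.2⟩
    | cond B S₁ S₂ => exact ⟨w, hs.2⟩
    | guard B S => exact ⟨w, hs.2⟩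
    | loop B S => exact ⟨w, hs.2⟩
    | block x hx t B =>
      exact hs.2 ▸ hmany hx ((Set.subset_union_left.trans Set.subset_union_left).trans hSV) _
    | call P t => exact hs.2 ▸ hmany (H.formal_inj P) (hPV P) _
  · have hSV := hNV S hS
    cases S with
    | block x hx t B =>
      exact hs.2 ▸ hmany hx ((Set.subset_union_left.trans Set.subset_union_left).trans hSV) _
    | call P t => exact hs.2 ▸ hmany (H.formal_inj P) (hPV P) _
    | _ => exact hs.elim

variable {k r w k' w' y : α → ℕ}

/-- A patched state being equal to a state that results from another patched state by changes
of variables in `V` is definable. -/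
theorem Def.patch_eq (hw' : NFn I h w') {τ : α → State M} (hτ : DefState I h τ)
    (hV : ∀ a, (τ a).AgreeOn {v | v ∉ V} (VCtx.st a)) :
    Def I h fun a => (VCtx.st a).patch h V (w' a) = τ a :=
  (DefState.patch V hw').eq hτ V fun a =>
    ((VCtx.st a).patch_agreeOn V (w' a)).trans (hV a).symm

theorem Def.patch_eq_setMany (hw : NFn I h w) (hw' : NFn I h w') {n : ℕ} {x : Fin n → SVar L}
    (hx : Function.Injective x) (hxV : varSet x ⊆ {v | v ∈ V}) {d : ∀ i, α → M.Val (x i).ty}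
    (hd : ∀ i, VFn I h (x i).ty (d i)) :
    Def I h fun a => (VCtx.st a).patch h V (w' a) =
      ((VCtx.st a).patch h V (w a)).setMany x fun i => d i a :=
  .patch_eq V hw' ((DefState.patch V hw).setMany hx hd) fun a =>
    (State.setMany_agreeOn _ _ fun i hi => absurd (hxV ⟨i, rfl⟩) hi).trans
      ((VCtx.st a).patch_agreeOn V (w a))

theorem Def.patch_eq_patch (hw : NFn I h w) (hw' : NFn I h w') :
    Def I h fun a : α => (VCtx.st a : State M).patch h V (w' a) = (VCtx.st a).patch h V (w a) :=
  .patch_eq V hw' (DefState.patch V hw) fun a => (VCtx.st a).patch_agreeOn V (w a)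

variable {V} in
theorem Def.enterStep (S : Stmt H) {n : ℕ} {x : Fin n → SVar L} (hx : Function.Injective x)
    (hxV : varSet x ⊆ {v | v ∈ V}) (t : ∀ i, PExpr L (x i).ty) (B : Stmt H)
    (hr : NFn I h r) (hw : NFn I h w) (hk' : NFn I h k') (hw' : NFn I h w') :
    Def I h fun a => EnterStep I N ((VCtx.st a).dec h) S x t B (r a)
      ((VCtx.st a).patch h V (w a)) (k' a) ((VCtx.st a).patch h V (w' a)) := by
  refine .and (.ex (.and ?_ ?_)) ?_
  · exact .forall_fin fun i => ((DefState.patch V hw.fst).simple (x i)).eq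
      (VFn.decTuple (A := fun i => (x i).ty) NFn.snd i)
  · exact hk'.fst.eq (.pushStmt N B (.frame N 1 S hr.fst NFn.snd))
  · exact .patch_eq_setMany V hw hw' hx hxV fun i => (DefState.patch V hw).peval (t i)

variable {V} in
theorem Def.stmtStep {S : Stmt H} (hSV : S.vars ⊆ {v | v ∈ V})
    (hPV : ∀ P, varSet (H.formal P) ⊆ {v | v ∈ V})
    (hr : NFn I h r) (hw : NFn I h w) (hk' : NFn I h k') (hw' : NFn I h w') :
    Def I h fun a => StmtStep I D N ((VCtx.st a).dec h) S (r a)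
      ((VCtx.st a).patch h V (w a)) (k' a) ((VCtx.st a).patch h V (w' a)) := by
  have hτ := DefState.patch (I := I) (h := h) V hw
  have hB : ∀ (B : PExpr L .bool) (b : Bool),
      Def I h fun a : α => ((VCtx.st a).patch h V (w a)).eval I B = b := fun B b =>
    (hτ.peval B).bool_eq b
  cases S with
  | skip => exact .and (hk'.eq hr) (.patch_eq_patch V hw hw')
  | assign x t =>
    exact .and (hk'.eq hr) (.patch_eq V hw' (hτ.set x (hτ.peval t)) fun a =>
      (State.set_agreeOn _ _ fun hx => absurd (hSV (.inl rfl)) hx).trans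
        ((VCtx.st a).patch_agreeOn V (w a)))
  | assignArr b s t =>
    exact .and (hk'.eq hr) (.patch_eq V hw' (hτ.setArr b (fun i => hτ.peval (s i)) (hτ.peval t))
      fun a => (State.setArr_agreeOn _ _ _ _ fun hx => absurd (hSV (.inl (.inl rfl))) hx).trans
        ((VCtx.st a).patch_agreeOn V (w a)))
  | par x hx t =>
    exact .and (hk'.eq hr) (.patch_eq_setMany V hw hw' hx (Set.subset_union_left.trans hSV)
      fun i => hτ.peval (t i))
  | seq S₁ S₂ =>
    exact .and (hk'.eq (.pushStmt N S₁ (.pushStmt N S₂ hr))) (.patch_eq_patch V hw hw')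
  | cond B S₁ S₂ =>
    exact .and (.or (.and (hB B true) (hk'.eq (.pushStmt N S₁ hr)))
      (.and (hB B false) (hk'.eq (.pushStmt N S₂ hr)))) (.patch_eq_patch V hw hw')
  | guard B S =>
    exact .and (.and (hB B true) (hk'.eq (.pushStmt N S hr))) (.patch_eq_patch V hw hw')
  | loop B S =>
    exact .and (.or (.and (hB B true) (hk'.eq (.pushStmt N S (.pushStmt N (.loop B S) hr))))
      (.and (hB B false) (hk'.eq hr))) (.patch_eq_patch V hw hw')
  | block x hx t B =>
    exact .enterStep N _ hx ((Set.subset_union_left.trans Set.subset_union_left).trans hSV) t B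
      hr hw hk' hw'
  | call P t => exact .enterStep N _ (H.formal_inj P) (hPV P) t _ hr hw hk' hw'

variable {V} in
theorem Def.restoreStep {S : Stmt H} (hSV : S.vars ⊆ {v | v ∈ V})
    (hPV : ∀ P, varSet (H.formal P) ⊆ {v | v ∈ V})
    (hr : NFn I h r) (hy : NFn I h y) (hw : NFn I h w) (hk' : NFn I h k') (hw' : NFn I h w') :
    Def I h fun a : α => RestoreStep ((VCtx.st a : State M).dec h) S (r a) (y a)
      ((VCtx.st a).patch h V (w a)) (k' a) ((VCtx.st a).patch h V (w' a)) := by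
  cases S with
  | block x hx t B =>
    exact .and (hk'.eq hr) (.patch_eq_setMany V hw hw' hx
      ((Set.subset_union_left.trans Set.subset_union_left).trans hSV)
      fun i => VFn.decTuple (A := fun i => (x i).ty) hy i)
  | call P t =>
    exact .and (hk'.eq hr) (.patch_eq_setMany V hw hw' (H.formal_inj P) (hPV P)
      fun i => VFn.decTuple (A := fun i => (H.formal P i).ty) hy i)
  | _ => exact .const False

variable {V N}

theorem Def.mstep (hNV : ∀ S ∈ N, S.vars ⊆ {v | v ∈ V})
    (hPV : ∀ P, varSet (H.formal P) ⊆ {v | v ∈ V})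
    (hk : NFn I h k) (hw : NFn I h w) (hk' : NFn I h k') (hw' : NFn I h w') :
    Def I h fun a => MStep I D N ((VCtx.st a).dec h) (k a, (VCtx.st a).patch h V (w a))
      (k' a, (VCtx.st a).patch h V (w' a)) := by
  refine .exists_mem N fun S hS => .ex (.or (.and ?_ ?_) (.ex (.and ?_ ?_)))
  · exact hk.fst.eq (.pushStmt N S NFn.snd)
  · exact .stmtStep D N (hNV S hS) hPV NFn.snd hw.fst hk'.fst hw'.fst
  · exact hk.fst.fst.eq (.frame N 1 S NFn.snd.fst NFn.snd)
  · exact .restoreStep (hNV S hS) hPV NFn.snd.fst NFn.snd hw.fst.fst hk'.fst.fst hw'.fst.fst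

theorem Def.good (q : Assertion L) (hk : NFn I h k) (hw : NFn I h w) :
    Def I h fun a => Good I N q (k a, (VCtx.st a).patch h V (w a)) := by
  refine .and (.imp (hk.eq (.const _)) ((DefState.patch V hw).psat q))
    (.forall_mem N fun S _ => .all (.imp (hk.fst.eq (.pushStmt N S NFn.snd)) ?_))
  cases S with
  | guard B S => exact ((DefState.patch V hw.fst).peval B).bool_eq true
  | _ => exact .const True

/-- The configuration of the machine with the code `c`, where states are represented as finite
modifications of `σ`. -/
noncomputable def codedConf (h : L.Ty → ℕ) (V : List (Var L)) (σ : State M) (c : ℕ) :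
    ℕ × State M :=
  (elemAt c 1, σ.patch h V (elemAt c 2))

theorem codedConf_pair (σ : State M) (k w : ℕ) :
    codedConf h V σ (encodeSeq [k, w]) = (k, σ.patch h V w) := by
  rw [codedConf, show elemAt (encodeSeq [k, w]) 1 = k from elemAt_encodeSeq_succ _ 0,
    show elemAt (encodeSeq [k, w]) 2 = w from elemAt_encodeSeq_succ _ 1]

theorem wp_iff_coded {D : Decls H} (hNV : ∀ S ∈ N, S.vars ⊆ {v | v ∈ V})
    (hPV : ∀ P, varSet (H.formal P) ⊆ {v | v ∈ V}) (q : Assertion L) {σ : State M}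
    (hσ : σ.Enumerates h) (k : ℕ) : WP I D N (σ.dec h) q k σ ↔
      ∀ c c', elemAt c 1 = k → elemAt c 2 = encodeSeq [] →
        Relation.ReflTransGen (fun c c' => MStep I D N (σ.dec h) (codedConf h V σ c)
          (codedConf h V σ c')) c c' → Good I N q (codedConf h V σ c') := by
  constructor
  · intro hw c c' h1 h2 hc
    have := Relation.ReflTransGen.lift (p := MStep I D N (σ.dec h)) (codedConf h V σ)
      (fun _ _ => id) _ _ hc
    rw [Function.onFun,
      show codedConf h V σ c = (k, σ) by rw [codedConf, h1, h2, State.patch_nil]] at this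
    exact hw _ this
  · intro hw
    -- every configuration that the machine reaches has a code that is reached
    have key : ∀ d, Relation.ReflTransGen (MStep I D N (σ.dec h)) (k, σ) d → ∃ c',
        Relation.ReflTransGen (fun c c' => MStep I D N (σ.dec h) (codedConf h V σ c)
          (codedConf h V σ c')) (encodeSeq [k, encodeSeq []]) c' ∧ codedConf h V σ c' = d := by
      intro d hd
      induction hd with
      | refl => exact ⟨_, .refl, by rw [codedConf_pair, State.patch_nil]⟩
      | @tail d d' _ hdd' ih =>
        obtain ⟨c', hc', rfl⟩ := ih
        obtain ⟨w', hw'⟩ := exists_patch_of_mstep D hσ hNV hPV hdd'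
        have hd' : codedConf h V σ (encodeSeq [d'.1, w']) = d' := by rw [codedConf_pair, ← hw']
        exact ⟨_, hc'.tail (hd'.symm ▸ hdd'), hd'⟩
    intro d hd
    obtain ⟨c', hc', rfl⟩ := key d hd
    exact hw _ c' (elemAt_encodeSeq_succ _ 0) (elemAt_encodeSeq_succ _ 1) hc'

/-- There is an assertion that expresses, for all stacks of the machine, the weakest precondition
of `q`; the code of the stack is the value of its only variable bound outside. -/
theorem exists_assn_wp (I : M.Interp) (h : L.Ty → ℕ) (D : Decls H)
    (hNV : ∀ S ∈ N, S.vars ⊆ {v | v ∈ V}) (hPV : ∀ P, varSet (H.formal P) ⊆ {v | v ∈ V})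
    (q : Assertion L) : ∃ Ψ : Assn L [.nat], ∀ (σ : State M) (k : ℕ), σ.Enumerates h →
      (Ψ.sat I σ (Env.cons (T := .nat) k Env.nil) ↔ WP I D N (σ.dec h) q k σ) := by
  have key : Def I h fun p : State M × ℕ => WP I D N (p.1.dec h) q p.2 p.1 := by
    refine Def.congr (X := fun p : State M × ℕ => _)
      (Def.all (Def.all (Def.imp ?_ (Def.imp ?_ (Def.imp ?_ ?_)))))
      fun p hp => (wp_iff_coded hNV hPV q hp p.2).symm
    · exact (NFn.snd.fst.elemAt (.const 1)).eq NFn.snd.fst.fst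
    · exact (NFn.snd.fst.elemAt (.const 2)).eq (.const _)
    · refine Def.reflTransGen (α := ((State M × ℕ) × ℕ) × ℕ) (R := fun σ c c' =>
        MStep I D N (σ.dec h) (codedConf h V σ c) (codedConf h V σ c')) ?_ NFn.snd.fst NFn.snd
      exact Def.mstep (α := (State M × ℕ) × ℕ) D hNV hPV (NFn.snd.fst.elemAt (.const 1))
        (NFn.snd.fst.elemAt (.const 2)) (NFn.snd.elemAt (.const 1)) (NFn.snd.elemAt (.const 2))
    · exact Def.good (α := ((State M × ℕ) × ℕ) × ℕ) q (NFn.snd.elemAt (.const 1))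
        (NFn.snd.elemAt (.const 2))
  obtain ⟨Ψ, hΨ⟩ := key
  exact ⟨Ψ, fun σ k hσ => hΨ (σ, k) hσ⟩

end DefWP

/-! ### The stack machine and the operational semantics -/

section Semantics
variable {L : Lang} {M : Model L} {H : Header L} {I : M.Interp} {D : Decls H}

theorem Trans.andThen {c c' : Conf M H} (hc : Trans I D c c') (R : RStmt M H) :
    Trans I D (c.andThen R) (c'.andThen R) := by
  obtain ⟨hs⟩ := hc
  rename_i R₁ σ
  cases R₁ with
  | empty => cases hs
  | _ => exact ⟨.seq R hs⟩

theorem reflTransGen_andThen {c c' : Conf M H} (hc : Relation.ReflTransGen (Trans I D) c c')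
    (R : RStmt M H) : Relation.ReflTransGen (Trans I D) (c.andThen R) (c'.andThen R) := by
  induction hc with
  | refl => exact .refl
  | tail _ hbc ih => exact ih.tail (hbc.andThen R)

theorem mem_semSP_of_step {S : Stmt H} {σ : State M} {c : Conf M H} {o : Option (State M)}
    (hs : Step I D (.prog S) σ c) (hc : Relation.ReflTransGen (Trans I D) c (Conf.final o)) :
    o ∈ semSP I D S σ :=
  .head ⟨hs⟩ hc

theorem exists_step_of_mem_semSP {S : Stmt H} {σ : State M} {o : Option (State M)}
    (ho : o ∈ semSP I D S σ) :
    ∃ c, Step I D (.prog S) σ c ∧ Relation.ReflTransGen (Trans I D) c (Conf.final o) := by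
  rcases Relation.ReflTransGen.cases_head ho with e | ⟨c, ⟨hs⟩, hc⟩
  · cases o <;> cases e
  · exact ⟨c, hs, hc⟩

theorem mem_semSP_seq {S₁ S₂ : Stmt H} {σ τ : State M} {o : Option (State M)}
    (h₁ : some τ ∈ semSP I D S₁ σ) (h₂ : o ∈ semSP I D S₂ τ) : o ∈ semSP I D (.seq S₁ S₂) σ := by
  obtain ⟨c, hs, hc⟩ := exists_step_of_mem_semSP h₁
  exact mem_semSP_of_step (.seqProg S₂ hs) ((reflTransGen_andThen hc (.prog S₂)).trans h₂)

theorem none_mem_semSP_seq {S₁ : Stmt H} (S₂ : Stmt H) {σ : State M}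
    (h₁ : none ∈ semSP I D S₁ σ) : none ∈ semSP I D (.seq S₁ S₂) σ := by
  obtain ⟨c, hs, hc⟩ := exists_step_of_mem_semSP h₁
  exact mem_semSP_of_step (.seqProg S₂ hs) (reflTransGen_andThen hc (.prog S₂))

section Block
variable {n : ℕ} {x : Fin n → SVar L} {hx : Function.Injective x} {t : ∀ i, PExpr L (x i).ty}
  {B : Stmt H} {σ : State M}

theorem mem_semSP_par_seq {o : Option (State M)}
    (ho : o ∈ semSP I D B (σ.setMany x fun i => σ.eval I (t i))) :
    o ∈ semSP I D (.seq (.par x hx t) B) σ :=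
  mem_semSP_seq (mem_semSP_of_step (.par x hx t σ) .refl) ho

theorem some_mem_semSP_block {τ : State M}
    (hτ : some τ ∈ semSP I D B (σ.setMany x fun i => σ.eval I (t i))) :
    some (τ.setMany x fun i => σ.simple (x i)) ∈ semSP I D (.block x hx t B) σ :=
  mem_semSP_of_step (.block x hx t B σ) ((reflTransGen_andThen (mem_semSP_par_seq (hx := hx) hτ)
    (.restore x fun i => σ.simple (x i))).tail ⟨.restore x _ τ⟩)

theorem none_mem_semSP_block
    (ho : none ∈ semSP I D B (σ.setMany x fun i => σ.eval I (t i))) :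
    none ∈ semSP I D (.block x hx t B) σ :=
  mem_semSP_of_step (.block x hx t B σ) (reflTransGen_andThen (mem_semSP_par_seq (hx := hx) ho)
    (.restore x fun i => σ.simple (x i)))

end Block

theorem mem_semSP_call {P : Fin H.num} {t : ∀ i, PExpr L (H.formal P i).ty} {σ : State M}
    {o : Option (State M)} (ho : o ∈ semSP I D (D.callBlock P t) σ) :
    o ∈ semSP I D (.call P t) σ :=
  mem_semSP_of_step (.call P t σ) ho

/-- The list of the substatements of a statement, including itself. -/
def Stmt.subs : Stmt H → List (Stmt H)
  | .seq S₁ S₂ => .seq S₁ S₂ :: (S₁.subs ++ S₂.subs)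
  | .cond B S₁ S₂ => .cond B S₁ S₂ :: (S₁.subs ++ S₂.subs)
  | .guard B S => .guard B S :: S.subs
  | .loop B S => .loop B S :: S.subs
  | .block x hx t S => .block x hx t S :: S.subs
  | S => [S]

theorem Stmt.mem_subs (S : Stmt H) : S ∈ S.subs := by
  cases S <;> simp [Stmt.subs]

theorem Stmt.subs_subset {S T : Stmt H} (hT : T ∈ S.subs) : T.subs ⊆ S.subs := by
  induction S with
  | seq S₁ S₂ ih₁ ih₂ | cond B S₁ S₂ ih₁ ih₂ =>
    rcases List.mem_cons.1 hT with rfl | hT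
    · exact List.Subset.refl _
    · rcases List.mem_append.1 hT with hT | hT
      · exact List.subset_cons_of_subset _ (List.subset_append_of_subset_left _ (ih₁ hT))
      · exact List.subset_cons_of_subset _ (List.subset_append_of_subset_right _ (ih₂ hT))
  | guard B S ih | loop B S ih | block x hx t S ih =>
    rcases List.mem_cons.1 hT with rfl | hT
    · exact List.Subset.refl _
    · exact List.subset_cons_of_subset _ (ih hT)
  | _ =>
    obtain rfl := List.mem_singleton.1 hT
    exact List.Subset.refl _

/-- A list of statements that contains with each statement all of its substatements, and the
procedure bodies. -/
structure Closed (D : Decls H) (N : List (Stmt H)) : Prop where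
  subs : ∀ S ∈ N, S.subs ⊆ N
  body : ∀ P, D.body P ∈ N

variable {N : List (Stmt H)} {e : ∀ T : L.Ty, ℕ → M.Val T}

variable (I D N e) in
/-- The outcomes of executing all frames of a stack by the operational semantics. -/
inductive Outcome : ℕ → State M → Option (State M) → Prop
  | empty (σ : State M) : Outcome emptyStack σ (some σ)
  | stmt {S : Stmt H} {r : ℕ} {σ τ : State M} {o : Option (State M)} : S ∈ N →
      some τ ∈ semSP I D S σ → Outcome r τ o → Outcome (pushStmt N S r) σ o
  | fail {S : Stmt H} (r : ℕ) {σ : State M} : S ∈ N →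
      none ∈ semSP I D S σ → Outcome (pushStmt N S r) σ none
  | restore {S : Stmt H} {r y : ℕ} {σ τ : State M} {o : Option (State M)} : S ∈ N →
      RestoreStep e S r y σ r τ → Outcome r τ o → Outcome (pushRestore N S r y) σ o

namespace Outcome

theorem of_emptyStack {σ : State M} {o : Option (State M)}
    (ho : Outcome I D N e emptyStack σ o) : o = some σ := by
  generalize hk : emptyStack = k at ho
  cases ho with
  | empty => rfl
  | stmt => exact (pushStmt_ne_emptyStack hk.symm).elim
  | fail => exact (pushStmt_ne_emptyStack hk.symm).elim
  | restore => exact (pushRestore_ne_emptyStack hk.symm).elim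

theorem of_pushStmt {S : Stmt H} {r : ℕ} {σ : State M} {o : Option (State M)} (hS : S ∈ N)
    (ho : Outcome I D N e (pushStmt N S r) σ o) :
    (none ∈ semSP I D S σ ∧ o = none) ∨ ∃ τ, some τ ∈ semSP I D S σ ∧ Outcome I D N e r τ o := by
  generalize hk : pushStmt N S r = k at ho
  cases ho with
  | empty => exact (pushStmt_ne_emptyStack hk).elim
  | stmt _ hτ ho =>
    obtain ⟨rfl, rfl⟩ := pushStmt_inj hS hk
    exact .inr ⟨_, hτ, ho⟩
  | fail _ _ hn =>
    obtain ⟨rfl, rfl⟩ := pushStmt_inj hS hk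
    exact .inl ⟨hn, rfl⟩
  | restore => exact (pushStmt_ne_pushRestore hS hk).elim

theorem of_pushRestore {S : Stmt H} {r y : ℕ} {σ : State M} {o : Option (State M)} (hS : S ∈ N)
    (ho : Outcome I D N e (pushRestore N S r y) σ o) :
    ∃ τ, RestoreStep e S r y σ r τ ∧ Outcome I D N e r τ o := by
  generalize hk : pushRestore N S r y = k at ho
  cases ho with
  | empty => exact (pushRestore_ne_emptyStack hk).elim
  | stmt hT => exact (pushStmt_ne_pushRestore hT hk.symm).elim
  | fail _ hT => exact (pushStmt_ne_pushRestore hT hk.symm).elim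
  | restore _ hτ ho =>
    obtain ⟨rfl, rfl, rfl⟩ := pushRestore_inj hS hk
    exact ⟨_, hτ, ho⟩

/-- A step without an effect on the state, from a statement to a stack of one statement. -/
theorem of_sub {S T : Stmt H} {r : ℕ} {σ : State M} {o : Option (State M)} (hS : S ∈ N)
    (hT : T ∈ N) (hs : Step I D (.prog S) σ (.run (.prog T) σ))
    (ho : Outcome I D N e (pushStmt N T r) σ o) : Outcome I D N e (pushStmt N S r) σ o := by
  rcases of_pushStmt hT ho with ⟨hn, rfl⟩ | ⟨τ, hτ, ho⟩
  · exact .fail r hS (mem_semSP_of_step hs hn)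
  · exact .stmt hS (mem_semSP_of_step hs hτ) ho

theorem of_seq {S₁ S₂ : Stmt H} {r : ℕ} {σ : State M} {o : Option (State M)}
    (hS₁ : S₁ ∈ N) (hS₂ : S₂ ∈ N) (ho : Outcome I D N e (pushStmt N S₁ (pushStmt N S₂ r)) σ o) :
    (none ∈ semSP I D (.seq S₁ S₂) σ ∧ o = none) ∨
      ∃ τ, some τ ∈ semSP I D (.seq S₁ S₂) σ ∧ Outcome I D N e r τ o := by
  rcases of_pushStmt hS₁ ho with ⟨hn, rfl⟩ | ⟨τ, hτ, ho⟩
  · exact .inl ⟨none_mem_semSP_seq S₂ hn, rfl⟩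
  · rcases of_pushStmt hS₂ ho with ⟨hn, rfl⟩ | ⟨υ, hυ, ho⟩
    · exact .inl ⟨mem_semSP_seq hτ hn, rfl⟩
    · exact .inr ⟨υ, mem_semSP_seq hτ hυ, ho⟩

theorem of_enterStep {S : Stmt H} {n : ℕ} {x : Fin n → SVar L} {hx : Function.Injective x}
    {t : ∀ i, PExpr L (x i).ty} {B : Stmt H} {r k' : ℕ} {σ σ' : State M} {o : Option (State M)}
    (hS : S ∈ N) (hB : B ∈ N) (hsem : semSP I D (.block x hx t B) σ ⊆ semSP I D S σ)
    (hrest : ∀ y τ τ', RestoreStep e S r y τ r τ' →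
      τ' = τ.setMany x (tupleOf e (fun i => (x i).ty) y))
    (hs : EnterStep I N e S x t B r σ k' σ') (ho : Outcome I D N e k' σ' o) :
    Outcome I D N e (pushStmt N S r) σ o := by
  obtain ⟨⟨y, hy, rfl⟩, rfl⟩ := hs
  rcases of_pushStmt hB ho with ⟨hn, rfl⟩ | ⟨τ, hτ, ho⟩
  · exact .fail r hS (hsem (none_mem_semSP_block hn))
  · obtain ⟨τ', hτ', ho⟩ := of_pushRestore hS ho
    obtain rfl := hrest y τ τ' hτ'
    refine .stmt hS (hsem ?_) ho
    rw [show tupleOf e (fun i => (x i).ty) y = fun i => σ.simple (x i) from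
      funext fun i => (hy i).symm]
    exact some_mem_semSP_block hτ

theorem of_stmtStep (hN : Closed D N) {S : Stmt H} {r k' : ℕ} {σ σ' : State M}
    {o : Option (State M)} (hS : S ∈ N) (hs : StmtStep I D N e S r σ k' σ')
    (ho : Outcome I D N e k' σ' o) : Outcome I D N e (pushStmt N S r) σ o := by
  have hsub := hN.subs S hS
  cases S with
  | skip =>
    obtain ⟨rfl, rfl⟩ := hs
    exact .stmt hS (mem_semSP_of_step (.skip _) .refl) ho
  | assign x t =>
    obtain ⟨rfl, rfl⟩ := hs
    exact .stmt hS (mem_semSP_of_step (.assign x t _) .refl) ho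
  | assignArr a s t =>
    obtain ⟨rfl, rfl⟩ := hs
    exact .stmt hS (mem_semSP_of_step (.assignArr a s t _) .refl) ho
  | par x hx t =>
    obtain ⟨rfl, rfl⟩ := hs
    exact .stmt hS (mem_semSP_of_step (.par x hx t _) .refl) ho
  | seq S₁ S₂ =>
    have hS₁ : S₁ ∈ N := hsub (by simp [Stmt.subs, S₁.mem_subs])
    have hS₂ : S₂ ∈ N := hsub (by simp [Stmt.subs, S₂.mem_subs])
    obtain ⟨rfl, rfl⟩ := hs
    rcases of_seq hS₁ hS₂ ho with ⟨hn, rfl⟩ | ⟨τ, hτ, ho⟩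
    · exact .fail r hS hn
    · exact .stmt hS hτ ho
  | cond B S₁ S₂ =>
    have hS₁ : S₁ ∈ N := hsub (by simp [Stmt.subs, S₁.mem_subs])
    have hS₂ : S₂ ∈ N := hsub (by simp [Stmt.subs, S₂.mem_subs])
    obtain ⟨⟨hB, rfl⟩ | ⟨hB, rfl⟩, rfl⟩ := hs
    · exact of_sub hS hS₁ (.condTrue B S₁ S₂ _ hB) ho
    · exact of_sub hS hS₂ (.condFalse B S₁ S₂ _ hB) ho
  | guard B S' =>
    have hS' : S' ∈ N := hsub (by simp [Stmt.subs, S'.mem_subs])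
    obtain ⟨⟨hB, rfl⟩, rfl⟩ := hs
    exact of_sub hS hS' (.guardTrue B S' _ hB) ho
  | loop B S' =>
    have hS' : S' ∈ N := hsub (by simp [Stmt.subs, S'.mem_subs])
    obtain ⟨⟨hB, rfl⟩ | ⟨hB, rfl⟩, rfl⟩ := hs
    · rcases of_seq hS' hS ho with ⟨hn, rfl⟩ | ⟨τ, hτ, ho⟩
      · exact .fail r hS (mem_semSP_of_step (.loopTrue B S' _ hB) hn)
      · exact .stmt hS (mem_semSP_of_step (.loopTrue B S' _ hB) hτ) ho
    · exact .stmt hS (mem_semSP_of_step (.loopFalse B S' _ hB) .refl) ho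
  | block x hx t B =>
    exact of_enterStep (hx := hx) hS (hsub (by simp [Stmt.subs, B.mem_subs])) subset_rfl
      (fun _ _ _ hr => hr.2) hs ho
  | call P t =>
    exact of_enterStep (hx := H.formal_inj P) hS (hN.body P) (fun _ => mem_semSP_call)
      (fun _ _ _ hr => hr.2) hs ho

theorem of_mstep (hN : Closed D N) {c c' : ℕ × State M} {o : Option (State M)}
    (hs : MStep I D N e c c') (ho : Outcome I D N e c'.1 c'.2 o) : Outcome I D N e c.1 c.2 o := by
  obtain ⟨k, σ⟩ := c
  obtain ⟨S, hS, r, ⟨rfl, hs⟩ | ⟨y, rfl, hs⟩⟩ := hs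
  · exact of_stmtStep hN hS hs ho
  · have hr : c'.1 = r := by
      cases S with
      | block x hx t B => exact hs.1
      | call P t => exact hs.1
      | _ => exact hs.elim
    rw [hr] at hs ho
    exact .restore hS hs ho

end Outcome

/-- If all outcomes of a statement are proper states that satisfy `q`, then the weakest
precondition of `q` holds for the stack that consists of this statement. -/
theorem wp_of_semSP (hN : Closed D N) {q : Assertion L} {S : Stmt H} (hS : S ∈ N) {σ : State M}
    (hq : ∀ o ∈ semSP I D S σ, ∃ τ, o = some τ ∧ q.sat I τ Env.nil) :
    WP I D N e q (pushStmt N S emptyStack) σ := by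
  intro c hc
  have key : ∀ o, Outcome I D N e c.1 c.2 o → o ∈ semSP I D S σ := by
    have hout : ∀ o, Outcome I D N e c.1 c.2 o →
        Outcome I D N e (pushStmt N S emptyStack) σ o := by
      intro o ho
      induction hc with
      | refl => exact ho
      | tail _ hbc ih => exact ih (Outcome.of_mstep hN hbc ho)
    intro o ho
    rcases Outcome.of_pushStmt hS (hout o ho) with ⟨hn, rfl⟩ | ⟨τ, hτ, ho⟩
    · exact hn
    · rwa [Outcome.of_emptyStack ho]
  refine ⟨fun e₀ => ?_, fun T hT r e₀ => ?_⟩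
  · obtain ⟨τ, e₁, hτ⟩ := hq _ (key (some c.2) (e₀ ▸ Outcome.empty c.2))
    cases e₁
    exact hτ
  · cases T with
    | guard B T =>
      rw [Guarded]
      by_contra hB
      rw [Bool.not_eq_true] at hB
      obtain ⟨τ, e₁, -⟩ := hq none (key none (e₀ ▸ Outcome.fail r hT
        (mem_semSP_of_step (.guardFalse B T _ hB) .refl)))
      cases e₁
    | _ => trivial

end Semantics

/-! ### Derivations -/

section Derivation
variable {L : Lang} {M : Model L} {H : Header L} {I : M.Interp} {D : Decls H} {h : L.Ty → ℕ}

/-- A simple variable of type `nat`. -/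
abbrev natVar (L : Lang) (m : ℕ) : SVar L := ⟨.nat, m⟩

/-- A simple variable of type `nat`, as an expression. -/
abbrev natExpr (L : Lang) (m : ℕ) : PExpr L .nat := .var (natVar L m)

theorem Expr.vars_eq_subset {Γ : List L.Ty} {T : L.Ty} (s t : Expr L Γ T) :
    (Expr.eq s t).vars ⊆ s.vars ∪ t.vars := by
  refine Set.iUnion_subset fun i => ?_
  by_cases hi : i = 0
  · simp [hi]
  · simp [hi]

theorem Expr.vars_conj_subset {Γ : List L.Ty} {n : ℕ} (B : Fin n → Expr L Γ .bool) :
    (Expr.conj B).vars ⊆ ⋃ i, (B i).vars := by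
  induction n with
  | zero => exact Set.iUnion_subset fun i => i.elim0
  | succ n ih =>
    refine Set.iUnion_subset fun i => ?_
    refine Fin.cases ?_ (fun j => ?_) i
    · exact Set.subset_iUnion (fun i => (B i).vars) 0
    · obtain rfl : j = 0 := Subsingleton.elim _ _
      exact (ih fun i => B i.succ).trans
        (Set.iUnion_subset fun i => Set.subset_iUnion (fun i => (B i).vars) i.succ)

theorem State.dec_setArr (σ : State M) {a : AVar L} (ha : ∀ T, a ≠ enumVar h T)
    (v : ∀ i, M.Val (a.arg i)) (d : M.Val a.val) : (σ.setArr a v d).dec h = σ.dec h := by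
  funext T k
  exact congrFun ((σ.setArr_agreeOn a v d (V := {Var.array (enumVar h T)})
    fun e => ha T (Var.array.inj e)).2 _ rfl) _

/-- The assertion that `Ψ` holds of the value of the expression `e`. -/
def Assn.at (Ψ : Assn L [.nat]) (e : PExpr L .nat) : Assertion L :=
  .ex .nat (.conj (.atom (.eq (.bvar .zero) e.lift)) Ψ)

theorem Assn.sat_at (Ψ : Assn L [.nat]) (e : PExpr L .nat) (σ : State M) :
    (Ψ.at e).sat I σ Env.nil ↔ Ψ.sat I σ (Env.cons (T := .nat) (σ.eval I e) Env.nil) := by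
  have heq : ∀ d : M.Val .nat, (Expr.eq (.bvar .zero) e.lift).eval I σ (Env.cons d Env.nil) =
      true ↔ d = σ.eval I e := fun d => by
    rw [Expr.eval_eq_iff, Expr.eval_lift]
    rfl
  constructor
  · rintro ⟨d, hd, hΨ⟩
    rw [← (heq d).1 hd]
    exact hΨ
  · exact fun hΨ => ⟨_, (heq _).2 rfl, hΨ⟩

theorem Assn.free_at_subset (Ψ : Assn L [.nat]) (e : PExpr L .nat) :
    (Ψ.at e).free ⊆ e.vars ∪ Ψ.free := by
  refine Set.union_subset_union_left _ ((Expr.vars_eq_subset _ _).trans ?_)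
  rw [Expr.vars_lift]
  exact Set.union_subset (Set.empty_subset _) subset_rfl

open scoped Classical in
/-- The expression for a stack whose uppermost frame refers to the statement `S`. -/
noncomputable def frameExpr (N : List (Stmt H)) (tag : ℕ) (S : Stmt H) (r y : PExpr L .nat) :
    PExpr L .nat :=
  .op (.seq 4) ![.op (.natConst tag) fun i => i.elim0, .op (.natConst (N.idxOf S)) fun i => i.elim0,
    r, y]

theorem eval_frameExpr (N : List (Stmt H)) (tag : ℕ) (S : Stmt H) (r y : PExpr L .nat)
    (σ : State M) :
    σ.eval I (frameExpr N tag S r y) = frame N tag S (σ.eval I r) (σ.eval I y) := by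
  simp only [State.eval, frameExpr, Expr.eval, Op.eval, frame, encodeSeq]
  rfl

theorem vars_frameExpr_subset (N : List (Stmt H)) (tag : ℕ) (S : Stmt H) (r y : PExpr L .nat) :
    (frameExpr N tag S r y).vars ⊆ r.vars ∪ y.vars := by
  refine Set.iUnion_subset fun i => ?_
  fin_cases i
  · exact Set.iUnion_subset fun i => i.elim0
  · exact Set.iUnion_subset fun i => i.elim0
  · exact Set.subset_union_left
  · exact Set.subset_union_right

/-- The expression for the stack with the rest `r` on which first `S` is to be executed. -/
noncomputable def pushExpr (N : List (Stmt H)) (S : Stmt H) (r : PExpr L .nat) : PExpr L .nat :=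
  frameExpr N 0 S r (.op (.natConst 0) fun i => i.elim0)

theorem eval_pushExpr (N : List (Stmt H)) (S : Stmt H) (r : PExpr L .nat) (σ : State M) :
    σ.eval I (pushExpr N S r) = pushStmt N S (σ.eval I r) :=
  eval_frameExpr N 0 S r _ σ

theorem vars_pushExpr_subset (N : List (Stmt H)) (S : Stmt H) (r : PExpr L .nat) :
    (pushExpr N S r).vars ⊆ r.vars :=
  (vars_frameExpr_subset N 0 S r _).trans
    (Set.union_subset subset_rfl (Set.iUnion_subset fun i => i.elim0))

theorem Implies.intro {p q : Assertion L}
    (hpq : ∀ σ : State M, σ.Enumerates h → p.sat I σ Env.nil → q.sat I σ Env.nil) :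
    Implies I h p q :=
  fun σ hσ => ⟨hσ.1, hpq σ hσ.1 hσ.2⟩

theorem Implies.refl (p : Assertion L) : Implies I h p p := subset_rfl

theorem SPR.conseq_left {A : Set (Triple H)} {p p₁ q : Assertion L} {S : Stmt H}
    (hS : SPR I D h A ⟨p₁, S, q⟩) (hp : Implies I h p p₁) : SPR I D h A ⟨p, S, q⟩ :=
  .consequence hp hS (.refl q)

/-- The data of a completeness proof: `N` contains the statements of the program and `V` their
variables, `Ψ` expresses the weakest preconditions of `q` for the stacks of the machine, and the
variables `natVar L z` and `natVar L y` are fresh. -/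
structure WPData (I : M.Interp) (D : Decls H) (h : L.Ty → ℕ) (q : Assertion L)
    (N : List (Stmt H)) (V : Set (Var L)) (Ψ : Assn L [.nat]) (z y : ℕ) : Prop where
  closed : Closed D N
  vars : ∀ S ∈ N, S.vars ⊆ V
  decl_vars : D.vars ⊆ V
  enumVar_notMem : ∀ T, Var.array (enumVar h T) ∉ V
  locals : ∀ S ∈ N, Disjoint S.locals D.globals
  formals : Disjoint D.formals D.globals
  sat_iff : ∀ (σ : State M) (k : ℕ), σ.Enumerates h →
    (Ψ.sat I σ (Env.cons (T := .nat) k Env.nil) ↔ WP I D N (σ.dec h) q k σ)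
  z_notMem : Var.simple (natVar L z) ∉ V
  y_notMem : Var.simple (natVar L y) ∉ V
  z_notMem_free : Var.simple (natVar L z) ∉ Ψ.free
  y_notMem_free : Var.simple (natVar L y) ∉ Ψ.free
  ne : natVar L y ≠ natVar L z

namespace WPData
variable {q : Assertion L} {N : List (Stmt H)} {V : Set (Var L)} {Ψ : Assn L [.nat]} {z y : ℕ}
  {A : Set (Triple H)} (W : WPData I D h q N V Ψ z y)
include W

theorem sat_at_iff {σ : State M} (hσ : σ.Enumerates h) (e : PExpr L .nat) :
    (Ψ.at e).sat I σ Env.nil ↔ WP I D N (σ.dec h) q (σ.eval I e) σ := by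
  rw [Assn.sat_at, W.sat_iff σ _ hσ]

/-- A triple for all continuations may be used for a particular one. -/
theorem instantiate {S : Stmt H} (hS : S.vars ⊆ V) {r : PExpr L .nat} (hr : Disjoint r.vars V)
    (hd : SPR I D h A ⟨Ψ.at (pushExpr N S (natExpr L z)), S, Ψ.at (natExpr L z)⟩) :
    SPR I D h A ⟨Ψ.at (pushExpr N S r), S, Ψ.at r⟩ := by
  have hinj : Function.Injective fun _ : Fin 1 => natVar L z := Function.injective_of_subsingleton _
  have hchange : D.change ∪ S.change ⊆ V := Set.union_subset
    ((D.change_subset_globals.trans D.globals_subset_vars).trans W.decl_vars)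
    ((S.change_subset_globals.trans S.globals_subset_vars).trans hS)
  have hsub := SPR.substitution (fun _ : Fin 1 => natVar L z) hinj (fun _ => r)
    (by
      rw [Set.disjoint_left]
      rintro _ ⟨_, rfl⟩ hz
      exact W.z_notMem (Set.union_subset W.decl_vars hS hz))
    (by
      rw [Set.disjoint_left]
      intro v hv hv'
      obtain ⟨_, hv⟩ := Set.mem_iUnion.1 hv
      exact Set.disjoint_left.1 hr hv (hchange hv')) hd
  have hag : ∀ (σ : State M) (d : M.Val (natVar L z).ty), (σ.set (natVar L z) d).AgreeOn Ψ.free σ :=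
    fun σ d => σ.set_agreeOn d W.z_notMem_free
  have hz : ∀ (σ : State M) (d : M.Val (natVar L z).ty),
      (σ.set (natVar L z) d).eval I (natExpr L z) = d := fun σ d => σ.set_simple_self _ d
  refine .consequence (.intro fun σ _ hp => ?_) hsub (.intro fun σ _ hp => ?_)
  · rw [Assn.sat_substMany I σ _ hinj, State.setMany_one, Assn.sat_at,
      Ψ.sat_congr I (hag _ _), eval_pushExpr, hz]
    rwa [Assn.sat_at, eval_pushExpr] at hp
  · rw [Assn.sat_substMany I σ _ hinj, State.setMany_one, Assn.sat_at,
      Ψ.sat_congr I (hag _ _), hz] at hp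
    rwa [Assn.sat_at]

theorem disjoint_vars_z : Disjoint (natExpr L z).vars V :=
  Set.disjoint_singleton_left.2 W.z_notMem

theorem eval_z_set {x : SVar L} (hx : Var.simple x ∈ V) (σ : State M) (d : M.Val x.ty) :
    (σ.set x d).eval I (natExpr L z) = σ.eval I (natExpr L z) :=
  σ.set_simple_of_ne d fun e => W.z_notMem (e ▸ hx)

omit W in
theorem eval_setMany {n : ℕ} {x : Fin n → SVar L} (hx : varSet x ⊆ V) (σ : State M)
    (d : ∀ i, M.Val (x i).ty) {e : PExpr L .nat} (he : Disjoint e.vars V) :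
    (σ.setMany x d).eval I e = σ.eval I e :=
  Expr.eval_congr I _ e (σ.setMany_agreeOn d fun i hi =>
    Set.disjoint_left.1 he hi (hx ⟨i, rfl⟩))

/-- The step from `S` and the stack `z`, as an implication between preconditions. -/
theorem wp_of_sat {S : Stmt H} (hS : S ∈ N) {σ σ' : State M} {k' : ℕ} (hσ : σ.Enumerates h)
    (hp : (Ψ.at (pushExpr N S (natExpr L z))).sat I σ Env.nil)
    (hs : StmtStep I D N (σ.dec h) S (σ.eval I (natExpr L z)) σ k' σ') :
    WP I D N (σ.dec h) q k' σ' := by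
  have hw := (W.sat_at_iff hσ _).1 hp
  rw [eval_pushExpr] at hw
  exact hw.stmtStep hS hs

/-- The triple for a block, where `S` is the block itself or a call that is executed as this
block. The old values of the local variables are frozen in a fresh variable `y`, as the code of a
tuple; the rest of the execution then starts with restoring the values that `y` codes. -/
theorem derive_block {S : Stmt H} (hS : S ∈ N) {n : ℕ} {x : Fin n → SVar L}
    {hx : Function.Injective x} {t : ∀ i, PExpr L (x i).ty} {B : Stmt H}
    (hvars : (Stmt.block x hx t B).vars ⊆ V) (hglob : Disjoint (varSet x) D.globals)
    (henter : ∀ r σ k' σ', EnterStep I N (σ.dec h) S x t B r σ k' σ' →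
      StmtStep I D N (σ.dec h) S r σ k' σ')
    (hrestore : ∀ r c (σ : State M), RestoreStep (σ.dec h) S r c σ r
      (σ.setMany x (tupleOf (σ.dec h) (fun i => (x i).ty) c)))
    (hd : SPR I D h A ⟨Ψ.at (pushExpr N B (natExpr L z)), B, Ψ.at (natExpr L z)⟩) :
    SPR I D h A ⟨Ψ.at (pushExpr N S (natExpr L z)), .block x hx t B, Ψ.at (natExpr L z)⟩ := by
  have hxV : varSet x ⊆ V := (Set.subset_union_left.trans Set.subset_union_left).trans hvars
  have hyx : ∀ i, x i ≠ natVar L y := fun i e => W.y_notMem (e ▸ hxV ⟨i, rfl⟩)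
  have hy : Disjoint (natExpr L y).vars V := Set.disjoint_singleton_left.2 W.y_notMem
  let K : PExpr L .nat := frameExpr N 1 S (natExpr L z) (natExpr L y)
  have hK : Disjoint K.vars V := Disjoint.mono_left (vars_frameExpr_subset _ _ _ _ _)
    (Set.disjoint_union_left.2 ⟨W.disjoint_vars_z, hy⟩)
  -- the values that are to be restored, and the assertion that they are the current values
  let u : ∀ i, PExpr L (x i).ty := decTupleExpr h (fun i => (x i).ty) (natExpr L y)
  let E : Assertion L := .atom (.conj fun i => .eq (.var (x i)) (u i))
  have huvars : ∀ i, (u i).vars ⊆ {v | v = Var.simple (natVar L y) ∨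
      ∃ T, v = Var.array (enumVar h T)} := by
    intro i v hv
    rcases hv with rfl | hv
    · exact .inr ⟨_, rfl⟩
    · obtain ⟨_, hv⟩ := Set.mem_iUnion.1 hv
      obtain ⟨j, hv⟩ := Set.mem_iUnion.1 hv
      fin_cases j
      · exact .inl hv
      · obtain ⟨j, -⟩ := Set.mem_iUnion.1 hv
        exact j.elim0
  have hE : ∀ σ : State M, E.sat I σ Env.nil ↔ ∀ i, σ.simple (x i) =
      tupleOf (σ.dec h) (fun i => (x i).ty) (σ.eval I (natExpr L y)) i := fun σ =>
    (Expr.eval_conj_iff I σ Env.nil _).trans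
      (forall_congr' fun i => Expr.eval_eq_iff I σ Env.nil (.var (x i)) (u i))
  have hseq : SPR I D h A ⟨.conj E (Ψ.at (pushExpr N S (natExpr L z))), .seq (.par x hx t) B,
      (Ψ.at (natExpr L z)).substMany x u⟩ := by
    refine .seq (.consequence (.intro fun σ hσ hp => ?_)
      (.par (Ψ.at (pushExpr N B K)) x hx t) (.refl _)) (.consequence (.refl _)
      (W.instantiate (Set.subset_union_right.trans hvars) hK hd) (.intro fun σ hσ hp => ?_))
    · rw [Assn.sat_substMany I σ _ hx]
      refine (W.sat_at_iff (σ := σ.setMany x fun i => σ.eval I (t i)) hσ _).2 ?_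
      rw [eval_setMany hxV _ _ (hK.mono_left (vars_pushExpr_subset N B K)), eval_pushExpr,
        eval_frameExpr]
      have hw := (W.sat_at_iff hσ _).1 hp.2
      rw [eval_pushExpr] at hw
      exact hw.stmtStep hS (henter _ _ _ _ ⟨⟨_, (hE σ).1 hp.1, rfl⟩, rfl⟩)
    · rw [Assn.sat_substMany I σ _ hx]
      refine (W.sat_at_iff (σ := σ.setMany x fun i => σ.eval I (u i)) hσ _).2 ?_
      rw [eval_setMany hxV _ _ W.disjoint_vars_z]
      have hw := (W.sat_at_iff hσ _).1 hp
      rw [eval_frameExpr] at hw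
      exact WP.restoreStep hS hw (hrestore _ _ _)
  have hblock : SPR I D h A ⟨.conj E (Ψ.at (pushExpr N S (natExpr L z))), .block x hx t B,
      (Ψ.at (natExpr L z)).substMany x u⟩ := by
    refine .block ((Ψ.at (natExpr L z)).disjoint_free_substMany hx u fun i j hij => ?_) hseq
    rcases huvars j hij with e | ⟨T, e⟩
    · exact hyx i (Var.simple.inj e)
    · cases e
  have hinv : Disjoint E.free (D.change ∪ (Stmt.block x hx t B).change) := by
    have hDV := (D.change_subset_globals.trans D.globals_subset_vars).trans W.decl_vars
    have hBV := ((Stmt.change_subset_globals _).trans (Stmt.globals_subset_vars _)).trans hvars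
    rw [Set.disjoint_left]
    intro v hv hv'
    obtain ⟨i, hv⟩ := Set.mem_iUnion.1 (Expr.vars_conj_subset _ hv)
    rcases Expr.vars_eq_subset _ _ hv with rfl | hv
    · rcases hv' with hv' | hv'
      · exact Set.disjoint_left.1 hglob ⟨i, rfl⟩ (D.change_subset_globals hv')
      · exact hv'.2 ⟨i, rfl⟩
    · rcases huvars i hv with rfl | ⟨T, rfl⟩
      · exact W.y_notMem (Set.union_subset hDV hBV hv')
      · exact W.enumVar_notMem T (Set.union_subset hDV hBV hv')
  have hfrozen : SPR I D h A ⟨.conj E (.conj E (Ψ.at (pushExpr N S (natExpr L z)))),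
      .block x hx t B, Ψ.at (natExpr L z)⟩ := by
    refine .consequence (.refl _) (.invariance hinv hblock) (.intro fun σ _ hp => ?_)
    have h₂ := hp.2
    rw [Assn.sat_substMany I σ _ hx] at h₂
    rwa [show (σ.setMany x fun i => σ.eval I (u i)) = σ by
      rw [← show (fun i => σ.simple (x i)) = fun i => σ.eval I (u i) from
        funext fun i => (hE σ).1 hp.1 i]
      exact σ.setMany_self hx] at h₂
  have hfree : Var.simple (natVar L y) ∉ D.vars ∪ (Stmt.block x hx t B).vars ∪
      (Ψ.at (natExpr L z)).free := by
    rintro (hv | hv)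
    · exact W.y_notMem (Set.union_subset W.decl_vars hvars hv)
    · rcases Ψ.free_at_subset _ hv with hv | hv
      · exact W.ne (Var.simple.inj hv)
      · exact W.y_notMem_free hv
  refine (SPR.existsIntro (natVar L y) hfree hfrozen).conseq_left (.intro fun σ hσ hp => ?_)
  rw [Assn.sat_exists]
  obtain ⟨c, hc⟩ := hσ.exists_decTuple (A := fun i => (x i).ty) fun i => σ.simple (x i)
  have hyc : (σ.set (natVar L y) c).eval I (natExpr L y) = c :=
    State.set_simple_self σ (natVar L y) c
  have hEc : E.sat I (σ.set (natVar L y) c) Env.nil := by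
    rw [hE]
    intro i
    rw [State.set_simple_of_ne _ _ (hyx i), hyc]
    exact hc i
  refine ⟨c, hEc, hEc, ?_⟩
  rw [Assn.sat_at, Ψ.sat_congr I (σ.set_agreeOn c W.y_notMem_free), eval_pushExpr,
    show (σ.set (natVar L y) c).eval I (natExpr L z) = σ.eval I (natExpr L z) from
      State.set_simple_of_ne σ (x := natVar L y) (y := natVar L z) c W.ne.symm,
    ← eval_pushExpr, ← Assn.sat_at]
  exact hp

/-- From the triples for the calls, the triples for all statements of the program are derivable:
before `S` the weakest precondition for the stack with `S` on top of `z` holds, and afterwards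
the one for the stack `z`. -/
theorem derive (hA : ∀ P t, Stmt.call P t ∈ N →
      (⟨Ψ.at (pushExpr N (.call P t) (natExpr L z)), .call P t, Ψ.at (natExpr L z)⟩ : Triple H) ∈ A)
    (S : Stmt H) (hS : S ∈ N) :
    SPR I D h A ⟨Ψ.at (pushExpr N S (natExpr L z)), S, Ψ.at (natExpr L z)⟩ := by
  induction S with
  | skip =>
    refine (SPR.skip _).conseq_left (.intro fun σ hσ hp => ?_)
    exact (W.sat_at_iff hσ _).2 (W.wp_of_sat (σ := σ) hS hσ hp ⟨rfl, rfl⟩)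
  | assign x t =>
    have hxV : Var.simple x ∈ V := W.vars (.assign x t) hS (Or.inl rfl)
    refine (SPR.assign _ x t).conseq_left (.intro fun σ hσ hp => ?_)
    rw [Assn.sat_substOne]
    refine (W.sat_at_iff (σ := σ.set x (σ.eval I t)) hσ _).2 ?_
    rw [W.eval_z_set hxV]
    change WP I D N (σ.dec h) _ _ _
    exact W.wp_of_sat (σ := σ) hS hσ hp ⟨rfl, rfl⟩
  | assignArr a s t =>
    refine (SPR.assignArr _ a s t).conseq_left (.intro fun σ hσ hp => ?_)
    rw [Assn.sat_substArr]
    have haV : Var.array a ∈ V := W.vars (.assignArr a s t) hS (Or.inl (Or.inl rfl))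
    have hne : ∀ T, a ≠ enumVar h T := fun T e => W.enumVar_notMem T (e ▸ haV)
    have hdec := σ.dec_setArr hne (fun i => σ.eval I (s i)) (σ.eval I t)
    have hσ' : (σ.setArr a (fun i => σ.eval I (s i)) (σ.eval I t)).Enumerates h := fun T => by
      have := hσ T
      rwa [show (fun k : ℕ => σ.array (enumVar h T) fun _ => k) = σ.dec h T from rfl,
        ← hdec] at this
    refine (W.sat_at_iff hσ' _).2 ?_
    rw [hdec]
    exact W.wp_of_sat (σ := σ) hS hσ hp (And.intro rfl rfl)
  | par x hx t =>
    have hxV : varSet x ⊆ V := Set.subset_union_left.trans (W.vars (.par x hx t) hS)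
    refine (SPR.par _ x hx t).conseq_left (.intro fun σ hσ hp => ?_)
    rw [Assn.sat_substMany I σ _ hx]
    refine (W.sat_at_iff (σ := σ.setMany x fun i => σ.eval I (t i)) hσ _).2 ?_
    rw [eval_setMany hxV _ _ W.disjoint_vars_z]
    change WP I D N (σ.dec h) _ _ _
    exact W.wp_of_sat (σ := σ) hS hσ hp ⟨rfl, rfl⟩
  | seq S₁ S₂ ih₁ ih₂ =>
    have hS₁ : S₁ ∈ N := W.closed.subs _ hS (by simp [Stmt.subs, S₁.mem_subs])
    have hS₂ : S₂ ∈ N := W.closed.subs _ hS (by simp [Stmt.subs, S₂.mem_subs])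
    refine .seq ((W.instantiate (W.vars _ hS₁) (W.disjoint_vars_z.mono_left
      (vars_pushExpr_subset N S₂ _)) (ih₁ hS₁)).conseq_left (.intro fun σ hσ hp => ?_)) (ih₂ hS₂)
    rw [W.sat_at_iff hσ, eval_pushExpr, eval_pushExpr]
    exact W.wp_of_sat (σ := σ) hS hσ hp ⟨rfl, rfl⟩
  | cond B S₁ S₂ ih₁ ih₂ =>
    have hS₁ : S₁ ∈ N := W.closed.subs _ hS (by simp [Stmt.subs, S₁.mem_subs])
    have hS₂ : S₂ ∈ N := W.closed.subs _ hS (by simp [Stmt.subs, S₂.mem_subs])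
    refine .cond ((ih₁ hS₁).conseq_left (.intro fun σ hσ hp => ?_))
      ((ih₂ hS₂).conseq_left (.intro fun σ hσ hp => ?_))
    · rw [W.sat_at_iff hσ, eval_pushExpr]
      exact W.wp_of_sat (σ := σ) hS hσ hp.1 ⟨.inl ⟨hp.2, rfl⟩, rfl⟩
    · rw [W.sat_at_iff hσ, eval_pushExpr]
      exact W.wp_of_sat (σ := σ) hS hσ hp.1 ⟨.inr ⟨Bool.eq_false_of_not_eq_true hp.2, rfl⟩, rfl⟩
  | guard B S' ih =>
    have hS' : S' ∈ N := W.closed.subs _ hS (by simp [Stmt.subs, S'.mem_subs])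
    have hB : ∀ σ : State M, σ.Enumerates h →
        (Ψ.at (pushExpr N (.guard B S') (natExpr L z))).sat I σ Env.nil →
        σ.eval I B = true := by
      intro σ hσ hp
      have hw := (W.sat_at_iff hσ _).1 hp
      rw [eval_pushExpr] at hw
      exact hw.guarded hS
    refine .guard (.intro hB) ((ih hS').conseq_left (.intro fun σ hσ hp => ?_))
    rw [W.sat_at_iff hσ, eval_pushExpr]
    exact W.wp_of_sat (σ := σ) hS hσ hp ⟨⟨hB σ hσ hp, rfl⟩, rfl⟩
  | loop B S' ih =>
    have hS' : S' ∈ N := W.closed.subs _ hS (by simp [Stmt.subs, S'.mem_subs])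
    refine .consequence (.refl _) (.loop ((W.instantiate (W.vars _ hS') (W.disjoint_vars_z.mono_left
      (vars_pushExpr_subset N (.loop B S') _)) (ih hS')).conseq_left (.intro fun σ hσ hp => ?_)))
      (.intro fun σ hσ hp => ?_)
    · rw [W.sat_at_iff hσ, eval_pushExpr, eval_pushExpr]
      exact W.wp_of_sat (σ := σ) hS hσ hp.1 ⟨.inl ⟨hp.2, rfl⟩, rfl⟩
    · rw [W.sat_at_iff hσ]
      exact W.wp_of_sat (σ := σ) hS hσ hp.1 ⟨.inr ⟨Bool.eq_false_of_not_eq_true hp.2, rfl⟩, rfl⟩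
  | block x hx t B ih =>
    have hB : B ∈ N := W.closed.subs _ hS (by simp [Stmt.subs, B.mem_subs])
    exact W.derive_block hS (W.vars _ hS) ((W.locals _ hS).mono_left Set.subset_union_left)
      (fun _ _ _ _ hs => hs) (fun _ _ _ => ⟨rfl, rfl⟩) (ih hB)
  | call P t => exact .assumption (hA P t hS)

/-- The triple for the block by which a call is replaced. -/
theorem derive_callBlock (hA : ∀ P t, Stmt.call P t ∈ N →
      (⟨Ψ.at (pushExpr N (.call P t) (natExpr L z)), .call P t, Ψ.at (natExpr L z)⟩ : Triple H) ∈ A)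
    {P : Fin H.num} {t : ∀ i, PExpr L (H.formal P i).ty} (hP : Stmt.call P t ∈ N) :
    SPR I D h A ⟨Ψ.at (pushExpr N (.call P t) (natExpr L z)), D.callBlock P t,
      Ψ.at (natExpr L z)⟩ := by
  refine W.derive_block hP ?_ (W.formals.mono_left (Set.subset_iUnion
    (fun P => varSet (H.formal P)) P)) (fun _ _ _ _ hs => hs) (fun _ _ _ => ⟨rfl, rfl⟩)
    (W.derive hA _ (W.closed.body P))
  exact Set.union_subset (Set.union_subset ((Set.subset_union_left.trans (Set.subset_iUnion
    (fun P => varSet (H.formal P) ∪ (D.body P).vars) P)).trans W.decl_vars) (W.vars _ hP))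
    (W.vars _ (W.closed.body P))

/-- The recursion rule yields the triples for all statements of the program. -/
theorem recursionRule {S : Stmt H} (hS : S ∈ N) {r : PExpr L .nat} (hr : Disjoint r.vars V) :
    RecursionRule I D h ⟨Ψ.at (pushExpr N S r), S, Ψ.at r⟩ := by
  let toCall : Stmt H → Option (CallTriple H)
    | .call P t => some ⟨Ψ.at (pushExpr N (.call P t) (natExpr L z)), P, t, Ψ.at (natExpr L z)⟩
    | _ => none
  have hA : ∀ P t, Stmt.call P t ∈ N → (⟨Ψ.at (pushExpr N (.call P t) (natExpr L z)), .call P t,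
      Ψ.at (natExpr L z)⟩ : Triple H) ∈ {G | ∃ c ∈ N.filterMap toCall, G = c.toTriple} :=
    fun P t hP => ⟨_, List.mem_filterMap.2 ⟨_, hP, rfl⟩, rfl⟩
  refine ⟨N.filterMap toCall, W.instantiate (W.vars S hS) hr (W.derive hA S hS), fun c hc => ?_⟩
  obtain ⟨T, hT, hc⟩ := List.mem_filterMap.1 hc
  cases T with
  | call P t =>
    cases hc
    exact W.derive_callBlock hA hT
  | _ => cases hc

end WPData

theorem Stmt.vars_subs_subset {S T : Stmt H} (hT : T ∈ S.subs) : T.vars ⊆ S.vars := by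
  induction S with
  | seq S₁ S₂ ih₁ ih₂ =>
    rcases List.mem_cons.1 hT with rfl | hT
    · exact subset_rfl
    · rcases List.mem_append.1 hT with hT | hT
      · exact (ih₁ hT).trans Set.subset_union_left
      · exact (ih₂ hT).trans Set.subset_union_right
  | cond B S₁ S₂ ih₁ ih₂ =>
    rcases List.mem_cons.1 hT with rfl | hT
    · exact subset_rfl
    · rcases List.mem_append.1 hT with hT | hT
      · exact (ih₁ hT).trans (Set.subset_union_right.trans Set.subset_union_left)
      · exact (ih₂ hT).trans Set.subset_union_right
  | guard B S ih | loop B S ih | block x hx t S ih =>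
    rcases List.mem_cons.1 hT with rfl | hT
    · exact subset_rfl
    · exact (ih hT).trans Set.subset_union_right
  | _ =>
    obtain rfl := List.mem_singleton.1 hT
    exact subset_rfl

theorem Stmt.locals_subs_subset {S T : Stmt H} (hT : T ∈ S.subs) : T.locals ⊆ S.locals := by
  induction S with
  | seq S₁ S₂ ih₁ ih₂ | cond B S₁ S₂ ih₁ ih₂ =>
    rcases List.mem_cons.1 hT with rfl | hT
    · exact subset_rfl
    · rcases List.mem_append.1 hT with hT | hT
      · exact (ih₁ hT).trans Set.subset_union_left
      · exact (ih₂ hT).trans Set.subset_union_right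
  | guard B S ih | loop B S ih =>
    rcases List.mem_cons.1 hT with rfl | hT
    · exact subset_rfl
    · exact ih hT
  | block x hx t S ih =>
    rcases List.mem_cons.1 hT with rfl | hT
    · exact subset_rfl
    · exact (ih hT).trans Set.subset_union_right
  | _ =>
    obtain rfl := List.mem_singleton.1 hT
    exact subset_rfl

/-- The list of all statements in the program with main statement `S` and declarations `D`. -/
def programStmts (D : Decls H) (S : Stmt H) : List (Stmt H) :=
  S.subs ++ (List.finRange H.num).flatMap fun P => (D.body P).subs

theorem mem_programStmts {S T : Stmt H} :
    T ∈ programStmts D S ↔ T ∈ S.subs ∨ ∃ P, T ∈ (D.body P).subs := by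
  simp [programStmts]

theorem closed_programStmts (D : Decls H) (S : Stmt H) : Closed D (programStmts D S) where
  subs T hT U hU := by
    rw [mem_programStmts] at hT ⊢
    exact hT.imp (fun hT => Stmt.subs_subset hT hU) fun ⟨P, hT⟩ => ⟨P, Stmt.subs_subset hT hU⟩
  body P := mem_programStmts.2 (.inr ⟨P, (D.body P).mem_subs⟩)

theorem exists_natVar_notMem {X : Set (Var L)} (hX : X.Finite) :
    ∃ m, Var.simple (natVar L m) ∉ X := by
  by_contra! hall
  refine Set.infinite_univ (α := ℕ) (Set.Finite.subset (hX.preimage (f := fun m =>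
    Var.simple (natVar L m)) fun a _ b _ hab => ?_) fun m _ => hall m)
  cases hab
  rfl

/-- For every postcondition there are an assertion that expresses the weakest preconditions and
fresh variables. -/
theorem exists_wpData (I : M.Interp) {S : Stmt H} (hclash : NoClash D S)
    (hfresh : ∀ T : L.Ty, Var.array (enumVar h T) ∉ D.vars ∪ S.vars) (q : Assertion L) :
    ∃ Ψ z y, WPData I D h q (programStmts D S) (D.vars ∪ S.vars) Ψ z y := by
  have hfin : (D.vars ∪ S.vars).Finite := D.finite_vars.union S.finite_vars
  have hV : {v | v ∈ hfin.toFinset.toList} = D.vars ∪ S.vars := by ext v; simp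
  have hvars : ∀ T ∈ programStmts D S, T.vars ⊆ D.vars ∪ S.vars := by
    intro T hT
    rcases mem_programStmts.1 hT with hT | ⟨P, hT⟩
    · exact (Stmt.vars_subs_subset hT).trans Set.subset_union_right
    · exact ((Stmt.vars_subs_subset hT).trans Set.subset_union_right).trans
        ((Set.subset_iUnion (fun P => varSet (H.formal P) ∪ (D.body P).vars) P).trans
          Set.subset_union_left)
  obtain ⟨Ψ, hΨ⟩ := exists_assn_wp (N := programStmts D S) (V := hfin.toFinset.toList) I h D
    (fun T hT => hV.symm ▸ hvars T hT) (fun P => by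
      rw [hV]
      exact (Set.subset_union_left.trans (Set.subset_iUnion (fun P =>
        varSet (H.formal P) ∪ (D.body P).vars) P)).trans Set.subset_union_left) q
  obtain ⟨z, hz⟩ := exists_natVar_notMem (hfin.union Ψ.finite_free)
  obtain ⟨y, hy⟩ := exists_natVar_notMem ((hfin.union Ψ.finite_free).insert
    (Var.simple (natVar L z)))
  refine ⟨Ψ, z, y, closed_programStmts D S, hvars, Set.subset_union_left, hfresh, ?_,
    hclash.formals_disjoint, hΨ, fun hv => hz (.inl hv), fun hv => hy (.inr (.inl hv)),
    fun hv => hz (.inr hv), fun hv => hy (.inr (.inr hv)), fun e => hy (.inl (e ▸ rfl))⟩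
  intro T hT
  refine hclash.locals_disjoint.mono ?_ Set.subset_union_right
  rcases mem_programStmts.1 hT with hT | ⟨P, hT⟩
  · exact (Stmt.locals_subs_subset hT).trans Set.subset_union_left
  · exact (Stmt.locals_subs_subset hT).trans
      ((Set.subset_iUnion (fun P => (D.body P).locals) P).trans Set.subset_union_right)

end Derivation

end RecProg

theorem mainTheorem4 {L : RecProg.Lang} (M : RecProg.Model L) (I : M.Interp)
    {H : RecProg.Header L} (D : RecProg.Decls H) (S : RecProg.Stmt H)
    (hclash : RecProg.NoClash D S)
    (h : L.Ty → ℕ)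
    (hfresh : ∀ T : L.Ty, RecProg.Var.array (RecProg.enumVar h T) ∉ D.vars ∪ S.vars)
    (p q : RecProg.Assertion L)
    (hvalid : RecProg.Triple.ValidSP I D h ⟨p, S, q⟩) :
    RecProg.SPRPlus I D h ⟨p, S, q⟩ := by
  obtain ⟨Ψ, z, y, W⟩ := exists_wpData I hclash hfresh q
  have hS : S ∈ programStmts D S := mem_programStmts.2 (.inl S.mem_subs)
  let r : PExpr L .nat := .op (.natConst emptyStack) fun i => i.elim0
  have hr : Disjoint r.vars (D.vars ∪ S.vars) :=
    Disjoint.mono_left (Set.iUnion_subset fun i => i.elim0) (Set.empty_disjoint _)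
  refine .consequence (.intro fun σ hσ hp => ?_) (.assumption (W.recursionRule hS hr))
    (.intro fun σ hσ hp => ((W.sat_at_iff hσ r).1 hp).sat)
  rw [W.sat_at_iff hσ, eval_pushExpr]
  refine wp_of_semSP W.closed hS fun o ho => ?_
  obtain ⟨τ, hτ, rfl⟩ := hvalid (Set.mem_biUnion (show σ ∈ p.states I h from ⟨hσ, hp⟩) ho)
  exact ⟨τ, rfl, hτ.2⟩
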